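/- Let $d\ge 1$, $1\le p<\infty$, let $\Omega\subset\mathbb{R}^d$ be open (not necessarily bounded or connected), and let $(\nu_\varepsilon)_{\varepsilon>0}$ be measurable radial functions $\nu_\varepsilon:\mathbb{R}^d\setminus\{0\}\to[0,\infty]$ such that, for all $\varepsilon>0$ and all $\delta>0$, $$\int_{\mathbb{R}^d}(1\wedge|h|^p)\,\nu_\varepsilon(h)\,dh=1,\qquad \lim_{\varepsilon\to0^+}\int_{|h|>\delta}(1\wedge|h|^p)\,\nu_\varepsilon(h)\,dh=0 .$$ Let $K_{d,p}$ be the mean value of $w\mapsto|w\cdot e|^p$ over the unit sphere $\mathbb{S}^{d-1}$ with respect to surface measure, where $e$ is any unit vector (the value does not depend on $e$). Notation. $W^{1,p}(\Omega)$ is the space of $u\in L^p(\Omega)$ whose distributional gradient $\nabla u$ is in $L^p(\Omega)$, with $\|u\|_{W^{1,p}(\Omega)}^p=\|u\|_{L^p(\Omega)}^p+\|\nabla u\|_{L^p(\Omega)}^p$; put $\|\nabla u\|_{L^p(\Omega)}=\infty$ if $\nabla u$ is not a function in $L^p(\Omega)$. For $u\in L^1(\Omega)$ let $$|u|_{BV(\Omega)}=\sup\Big\{\int_\Omega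 u\,\operatorname{div}\phi\,dx:\ \phi\in C_c^\infty(\Omega,\mathbb{R}^d),\ |\phi|\le1\Big\}\in[0,\infty],$$ let $BV(\Omega)=\{u\in L^1(\Omega):|u|_{BV(\Omega)}<\infty\}$ with $\|u\|_{BV(\Omega)}=\|u\|_{L^1(\Omega)}+|u|_{BV(\Omega)}$, and for $v\in BV(\mathbb{R}^d)$ let $|\nabla v|$ be the total variation measure of its gradient, that is, the outer regular Borel measure with $|\nabla v|(U)=|v|_{BV(U)}$ for $U$ open. The set $\Omega$ is a $W^{1,p}$-extension domain if there are a linear map $E:W^{1,p}(\Omega)\to W^{1,p}(\mathbb{R}^d)$ and a constant $C$ with $Eu|_\Omega=u$ and $\|Eu\|_{W^{1,p}(\mathbb{R}^d)}\le C\|u\|_{W^{1,p}(\Omega)}$ for all $u$. It is a $BV$-extension domain if there are a linear map $E:BV(\Omega)\to BV(\mathbb{R}^d)$ and a constant $C$ with $Eu|_\Omega=u$, $\|Eu\|_{BV(\mathbb{R}^d)}\le C\|u\|_{BV(\Omega)}$ and $|\nabla Eu|(\partial\Omega)=0$ for all $u\in BV(\Omega)$. (1) Let $\Omega$ be a $W^{1,p}$-extension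 domain. If $1<p<\infty$ and $u\in L^p(\Omega)$, or if $p=1$ and $u\in W^{1,1}(\Omega)$, then $$\lim_{\varepsilon\to0^+}\int_\Omega\int_\Omega|u(x)-u(y)|^p\,\nu_\varepsilon(x-y)\,dy\,dx=K_{d,p}\,\|\nabla u\|_{L^p(\Omega)}^p .$$ (2) Let $p=1$ and let $\Omega$ be a $BV$-extension domain. Then for every $u\in L^1(\Omega)$ $$\lim_{\varepsilon\to0^+}\int_\Omega\int_\Omega|u(x)-u(y)|\,\nu_\varepsilon(x-y)\,dy\,dx=K_{d,1}\,|u|_{BV(\Omega)} .$$ Both limits are in $[0,\infty]$; the value $\infty$ is allowed on both sides. -/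

import Mathlib

open MeasureTheory Filter Topology Set
open scoped ENNReal NNReal ContDiff

/-- `ℝ^d` with its Euclidean norm and Lebesgue measure. -/
abbrev RSpace (d : ℕ) : Type := EuclideanSpace ℝ (Fin d)

/-- `φ ∈ C_c^∞(Ω, F)`, seen as a function on `ℝ^d`. -/
def IsTestFunction {d : ℕ} {F : Type*} [NormedAddCommGroup F] [NormedSpace ℝ F]
    (Ω : Set (RSpace d)) (φ : RSpace d → F) : Prop :=
  ContDiff ℝ ∞ φ ∧ HasCompactSupport φ ∧ tsupport φ ⊆ Ω

/-- The divergence `∑ i, ∂φ_i/∂x_i` of a vector field. -/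
noncomputable def divergence {d : ℕ} (φ : RSpace d → RSpace d) (x : RSpace d) : ℝ :=
  ∑ i : Fin d, (fderiv ℝ φ x (EuclideanSpace.single i 1)) i

/-- `g ∈ L^1_loc(Ω, ℝ^d)` is the distributional gradient on `Ω` of `u ∈ L^1_loc(Ω)`. -/
def HasWeakGradient {d : ℕ} (Ω : Set (RSpace d)) (u : RSpace d → ℝ)
    (g : RSpace d → RSpace d) : Prop :=
  LocallyIntegrableOn u Ω ∧ LocallyIntegrableOn g Ω ∧
    ∀ φ : RSpace d → ℝ, IsTestFunction Ω φ → ∀ v : RSpace d,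
      ∫ x in Ω, u x * fderiv ℝ φ x v = - ∫ x in Ω, inner ℝ (g x) v * φ x

/-- `‖∇u‖_{L^p(Ω)}^p`. The weak gradient is unique up to null sets, so the infimum is over at most
one value; it is `∞` if `u` has no weak gradient in `L^1_loc(Ω)`, or one that is not in `L^p(Ω)`. -/
noncomputable def gradEnergy {d : ℕ} (Ω : Set (RSpace d)) (p : ℝ) (u : RSpace d → ℝ) : ℝ≥0∞ :=
  ⨅ (g : RSpace d → RSpace d) (_ : HasWeakGradient Ω u g), ∫⁻ x in Ω, ‖g x‖ₑ ^ p

/-- `u ∈ W^{1,p}(Ω)`. -/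
def MemW1p {d : ℕ} (Ω : Set (RSpace d)) (p : ℝ) (u : RSpace d → ℝ) : Prop :=
  MemLp u (ENNReal.ofReal p) (volume.restrict Ω) ∧
    ∃ g : RSpace d → RSpace d,
      HasWeakGradient Ω u g ∧ MemLp g (ENNReal.ofReal p) (volume.restrict Ω)

/-- `‖u‖_{W^{1,p}(Ω)} = (‖u‖_{L^p(Ω)}^p + ‖∇u‖_{L^p(Ω)}^p)^{1/p}`. -/
noncomputable def normW1p {d : ℕ} (Ω : Set (RSpace d)) (p : ℝ) (u : RSpace d → ℝ) : ℝ≥0∞ :=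
  ((∫⁻ x in Ω, ‖u x‖ₑ ^ p) + gradEnergy Ω p u) ^ (1 / p)

/-- `|u|_{BV(Ω)}`, with value `∞` if `u` is not of bounded variation. -/
noncomputable def bvSeminorm {d : ℕ} (Ω : Set (RSpace d)) (u : RSpace d → ℝ) : ℝ≥0∞ :=
  ⨆ (φ : RSpace d → RSpace d) (_ : IsTestFunction Ω φ ∧ ∀ x, ‖φ x‖ ≤ 1),
    ENNReal.ofReal (∫ x in Ω, u x * divergence φ x)

/-- `u ∈ BV(Ω)`. -/
def MemBV {d : ℕ} (Ω : Set (RSpace d)) (u : RSpace d → ℝ) : Prop :=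
  MemLp u 1 (volume.restrict Ω) ∧ bvSeminorm Ω u < ⊤

/-- `‖u‖_{BV(Ω)} = ‖u‖_{L^1(Ω)} + |u|_{BV(Ω)}`. -/
noncomputable def normBV {d : ℕ} (Ω : Set (RSpace d)) (u : RSpace d → ℝ) : ℝ≥0∞ :=
  (∫⁻ x in Ω, ‖u x‖ₑ) + bvSeminorm Ω u

/-- The value `|∇v|(A)` of the total variation measure of `v : ℝ^d → ℝ`: on an open set `U` it is
`|v|_{BV(U)}`, and it is extended to all sets by outer regularity. -/
noncomputable def variationMeasure {d : ℕ} (v : RSpace d → ℝ) (A : Set (RSpace d)) : ℝ≥0∞ :=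
  ⨅ (U : Set (RSpace d)) (_ : IsOpen U ∧ A ⊆ U), bvSeminorm U v

section Helpers

theorem integrable_mul_of_compactSupport {d : ℕ} {Ω : Set (RSpace d)} {u ψ : RSpace d → ℝ}
    (hu : LocallyIntegrableOn u Ω) (hc : Continuous ψ) (hs : HasCompactSupport ψ)
    (ht : tsupport ψ ⊆ Ω) : Integrable (fun x => u x * ψ x) (volume.restrict Ω) := by
  have h1 : IntegrableOn u (tsupport ψ) := hu.integrableOn_compact_subset ht hs.isCompact
  have h2 : IntegrableOn (fun x => u x * ψ x) (tsupport ψ) :=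
    h1.mul_continuousOn hc.continuousOn hs.isCompact
  have h3 : Integrable (fun x => u x * ψ x) :=
    (integrableOn_iff_integrable_of_support_subset
      (fun x hx => subset_tsupport ψ (right_ne_zero_of_mul hx))).1 h2
  exact h3.restrict

theorem IsTestFunction.integrable_mul_fderiv {d : ℕ} {Ω : Set (RSpace d)} {u φ : RSpace d → ℝ}
    (hu : LocallyIntegrableOn u Ω) (hφ : IsTestFunction Ω φ) (v : RSpace d) :
    Integrable (fun x => u x * fderiv ℝ φ x v) (volume.restrict Ω) := by
  have hsub : tsupport (fun x => fderiv ℝ φ x v) ⊆ tsupport φ := tsupport_fderiv_apply_subset ℝ v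
  refine integrable_mul_of_compactSupport hu ?_ ?_ (hsub.trans hφ.2.2)
  · exact (hφ.1.continuous_fderiv (by simp)).clm_apply continuous_const
  · exact hφ.2.1.fderiv_apply (𝕜 := ℝ) v

theorem IsTestFunction.integrable_inner_mul {d : ℕ} {Ω : Set (RSpace d)} {φ : RSpace d → ℝ}
    {g : RSpace d → RSpace d} (hg : LocallyIntegrableOn g Ω) (hφ : IsTestFunction Ω φ)
    (v : RSpace d) : Integrable (fun x => inner ℝ (g x) v * φ x) (volume.restrict Ω) := by
  refine integrable_mul_of_compactSupport (fun x hx => ?_) hφ.1.continuous hφ.2.1 hφ.2.2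
  obtain ⟨s, hs, hi⟩ := hg x hx
  exact ⟨s, hs, hi.inner_const v⟩

theorem IsTestFunction.integrable_mul_divergence {d : ℕ} {Ω : Set (RSpace d)} {u : RSpace d → ℝ}
    {φ : RSpace d → RSpace d} (hu : LocallyIntegrableOn u Ω) (hφ : IsTestFunction Ω φ) :
    Integrable (fun x => u x * divergence φ x) (volume.restrict Ω) := by
  simp only [divergence, Finset.mul_sum]
  refine integrable_finsetSum _ fun i _ => ?_
  have h1 : tsupport (fun x => (fderiv ℝ φ x (EuclideanSpace.single i 1)) i) ⊆ tsupport φ := by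
    refine (closure_mono ?_).trans
      (tsupport_fderiv_apply_subset ℝ (f := φ) (EuclideanSpace.single i (1 : ℝ)))
    intro x hx h0
    exact hx (by simp only [h0]; rfl)
  refine integrable_mul_of_compactSupport hu ?_
    (hφ.2.1.isCompact.of_isClosed_subset (isClosed_tsupport _) h1) (h1.trans hφ.2.2)
  exact (EuclideanSpace.proj (𝕜 := ℝ) i).continuous.comp
    ((hφ.1.continuous_fderiv (by simp)).clm_apply continuous_const)

theorem HasWeakGradient.congr {d : ℕ} {Ω : Set (RSpace d)} {u w : RSpace d → ℝ}
    {g : RSpace d → RSpace d} (h : HasWeakGradient Ω u g) (huw : u =ᵐ[volume.restrict Ω] w) :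
    HasWeakGradient Ω w g := by
  refine ⟨fun x hx => ?_, h.2.1, fun φ hφ v => ?_⟩
  · obtain ⟨s, hs, hi⟩ := h.1 x hx
    refine ⟨s ∩ Ω, inter_mem hs self_mem_nhdsWithin, ?_⟩
    exact (hi.mono_set inter_subset_left).congr
      (ae_restrict_of_ae_restrict_of_subset inter_subset_right huw)
  · rw [← h.2.2 φ hφ v]
    exact integral_congr_ae (huw.mono fun x hx => by simp only [hx])

theorem LocallyIntegrableOn.add_of {d : ℕ} {F : Type*} [NormedAddCommGroup F]
    {Ω : Set (RSpace d)} {u w : RSpace d → F} (hu : LocallyIntegrableOn u Ω)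
    (hw : LocallyIntegrableOn w Ω) : LocallyIntegrableOn (u + w) Ω :=
  fun x hx => (hu x hx).add (hw x hx)

theorem HasWeakGradient.add {d : ℕ} {Ω : Set (RSpace d)} {u w : RSpace d → ℝ}
    {g k : RSpace d → RSpace d} (hu : HasWeakGradient Ω u g) (hw : HasWeakGradient Ω w k) :
    HasWeakGradient Ω (u + w) (g + k) := by
  refine ⟨LocallyIntegrableOn.add_of hu.1 hw.1, LocallyIntegrableOn.add_of hu.2.1 hw.2.1,
    fun φ hφ v => ?_⟩
  simp only [Pi.add_apply, add_mul, inner_add_left]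
  rw [integral_add (hφ.integrable_mul_fderiv hu.1 v) (hφ.integrable_mul_fderiv hw.1 v),
    integral_add (hφ.integrable_inner_mul hu.2.1 v) (hφ.integrable_inner_mul hw.2.1 v),
    hu.2.2 φ hφ v, hw.2.2 φ hφ v]
  ring

theorem HasWeakGradient.const_smul {d : ℕ} {Ω : Set (RSpace d)} {u : RSpace d → ℝ}
    {g : RSpace d → RSpace d} (c : ℝ) (hu : HasWeakGradient Ω u g) :
    HasWeakGradient Ω (c • u) (c • g) := by
  refine ⟨fun x hx => (hu.1 x hx).smul c, fun x hx => (hu.2.1 x hx).smul c, fun φ hφ v => ?_⟩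
  simp only [Pi.smul_apply, smul_eq_mul, real_inner_smul_left, mul_assoc]
  rw [integral_const_mul, integral_const_mul, hu.2.2 φ hφ v]
  ring

theorem hasWeakGradient_zero {d : ℕ} (Ω : Set (RSpace d)) :
    HasWeakGradient Ω (0 : RSpace d → ℝ) 0 := by
  refine ⟨fun x _ => ⟨univ, univ_mem, by simp⟩, fun x _ => ⟨univ, univ_mem, by simp⟩,
    fun φ _ v => by simp⟩

theorem bvSeminorm_congr {d : ℕ} {Ω : Set (RSpace d)} {u w : RSpace d → ℝ}
    (h : u =ᵐ[volume.restrict Ω] w) : bvSeminorm Ω u = bvSeminorm Ω w := by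
  unfold bvSeminorm
  refine iSup_congr fun φ => iSup_congr fun _ => ?_
  congr 1
  exact integral_congr_ae (h.mono fun x hx => by simp only [hx])

theorem bvSeminorm_zero {d : ℕ} (Ω : Set (RSpace d)) : bvSeminorm Ω (0 : RSpace d → ℝ) = 0 := by
  simp [bvSeminorm]

theorem locallyIntegrableOn_of_memLp_one {d : ℕ} {Ω : Set (RSpace d)} {u : RSpace d → ℝ}
    (hu : MemLp u 1 (volume.restrict Ω)) : LocallyIntegrableOn u Ω :=
  IntegrableOn.locallyIntegrableOn (memLp_one_iff_integrable.1 hu)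

theorem bvSeminorm_add_le {d : ℕ} {Ω : Set (RSpace d)} {u w : RSpace d → ℝ}
    (hu : MemLp u 1 (volume.restrict Ω)) (hw : MemLp w 1 (volume.restrict Ω)) :
    bvSeminorm Ω (u + w) ≤ bvSeminorm Ω u + bvSeminorm Ω w := by
  refine iSup₂_le fun φ hφ => ?_
  simp only [Pi.add_apply, add_mul]
  rw [integral_add (hφ.1.integrable_mul_divergence (locallyIntegrableOn_of_memLp_one hu))
    (hφ.1.integrable_mul_divergence (locallyIntegrableOn_of_memLp_one hw))]
  refine ENNReal.ofReal_add_le.trans (add_le_add ?_ ?_)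
  · exact le_iSup₂ (f := fun (φ : RSpace d → RSpace d)
      (_ : IsTestFunction Ω φ ∧ ∀ x, ‖φ x‖ ≤ 1) =>
        ENNReal.ofReal (∫ x in Ω, u x * divergence φ x)) φ hφ
  · exact le_iSup₂ (f := fun (φ : RSpace d → RSpace d)
      (_ : IsTestFunction Ω φ ∧ ∀ x, ‖φ x‖ ≤ 1) =>
        ENNReal.ofReal (∫ x in Ω, w x * divergence φ x)) φ hφ

theorem divergence_neg {d : ℕ} (φ : RSpace d → RSpace d) (x : RSpace d) :
    divergence (-φ) x = - divergence φ x := by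
  simp [divergence, fderiv_neg]

theorem bvSeminorm_smul_le {d : ℕ} {Ω : Set (RSpace d)} (c : ℝ) (u : RSpace d → ℝ) :
    bvSeminorm Ω (c • u) ≤ ENNReal.ofReal |c| * bvSeminorm Ω u := by
  refine iSup₂_le fun φ hφ => ?_
  simp only [Pi.smul_apply, smul_eq_mul, mul_assoc, integral_const_mul]
  have hle : ∀ ψ : RSpace d → RSpace d, (IsTestFunction Ω ψ ∧ ∀ x, ‖ψ x‖ ≤ 1) →
      ENNReal.ofReal (∫ x in Ω, u x * divergence ψ x) ≤ bvSeminorm Ω u := fun ψ hψ =>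
    le_iSup₂ (f := fun (φ : RSpace d → RSpace d)
      (_ : IsTestFunction Ω φ ∧ ∀ x, ‖φ x‖ ≤ 1) =>
        ENNReal.ofReal (∫ x in Ω, u x * divergence φ x)) ψ hψ
  rcases le_total 0 c with hc | hc
  · rw [ENNReal.ofReal_mul hc, abs_of_nonneg hc]
    gcongr
    exact hle φ hφ
  · rw [← neg_mul_neg, ENNReal.ofReal_mul (neg_nonneg.2 hc), abs_of_nonpos hc, ← integral_neg]
    gcongr
    have h2 := hle (-φ) ⟨⟨hφ.1.1.neg, by
      rw [HasCompactSupport, tsupport, Function.support_neg]; exact hφ.1.2.1, by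
      rw [tsupport, Function.support_neg]; exact hφ.1.2.2⟩, by simpa using hφ.2⟩
    simpa [divergence_neg] using h2

end Helpers

/-- The Sobolev space `W^{1,p}(Ω)` as a linear subspace of `L^p(Ω)`. -/
def sobolevSpace {d : ℕ} (Ω : Set (RSpace d)) (p : ℝ) :
    Submodule ℝ (Lp ℝ (ENNReal.ofReal p) ((volume : Measure (RSpace d)).restrict Ω)) where
  carrier := {u | MemW1p Ω p u}
  zero_mem' := ⟨Lp.memLp _, 0, (hasWeakGradient_zero Ω).congr (Lp.coeFn_zero ..).symm,
    MemLp.zero⟩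
  add_mem' := by
    rintro u w ⟨_, g, hg, hg'⟩ ⟨_, k, hk, hk'⟩
    exact ⟨Lp.memLp _, g + k, (hg.add hk).congr (Lp.coeFn_add u w).symm, hg'.add hk'⟩
  smul_mem' := by
    rintro c u ⟨_, g, hg, hg'⟩
    exact ⟨Lp.memLp _, c • g, (hg.const_smul c).congr (Lp.coeFn_smul c u).symm, hg'.const_smul c⟩

/-- The space `BV(Ω)` as a linear subspace of `L^1(Ω)`. -/
def bvSpace {d : ℕ} (Ω : Set (RSpace d)) :
    Submodule ℝ (Lp ℝ 1 ((volume : Measure (RSpace d)).restrict Ω)) where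
  carrier := {u | MemBV Ω u}
  zero_mem' := ⟨Lp.memLp _, by
    rw [bvSeminorm_congr (Lp.coeFn_zero _ _ _), bvSeminorm_zero]; simp⟩
  add_mem' := by
    rintro u w ⟨hu, hu'⟩ ⟨hw, hw'⟩
    refine ⟨Lp.memLp _, ?_⟩
    rw [bvSeminorm_congr (Lp.coeFn_add u w)]
    exact (bvSeminorm_add_le hu hw).trans_lt (ENNReal.add_lt_top.2 ⟨hu', hw'⟩)
  smul_mem' := by
    rintro c u ⟨_, hu'⟩
    refine ⟨Lp.memLp _, ?_⟩
    rw [bvSeminorm_congr (Lp.coeFn_smul c u)]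
    exact (bvSeminorm_smul_le c u).trans_lt (ENNReal.mul_lt_top ENNReal.ofReal_lt_top hu')

/-- The open set `Ω` is a `W^{1,p}`-extension domain: there is a bounded linear extension operator
`W^{1,p}(Ω) → W^{1,p}(ℝ^d)`. -/
def IsSobolevExtensionDomain {d : ℕ} (Ω : Set (RSpace d)) (p : ℝ) : Prop :=
  IsOpen Ω ∧
    ∃ (T : sobolevSpace Ω p →ₗ[ℝ] sobolevSpace (univ : Set (RSpace d)) p) (C : ℝ≥0),
      ∀ u : sobolevSpace Ω p,
        ((T u).1 : RSpace d → ℝ) =ᵐ[volume.restrict Ω] (u.1 : RSpace d → ℝ) ∧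
        normW1p univ p (T u).1 ≤ C * normW1p Ω p u.1

/-- The open set `Ω` is a `BV`-extension domain: there is a bounded linear extension operator
`BV(Ω) → BV(ℝ^d)`, whose values have a gradient measure that does not charge `∂Ω`. -/
def IsBVExtensionDomain {d : ℕ} (Ω : Set (RSpace d)) : Prop :=
  IsOpen Ω ∧
    ∃ (T : bvSpace Ω →ₗ[ℝ] bvSpace (univ : Set (RSpace d))) (C : ℝ≥0),
      ∀ u : bvSpace Ω,
        ((T u).1 : RSpace d → ℝ) =ᵐ[volume.restrict Ω] (u.1 : RSpace d → ℝ) ∧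
        normBV univ (T u).1 ≤ C * normBV Ω u.1 ∧
        variationMeasure (T u).1 (frontier Ω) = 0

/-- `(ν_ε)_{ε > 0}` is a Dirac approximation of `p`-Lévy measures: each `ν_ε` is measurable and
radial on `ℝ^d ∖ {0}` with `∫ (1 ∧ |h|^p) ν_ε(h) dh = 1`, and for every `δ > 0` the integral over
`|h| > δ` tends to `0` as `ε → 0+`. The values `ν_ε(0)` and `ν_ε` for `ε ≤ 0` play no role. -/
structure IsLevyDiracApprox {d : ℕ} (p : ℝ) (ν : ℝ → RSpace d → ℝ≥0∞) : Prop where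
  measurable : ∀ ε > 0, AEMeasurable (ν ε) volume
  radial : ∀ ε > 0, ∀ h h' : RSpace d, ‖h‖ = ‖h'‖ → ν ε h = ν ε h'
  normalized : ∀ ε > 0, ∫⁻ h, ENNReal.ofReal (min 1 (‖h‖ ^ p)) * ν ε h = 1
  concentrates : ∀ δ > 0,
    Tendsto (fun ε => ∫⁻ h in {h : RSpace d | δ < ‖h‖}, ENNReal.ofReal (min 1 (‖h‖ ^ p)) * ν ε h)
      (𝓝[>] (0 : ℝ)) (𝓝 0)

/-- The constant `K_{d,p}`: the mean over the unit sphere, for the surface measure, of `|w · e|^p`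
with `e` a unit vector (the value does not depend on `e`). -/
noncomputable def sphereMean {d : ℕ} (p : ℝ) (e : RSpace d) : ℝ :=
  ⨍ w : Metric.sphere (0 : RSpace d) 1, |inner ℝ (w : RSpace d) e| ^ p
    ∂((volume : Measure (RSpace d)).toSphere)

/-- `∬_{Ω×Ω} |u(x) - u(y)|^p ν(x - y) dx dy`. -/
noncomputable def nonlocalEnergy {d : ℕ} (Ω : Set (RSpace d)) (p : ℝ) (ν : RSpace d → ℝ≥0∞)
    (u : RSpace d → ℝ) : ℝ≥0∞ :=
  ∫⁻ x in Ω, ∫⁻ y in Ω, ‖u x - u y‖ₑ ^ p * ν (x - y)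

/-! ### Averages over radial weights and the constant `K_{d,p}` -/

section Radial

variable {d : ℕ}

/-! To first order `u (x + h) - u x` is `∇u(x) · h`, and averaging `|∇u(x) · h|^p` against a radial
kernel gives `K_{d,p} |∇u(x)|^p` times `∫ ν(h) |h|^p dh` (`lintegral_radial_inner`). Near the origin
this mass tends to `1`, and away from it `ν` itself has vanishing mass (`tendsto_mass`,
`tendsto_tail`). Rough functions are reached by mollification, one inequality at a time.

The lower bound holds on every open set. By Jensen, mollification does not increase the nonlocal
energy, provided that one shrinks `Ω` a little (`lintegral_mollify_le_nonlocalEnergy`). With Fatou's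
lemma, the first-order expansion then bounds `K ∫ |∇(η_n * u)|^p` over `innerSet Ω n` by the lower
limit of the energies, uniformly in `n`. Letting `n → ∞` gives the claim by Fatou if `u` has a weak
gradient, and by duality for the total variation. If `p > 1` and the lower limit is finite, weak
compactness of `L^p` turns the uniform bound into a weak gradient (`exists_hasWeakGradient`), so
outside `W^{1,p}` the energies diverge.

The upper bound is where the extension `v` of `u` to the whole space enters. Large `h` cost at most
a constant times the tail mass (`limsup_nonlocalEnergy_le`). For small `h` the increments of the
mollified `v` are integrals of its gradient along segments, so the energy is controlled by the
gradient on a slight enlargement of `Ω`. For Sobolev functions the excess is small because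
translation is continuous in `L^1` (`tendsto_lintegral_translate_diff`); for BV functions it is
small because `|∇v|(∂Ω) = 0` (`exists_thickening_bvSeminorm_le`). -/

theorem lintegral_radial_inner_eq_of_norm_eq {ρ : RSpace d → ℝ≥0∞}
    (hρ : ∀ h h' : RSpace d, ‖h‖ = ‖h'‖ → ρ h = ρ h') (p : ℝ) {a b : RSpace d} (hab : ‖a‖ = ‖b‖) :
    ∫⁻ h, ρ h * ‖inner ℝ a h‖ₑ ^ p = ∫⁻ h, ρ h * ‖inner ℝ b h‖ₑ ^ p := by
  -- The reflection that swaps `a` and `b` preserves Lebesgue measure and the norm, hence the radial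
  -- weight.
  let R : RSpace d ≃ₗᵢ[ℝ] RSpace d := (ℝ ∙ (a - b))ᗮ.reflection
  have hR : R a = b := Submodule.reflection_sub hab
  rw [← R.measurePreserving.lintegral_comp_emb R.toHomeomorph.measurableEmbedding
    (fun h => ρ h * ‖inner ℝ b h‖ₑ ^ p)]
  refine lintegral_congr fun h => ?_
  rw [← hR, R.inner_map_map, hρ (R h) h (R.norm_map h)]

theorem lintegral_radial_inner_eq_mul {ρ : RSpace d → ℝ≥0∞}
    (hρ : ∀ h h' : RSpace d, ‖h‖ = ‖h'‖ → ρ h = ρ h') {p : ℝ} (hp : 0 < p) {e : RSpace d}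
    (he : ‖e‖ = 1) (a : RSpace d) :
    ∫⁻ h, ρ h * ‖inner ℝ a h‖ₑ ^ p = ‖a‖ₑ ^ p * ∫⁻ h, ρ h * ‖inner ℝ e h‖ₑ ^ p := by
  have h1 : ‖a‖ = ‖‖a‖ • e‖ := by rw [norm_smul, he]; simp
  rw [lintegral_radial_inner_eq_of_norm_eq hρ p h1,
    ← lintegral_const_mul' _ _ (ENNReal.rpow_ne_top_of_nonneg hp.le enorm_ne_top)]
  refine lintegral_congr fun h => ?_
  rw [real_inner_smul_left, enorm_mul, ENNReal.mul_rpow_of_nonneg _ _ hp.le, enorm_norm]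
  ring

/-- `toSphere` is `d` times the volume of the unit cone over a set of directions, so a function of
the direction alone can be integrated over the punctured ball instead. -/
theorem lintegral_toSphere {f : RSpace d → ℝ≥0∞} (hf : Measurable f) :
    ∫⁻ w : Metric.sphere (0 : RSpace d) 1, f w ∂((volume : Measure (RSpace d)).toSphere)
      = d * ∫⁻ h in Metric.ball (0 : RSpace d) 1 \ {0}, f (‖h‖⁻¹ • h) := by
  have hemb : MeasurableEmbedding
      (Subtype.val ∘ (homeomorphUnitSphereProd (RSpace d)).symm : _ → RSpace d) :=
    (MeasurableEmbedding.subtype_coe (measurableSet_singleton _).compl).comp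
      (Homeomorph.measurableEmbedding _)
  have hm : Measurable fun w : Metric.sphere (0 : RSpace d) 1 => f w :=
    hf.comp measurable_subtype_coe
  have hset : (univ ×ˢ Iio ⟨1, mem_Ioi.2 one_pos⟩ : Set (Metric.sphere (0 : RSpace d) 1 × Ioi (0 : ℝ)))
      = (Subtype.val ∘ (homeomorphUnitSphereProd (RSpace d)).symm : _ → RSpace d) ⁻¹'
        (Metric.ball (0 : RSpace d) 1 \ {0}) := by
    ext ⟨w, r⟩
    have hw : ‖(w : RSpace d)‖ = 1 := by simp
    have hr : (0 : ℝ) < r := r.2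
    have hw0 : (w : RSpace d) ≠ 0 := by rw [← norm_ne_zero_iff, hw]; exact one_ne_zero
    simp [norm_smul, hw, abs_of_pos hr, hr.ne', hw0, ← Subtype.coe_lt_coe]
  have hmap : Measure.map (Subtype.val ∘ (homeomorphUnitSphereProd (RSpace d)).symm : _ → RSpace d)
      ((Measure.comap (Subtype.val ∘ (homeomorphUnitSphereProd (RSpace d)).symm : _ → RSpace d)
        volume).restrict
          ((Subtype.val ∘ (homeomorphUnitSphereProd (RSpace d)).symm : _ → RSpace d) ⁻¹'
            (Metric.ball (0 : RSpace d) 1 \ {0})))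
      = volume.restrict (Metric.ball (0 : RSpace d) 1 \ {0}) := by
    rw [← hemb.restrict_map, hemb.map_comap,
      Measure.restrict_restrict (measurableSet_ball.diff (measurableSet_singleton _))]
    congr 1
    refine inter_eq_left.2 fun h hh => ?_
    have h0 : h ≠ 0 := hh.2
    exact ⟨homeomorphUnitSphereProd (RSpace d) ⟨h, h0⟩, by simp⟩
  rw [Measure.toSphere, lintegral_smul_measure, Measure.fst, lintegral_map hm measurable_fst, hset,
    finrank_euclideanSpace_fin, nsmul_eq_mul]
  congr 1
  conv_rhs => rw [← hmap]
  rw [hemb.lintegral_map]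
  refine lintegral_congr fun ⟨w, r⟩ => ?_
  have hw : ‖(w : RSpace d)‖ = 1 := by simp
  have hr : (0 : ℝ) < r := r.2
  simp [norm_smul, hw, abs_of_pos hr, smul_smul, hr.ne']

/-- The integrand on the right depends only on the direction of `h`, and the sphere has surface
measure `d` times the volume of the ball. -/
theorem ofReal_sphereMean {p : ℝ} (hp : 0 < p) {e : RSpace d} (he : ‖e‖ = 1) :
    ENNReal.ofReal (sphereMean p e) * volume (Metric.ball (0 : RSpace d) 1) =
      ∫⁻ h in Metric.ball (0 : RSpace d) 1, ‖h‖ₑ ^ (-p) * ‖inner ℝ e h‖ₑ ^ p := by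
  have hd : d ≠ 0 := by
    rintro rfl
    rw [Subsingleton.elim e 0] at he; simp at he
  have hc : Continuous fun w : Metric.sphere (0 : RSpace d) 1 =>
      |inner ℝ (w : RSpace d) e| ^ p := by
    refine Continuous.rpow_const ?_ fun _ => Or.inr hp.le
    fun_prop
  have hinteg : Integrable (fun w : Metric.sphere (0 : RSpace d) 1 => |inner ℝ (w : RSpace d) e| ^ p)
      (volume : Measure (RSpace d)).toSphere :=
    hc.integrable_of_hasCompactSupport (HasCompactSupport.of_compactSpace _)
  have h1 : ENNReal.ofReal (∫ w : Metric.sphere (0 : RSpace d) 1, |inner ℝ (w : RSpace d) e| ^ p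
      ∂((volume : Measure (RSpace d)).toSphere)) =
      d * ∫⁻ h in Metric.ball (0 : RSpace d) 1, ‖h‖ₑ ^ (-p) * ‖inner ℝ e h‖ₑ ^ p := by
    rw [ofReal_integral_eq_lintegral_ofReal hinteg (Eventually.of_forall fun w => by positivity)]
    have h2 : ∀ w : Metric.sphere (0 : RSpace d) 1, ENNReal.ofReal (|inner ℝ (w : RSpace d) e| ^ p)
        = ‖inner ℝ (w : RSpace d) e‖ₑ ^ p := fun w => by
      rw [← ENNReal.ofReal_rpow_of_nonneg (abs_nonneg _) hp.le, Real.enorm_eq_ofReal_abs]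
    simp_rw [h2]
    rw [lintegral_toSphere (f := fun h : RSpace d => ‖inner ℝ h e‖ₑ ^ p) (by fun_prop)]
    congr 1
    have hae : (Metric.ball (0 : RSpace d) 1 \ {0} : Set (RSpace d)) =ᵐ[volume]
        Metric.ball (0 : RSpace d) 1 := by
      have : Nonempty (Fin d) := ⟨⟨0, Nat.pos_of_ne_zero hd⟩⟩
      exact sdiff_null_ae_eq_self (measure_singleton _)
    rw [Measure.restrict_congr_set hae]
    refine lintegral_congr fun h => ?_
    rcases eq_or_ne h 0 with rfl | h0
    -- At the origin both sides vanish: `0 ^ (-p) = ⊤` is multiplied by `0`.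
    · simp [hp]
    · rw [real_inner_smul_left, enorm_mul, ENNReal.mul_rpow_of_nonneg _ _ hp.le, real_inner_comm,
        enorm_inv (norm_ne_zero_iff.2 h0), enorm_norm, ENNReal.inv_rpow, ENNReal.rpow_neg]
  have hσ : (volume : Measure (RSpace d)).toSphere.real univ =
      d * (volume : Measure (RSpace d)).real (Metric.ball 0 1) := by simp
  have hvol : (volume : Measure (RSpace d)).real (Metric.ball 0 1) ≠ 0 := by
    rw [measureReal_def, ENNReal.toReal_ne_zero]
    exact ⟨(Metric.measure_ball_pos _ _ one_pos).ne', measure_ball_lt_top.ne⟩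
  have hd' : (d : ℝ) ≠ 0 := Nat.cast_ne_zero.2 hd
  have h3 : (d : ℝ≥0∞) * (ENNReal.ofReal (sphereMean p e) * volume (Metric.ball (0 : RSpace d) 1))
      = d * ∫⁻ h in Metric.ball (0 : RSpace d) 1, ‖h‖ₑ ^ (-p) * ‖inner ℝ e h‖ₑ ^ p := by
    rw [← h1, ← ENNReal.ofReal_toReal (measure_ball_lt_top (μ := (volume : Measure (RSpace d)))
      (x := 0) (r := 1)).ne, ← measureReal_def, ← ENNReal.ofReal_natCast, mul_left_comm,
      ← ENNReal.ofReal_mul (by positivity), ← hσ, ← ENNReal.ofReal_mul' (by positivity)]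
    congr 1
    rw [sphereMean, average_eq, smul_eq_mul, mul_comm, ← mul_assoc, mul_inv_cancel₀, one_mul]
    rw [hσ]
    exact mul_ne_zero hd' hvol
  exact (ENNReal.mul_right_inj (Nat.cast_ne_zero.2 hd) (ENNReal.natCast_ne_top d)).1 h3

/-- Averaging a directional quantity against a radial weight produces the constant `K_{d,p}`. -/
theorem lintegral_radial_inner {ρ : RSpace d → ℝ≥0∞} (hm : AEMeasurable ρ volume)
    (hρ : ∀ h h' : RSpace d, ‖h‖ = ‖h'‖ → ρ h = ρ h') {p : ℝ} (hp : 0 < p) {e : RSpace d}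
    (he : ‖e‖ = 1) (a : RSpace d) :
    ∫⁻ h, ρ h * ‖inner ℝ a h‖ₑ ^ p
      = ENNReal.ofReal (sphereMean p e) * ‖a‖ₑ ^ p * ∫⁻ h, ρ h * ‖h‖ₑ ^ p := by
  have hd : d ≠ 0 := by
    rintro rfl
    rw [Subsingleton.elim e 0] at he; simp at he
  have : Nonempty (Fin d) := ⟨⟨0, Nat.pos_of_ne_zero hd⟩⟩
  let B := Metric.ball (0 : RSpace d) 1
  -- A reference weight for which both integrals are known: `∫ ρ₀ |k|^p` is the volume of the ball
  -- and `∫ ρ₀ |e · k|^p` is `K` times that. Fubini for `ρ₀(k) ρ(h) |k · h|^p`, where `k` and `h`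
  -- play symmetric roles, carries the ratio `K` over to every radial `ρ`.
  let ρ₀ : RSpace d → ℝ≥0∞ := B.indicator fun k => ‖k‖ₑ ^ (-p)
  have hρ₀m : Measurable ρ₀ := (by fun_prop : Measurable fun k : RSpace d => ‖k‖ₑ ^ (-p)).indicator
    measurableSet_ball
  have hρ₀ : ∀ h h' : RSpace d, ‖h‖ = ‖h'‖ → ρ₀ h = ρ₀ h' := fun h h' hh => by
    have : ‖h‖ₑ = ‖h'‖ₑ := by rw [← enorm_norm, hh, enorm_norm]
    simp only [ρ₀, indicator, B, mem_ball_zero_iff, hh, this]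
  have hswap : ∫⁻ k, ρ₀ k * ∫⁻ h, ρ h * ‖inner ℝ k h‖ₑ ^ p
      = ∫⁻ h, ρ h * ∫⁻ k, ρ₀ k * ‖inner ℝ h k‖ₑ ^ p := by
    have h1 : ∀ k, ρ₀ k * ∫⁻ h, ρ h * ‖inner ℝ k h‖ₑ ^ p
        = ∫⁻ h, ρ₀ k * (ρ h * ‖inner ℝ k h‖ₑ ^ p) := fun k =>
      (lintegral_const_mul'' _ (hm.mul (by fun_prop))).symm
    have h2 : ∀ h, ρ h * ∫⁻ k, ρ₀ k * ‖inner ℝ h k‖ₑ ^ p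
        = ∫⁻ k, ρ₀ k * (ρ h * ‖inner ℝ k h‖ₑ ^ p) := fun h => by
      rw [← lintegral_const_mul _ (by fun_prop)]
      refine lintegral_congr fun k => ?_
      rw [real_inner_comm]; ring
    simp_rw [h1, h2]
    refine lintegral_lintegral_swap ?_
    refine ((hρ₀m.comp measurable_fst).aemeasurable).mul ((hm.comp_snd).mul ?_)
    exact Measurable.aemeasurable (by fun_prop)
  have hl : ∀ k, ρ₀ k * ∫⁻ h, ρ h * ‖inner ℝ k h‖ₑ ^ p
      = ρ₀ k * ‖k‖ₑ ^ p * ∫⁻ h, ρ h * ‖inner ℝ e h‖ₑ ^ p := fun k => by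
    rw [lintegral_radial_inner_eq_mul hρ hp he k, mul_assoc]
  have hr : ∀ h, ρ h * ∫⁻ k, ρ₀ k * ‖inner ℝ h k‖ₑ ^ p
      = ρ h * ‖h‖ₑ ^ p * ∫⁻ k, ρ₀ k * ‖inner ℝ e k‖ₑ ^ p := fun h => by
    rw [lintegral_radial_inner_eq_mul hρ₀ hp he h, mul_assoc]
  rw [lintegral_congr hl, lintegral_congr hr] at hswap
  have hB : ∫⁻ k, ρ₀ k * ‖k‖ₑ ^ p = volume B := by
    have : ∀ᵐ k : RSpace d, ρ₀ k * ‖k‖ₑ ^ p = B.indicator 1 k := by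
      have h0 : ∀ᵐ k : RSpace d, k ≠ 0 := by simp [ae_iff]
      filter_upwards [h0] with k hk
      by_cases hkB : k ∈ B
      · simp only [ρ₀, indicator_of_mem hkB, Pi.one_apply]
        rw [← ENNReal.rpow_add _ _ (enorm_ne_zero.2 hk) enorm_ne_top]; simp
      · simp [ρ₀, indicator_of_notMem hkB]
    rw [lintegral_congr_ae this, lintegral_indicator_one measurableSet_ball]
  have hK : ∫⁻ k, ρ₀ k * ‖inner ℝ e k‖ₑ ^ p = ENNReal.ofReal (sphereMean p e) * volume B := by
    rw [ofReal_sphereMean hp he, ← lintegral_indicator measurableSet_ball]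
    refine lintegral_congr fun k => ?_
    by_cases hkB : k ∈ B
    · simp only [ρ₀, indicator_of_mem hkB]
      rw [indicator_of_mem hkB]
    · simp only [ρ₀, indicator_of_notMem hkB, zero_mul]
      rw [indicator_of_notMem hkB]
  rw [lintegral_mul_const _ (by fun_prop), lintegral_mul_const'' _ (by fun_prop), hB, hK] at hswap
  rw [lintegral_radial_inner_eq_mul hρ hp he]
  have hne : volume B ≠ 0 := (Metric.measure_ball_pos _ _ one_pos).ne'
  have hnt : volume B ≠ ⊤ := measure_ball_lt_top.ne
  have : ∫⁻ h, ρ h * ‖inner ℝ e h‖ₑ ^ p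
      = ENNReal.ofReal (sphereMean p e) * ∫⁻ h, ρ h * ‖h‖ₑ ^ p := by
    refine (ENNReal.mul_right_inj hne hnt).1 ?_
    rw [hswap]; ring
  rw [this]; ring

/-- The integrand in `ofReal_sphereMean` is positive off the hyperplane orthogonal to `e`.
Positivity of `K` makes `K * ⊤ = ⊤` in the divergent cases and allows division by `K`. -/
theorem ofReal_sphereMean_ne_zero {p : ℝ} (hp : 0 < p) {e : RSpace d} (he : ‖e‖ = 1) :
    ENNReal.ofReal (sphereMean p e) ≠ 0 := by
  intro h0
  have h1 := ofReal_sphereMean hp he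
  rw [h0, zero_mul, eq_comm, lintegral_eq_zero_iff (by fun_prop)] at h1
  have hB : IsOpen (Metric.ball (0 : RSpace d) 1 ∩ {h | inner ℝ e h ≠ 0}) :=
    Metric.isOpen_ball.inter (isOpen_ne_fun (by fun_prop) continuous_const)
  have hne : (Metric.ball (0 : RSpace d) 1 ∩ {h | inner ℝ e h ≠ 0}).Nonempty :=
    ⟨(1 / 2 : ℝ) • e, by simp [norm_smul, he]; norm_num, by
      simp only [mem_ofPred_eq, real_inner_smul_right, real_inner_self_eq_norm_sq, he]; norm_num⟩
  refine (hB.measure_pos volume hne).ne' ?_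
  rw [inter_comm, ← Measure.restrict_apply (isOpen_ne_fun (by fun_prop)
    continuous_const).measurableSet]
  refine measure_mono_null (fun h hh => ?_) h1
  have hh' : inner ℝ e h ≠ 0 := hh
  have hz : h ≠ 0 := by rintro rfl; simp at hh'
  simp only [mem_compl_iff, mem_ofPred_eq, Pi.zero_apply, mul_eq_zero, not_or]
  refine ⟨?_, ?_⟩
  · rw [ENNReal.rpow_neg]
    exact ENNReal.inv_ne_zero.2 (ENNReal.rpow_ne_top_of_nonneg hp.le enorm_ne_top)
  · exact (ENNReal.rpow_pos (enorm_pos.2 hh') enorm_ne_top).ne'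

end Radial

/-- A family of radial kernels, normalized and concentrating at `0` along a filter. -/
structure IsLevyFamily {d : ℕ} {ι : Type*} (l : Filter ι) (p : ℝ)
    (ν : ι → RSpace d → ℝ≥0∞) : Prop where
  measurable : ∀ i, AEMeasurable (ν i) volume
  radial : ∀ i, ∀ h h' : RSpace d, ‖h‖ = ‖h'‖ → ν i h = ν i h'
  normalized : ∀ i, ∫⁻ h, ENNReal.ofReal (min 1 (‖h‖ ^ p)) * ν i h = 1
  concentrates : ∀ δ > 0,
    Tendsto (fun i => ∫⁻ h in {h : RSpace d | δ < ‖h‖}, ENNReal.ofReal (min 1 (‖h‖ ^ p)) * ν i h)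
      l (𝓝 0)

/-! ### Masses of the kernels and the energy as an integral over shifts -/

section Kernel

variable {d : ℕ} {ι : Type*} {l : Filter ι} {p : ℝ} {ν : ι → RSpace d → ℝ≥0∞}

/-- Indices `ε ≤ 0`, about which nothing is assumed, are sent to `1`, so that the conditions hold at
every index; the limit at `0+` does not see this. -/
theorem IsLevyDiracApprox.isLevyFamily {ν : ℝ → RSpace d → ℝ≥0∞} (hν : IsLevyDiracApprox p ν) :
    IsLevyFamily (𝓝[>] (0 : ℝ)) p fun ε => ν (if 0 < ε then ε else 1) := by
  have hpos : ∀ ε : ℝ, 0 < (if 0 < ε then ε else 1) := fun ε => by split_ifs <;> simp_all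
  refine ⟨fun ε => hν.measurable _ (hpos ε), fun ε => hν.radial _ (hpos ε),
    fun ε => hν.normalized _ (hpos ε), fun δ hδ => (hν.concentrates δ hδ).congr' ?_⟩
  filter_upwards [self_mem_nhdsWithin] with ε hε
  rw [if_pos (show (0 : ℝ) < ε from hε)]

theorem compl_closedBall_zero (δ : ℝ) :
    (Metric.closedBall (0 : RSpace d) δ)ᶜ = {h : RSpace d | δ < ‖h‖} := by
  ext h; simp

theorem setLIntegral_closedBall_mul_enorm_rpow (hp : 0 < p) {δ : ℝ} (hδ : δ ≤ 1)
    (k : RSpace d → ℝ≥0∞) :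
    ∫⁻ h in Metric.closedBall (0 : RSpace d) δ, k h * ‖h‖ₑ ^ p =
      ∫⁻ h in Metric.closedBall (0 : RSpace d) δ, ENNReal.ofReal (min 1 (‖h‖ ^ p)) * k h := by
  refine setLIntegral_congr_fun measurableSet_closedBall fun h hh => ?_
  have h1 : ‖h‖ ≤ 1 := (mem_closedBall_zero_iff.1 hh).trans hδ
  rw [min_eq_right (Real.rpow_le_one (norm_nonneg _) h1 hp.le), mul_comm,
    ← ENNReal.ofReal_rpow_of_nonneg (norm_nonneg _) hp.le, ofReal_norm]

theorem IsLevyFamily.mass_le_one (hν : IsLevyFamily l p ν) (hp : 0 < p) {δ : ℝ} (hδ : δ ≤ 1)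
    (i : ι) : ∫⁻ h in Metric.closedBall (0 : RSpace d) δ, ν i h * ‖h‖ₑ ^ p ≤ 1 := by
  rw [setLIntegral_closedBall_mul_enorm_rpow hp hδ, ← hν.normalized i]
  exact setLIntegral_le_lintegral _ _

theorem IsLevyFamily.tendsto_mass (hν : IsLevyFamily l p ν) (hp : 0 < p) {δ : ℝ} (hδ0 : 0 < δ)
    (hδ : δ ≤ 1) :
    Tendsto (fun i => ∫⁻ h in Metric.closedBall (0 : RSpace d) δ, ν i h * ‖h‖ₑ ^ p) l (𝓝 1) := by
  have h1 : ∀ i, ∫⁻ h in Metric.closedBall (0 : RSpace d) δ, ν i h * ‖h‖ₑ ^ p =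
      1 - ∫⁻ h in {h : RSpace d | δ < ‖h‖}, ENNReal.ofReal (min 1 (‖h‖ ^ p)) * ν i h := fun i => by
    rw [setLIntegral_closedBall_mul_enorm_rpow hp hδ]
    have h2 := lintegral_add_compl (μ := (volume : Measure (RSpace d)))
      (fun h => ENNReal.ofReal (min 1 (‖h‖ ^ p)) * ν i h)
      (measurableSet_closedBall (x := (0 : RSpace d)) (ε := δ))
    rw [hν.normalized i, compl_closedBall_zero] at h2
    refine ENNReal.eq_sub_of_add_eq (ne_of_lt ?_) h2
    exact (le_add_self.trans h2.le).trans_lt ENNReal.one_lt_top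
  simp_rw [h1]
  have h3 := ENNReal.Tendsto.sub (tendsto_const_nhds (x := (1 : ℝ≥0∞)) (f := l))
    (hν.concentrates δ hδ0) (Or.inl ENNReal.one_ne_top)
  simpa using h3

/-- Beyond `δ` the weight `1 ∧ |h|^p` is at least the positive constant `1 ∧ δ^p`, which can be
divided out. -/
theorem IsLevyFamily.tendsto_tail (hν : IsLevyFamily l p ν) (hp : 0 < p) {δ : ℝ} (hδ : 0 < δ) :
    Tendsto (fun i => ∫⁻ h in {h : RSpace d | δ < ‖h‖}, ν i h) l (𝓝 0) := by
  set c : ℝ≥0∞ := ENNReal.ofReal (min 1 (δ ^ p)) with hc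
  have hc0 : c ≠ 0 := by
    rw [hc, Ne, ENNReal.ofReal_eq_zero, not_le]
    exact lt_min one_pos (Real.rpow_pos_of_pos hδ p)
  have hct : c ≠ ⊤ := ENNReal.ofReal_ne_top
  have hlim : Tendsto (fun i => c⁻¹ * ∫⁻ h in {h : RSpace d | δ < ‖h‖},
      ENNReal.ofReal (min 1 (‖h‖ ^ p)) * ν i h) l (𝓝 0) := by
    simpa using ENNReal.Tendsto.const_mul (hν.concentrates δ hδ)
      (Or.inr (ENNReal.inv_ne_top.2 hc0))
  refine tendsto_of_tendsto_of_tendsto_of_le_of_le tendsto_const_nhds hlim (fun _ => zero_le)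
    fun i => ?_
  rw [mul_comm, ← div_eq_mul_inv, ENNReal.le_div_iff_mul_le (Or.inl hc0) (Or.inl hct), mul_comm]
  rw [← lintegral_const_mul' _ _ hct]
  refine setLIntegral_mono_ae' (measurableSet_lt measurable_const measurable_norm)
    (Eventually.of_forall fun h hh => ?_)
  have hh' : δ ≤ ‖h‖ := (show δ < ‖h‖ from hh).le
  rw [hc]
  gcongr

/-- Substitution of `y = x + h` and Tonelli. Radial kernels are even, which turns `k (x - y)` into
`k h`; the indicator keeps the `x` with `x + h ∈ Ω`. -/
theorem nonlocalEnergy_eq {Ω : Set (RSpace d)} (hΩ : MeasurableSet Ω) {k : RSpace d → ℝ≥0∞}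
    (hk : AEMeasurable k volume) (hr : ∀ h h' : RSpace d, ‖h‖ = ‖h'‖ → k h = k h')
    {u : RSpace d → ℝ} (hu : Measurable u) :
    nonlocalEnergy Ω p k u =
      ∫⁻ h, k h * ∫⁻ x in Ω, Ω.indicator (fun z => ‖u z - u x‖ₑ ^ p) (x + h) := by
  have h1 : ∀ x, ∫⁻ y in Ω, ‖u x - u y‖ₑ ^ p * k (x - y) =
      ∫⁻ h, k h * Ω.indicator (fun z => ‖u z - u x‖ₑ ^ p) (x + h) := fun x => by
    rw [← lintegral_indicator hΩ, ← lintegral_add_left_eq_self _ x]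
    refine lintegral_congr fun h => ?_
    by_cases hx : x + h ∈ Ω
    · rw [indicator_of_mem hx, indicator_of_mem hx, mul_comm, ← enorm_neg (u x - u (x + h)),
        neg_sub, hr (x - (x + h)) h (by simp)]
    · simp [indicator_of_notMem hx]
  have hm : Measurable fun q : RSpace d × RSpace d =>
      Ω.indicator (fun z => ‖u z - u q.1‖ₑ ^ p) (q.1 + q.2) := by
    have : (fun q : RSpace d × RSpace d =>
        Ω.indicator (fun z => ‖u z - u q.1‖ₑ ^ p) (q.1 + q.2)) =
        ((fun q : RSpace d × RSpace d => q.1 + q.2) ⁻¹' Ω).indicator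
          fun q => ‖u (q.1 + q.2) - u q.1‖ₑ ^ p := by
      rfl
    rw [this]
    exact Measurable.indicator (by fun_prop) (measurable_add hΩ)
  rw [nonlocalEnergy]
  simp_rw [h1]
  rw [lintegral_lintegral_swap ((hk.comp_snd).mul hm.aemeasurable)]
  refine lintegral_congr fun h => ?_
  rw [lintegral_const_mul]
  exact hm.comp measurable_prodMk_right

theorem lintegral_kernel_inner {k : RSpace d → ℝ≥0∞}
    (hk : AEMeasurable k volume) (hr : ∀ h h' : RSpace d, ‖h‖ = ‖h'‖ → k h = k h') (hp : 0 < p)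
    {e : RSpace d} (he : ‖e‖ = 1) (δ : ℝ) (a : RSpace d) :
    ∫⁻ h in Metric.closedBall (0 : RSpace d) δ, k h * ‖inner ℝ a h‖ₑ ^ p =
      ENNReal.ofReal (sphereMean p e) * ‖a‖ₑ ^ p *
        ∫⁻ h in Metric.closedBall (0 : RSpace d) δ, k h * ‖h‖ₑ ^ p := by
  have h1 := lintegral_radial_inner (hk.indicator (measurableSet_closedBall (x := 0) (ε := δ)))
    (fun h h' hh => by simp only [indicator, mem_closedBall_zero_iff, hh, hr h h' hh]) hp he a
  rw [← lintegral_indicator measurableSet_closedBall, ← lintegral_indicator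
    measurableSet_closedBall]
  simp_rw [indicator_mul_left _ k]
  exact h1

theorem lintegral_kernel_lintegral_inner {k : RSpace d → ℝ≥0∞}
    (hk : AEMeasurable k volume) (hr : ∀ h h' : RSpace d, ‖h‖ = ‖h'‖ → k h = k h') (hp : 0 < p)
    {e : RSpace d} (he : ‖e‖ = 1) (δ : ℝ) (A : Set (RSpace d)) {g : RSpace d → RSpace d}
    (hg : Measurable g) :
    ∫⁻ h in Metric.closedBall (0 : RSpace d) δ, k h * ∫⁻ x in A, ‖inner ℝ (g x) h‖ₑ ^ p =
      ENNReal.ofReal (sphereMean p e) * (∫⁻ x in A, ‖g x‖ₑ ^ p) *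
        ∫⁻ h in Metric.closedBall (0 : RSpace d) δ, k h * ‖h‖ₑ ^ p := by
  have h1 : ∀ h, k h * ∫⁻ x in A, ‖inner ℝ (g x) h‖ₑ ^ p =
      ∫⁻ x in A, k h * ‖inner ℝ (g x) h‖ₑ ^ p := fun h =>
    (lintegral_const_mul _ (by fun_prop)).symm
  simp_rw [h1]
  rw [lintegral_lintegral_swap]
  · simp_rw [lintegral_kernel_inner hk hr hp he]
    rw [lintegral_mul_const _ (by fun_prop), lintegral_const_mul _ (by fun_prop)]
  · refine (hk.restrict.comp_fst).mul ?_
    exact Measurable.aemeasurable (by fun_prop)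

end Kernel

/-! ### Jensen's inequality -/

section Jensen

variable {α : Type*} [MeasurableSpace α] {p : ℝ}

theorem lintegral_rpow_le_of_isProbabilityMeasure (μ : Measure α) [IsProbabilityMeasure μ]
    (hp : 1 ≤ p) {f : α → ℝ≥0∞} (hf : AEMeasurable f μ) :
    (∫⁻ a, f a ∂μ) ^ p ≤ ∫⁻ a, f a ^ p ∂μ := by
  rcases hp.eq_or_lt with rfl | hp
  · simp
  have h := ENNReal.lintegral_mul_le_Lp_mul_Lq μ (Real.HolderConjugate.conjExponent hp) hf
    (aemeasurable_const (b := (1 : ℝ≥0∞)))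
  simp only [Pi.mul_apply, mul_one, ENNReal.one_rpow, lintegral_const, measure_univ] at h
  calc _ ≤ ((∫⁻ a, f a ^ p ∂μ) ^ (1 / p)) ^ p := ENNReal.rpow_le_rpow h (by linarith)
    _ = _ := by rw [← ENNReal.rpow_mul, one_div_mul_cancel (by linarith), ENNReal.rpow_one]

/-- The weight `w` makes `μ` a probability measure. Only the norm of `f` has to be measurable, since
`‖∫ f‖ ≤ ∫ ‖f‖` holds for any `f`. -/
theorem enorm_integral_smul_rpow_le (μ : Measure α) {E : Type*} [NormedAddCommGroup E]
    [NormedSpace ℝ E] (hp : 1 ≤ p) {w : α → ℝ} (hw : Measurable w) (hw0 : ∀ a, 0 ≤ w a)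
    (hw1 : ∫⁻ a, ENNReal.ofReal (w a) ∂μ = 1) {f : α → E} (hf : AEMeasurable (fun a => ‖f a‖ₑ) μ) :
    ‖∫ a, w a • f a ∂μ‖ₑ ^ p ≤ ∫⁻ a, ENNReal.ofReal (w a) * ‖f a‖ₑ ^ p ∂μ := by
  have hwm : Measurable fun a => ENNReal.ofReal (w a) := hw.ennreal_ofReal
  have : IsProbabilityMeasure (μ.withDensity fun a => ENNReal.ofReal (w a)) :=
    ⟨by rw [withDensity_apply _ .univ, Measure.restrict_univ, hw1]⟩
  have hf' : AEMeasurable (fun a => ‖f a‖ₑ) (μ.withDensity fun a => ENNReal.ofReal (w a)) :=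
    hf.mono_ac (withDensity_absolutelyContinuous _ _)
  have h1 := lintegral_rpow_le_of_isProbabilityMeasure _ hp hf'
  have hlt : ∀ᵐ a ∂μ, ENNReal.ofReal (w a) < ⊤ := Eventually.of_forall fun _ =>
    ENNReal.ofReal_lt_top
  rw [lintegral_withDensity_eq_lintegral_mul_non_measurable _ hwm hlt,
    lintegral_withDensity_eq_lintegral_mul_non_measurable _ hwm hlt] at h1
  refine le_trans (ENNReal.rpow_le_rpow ?_ (by linarith)) h1
  refine (enorm_integral_le_lintegral_enorm _).trans (le_of_eq (lintegral_congr fun a => ?_))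
  rw [enorm_smul, Real.enorm_of_nonneg (hw0 a)]; rfl

end Jensen

/-! ### Mollification -/

section Mollify

/-- A smooth bump function at `0` of radius `1 / (n + 1)`. -/
noncomputable def mollifierBump (d n : ℕ) : ContDiffBump (0 : RSpace d) where
  rIn := 1 / (2 * ((n : ℝ) + 1))
  rOut := 1 / ((n : ℝ) + 1)
  rIn_pos := by positivity
  rIn_lt_rOut := by
    apply one_div_lt_one_div_of_lt <;> linarith [(Nat.cast_nonneg n : (0 : ℝ) ≤ n)]

/-- The standard smooth kernel of integral `1` supported in the ball of radius `1 / (n + 1)`. -/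
noncomputable def mollifier (d n : ℕ) : RSpace d → ℝ := (mollifierBump d n).normed volume

/-- Convolution with `mollifier d n`. -/
noncomputable def mollify {d : ℕ} {F : Type*} [NormedAddCommGroup F] [NormedSpace ℝ F] (n : ℕ)
    (u : RSpace d → F) (x : RSpace d) : F :=
  ∫ t, mollifier d n t • u (x - t)

variable {d : ℕ} {F : Type*} [NormedAddCommGroup F] [NormedSpace ℝ F] {n : ℕ}

theorem mollifier_contDiff : ContDiff ℝ ∞ (mollifier d n) := (mollifierBump d n).contDiff_normed

theorem mollifier_hasCompactSupport : HasCompactSupport (mollifier d n) :=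
  (mollifierBump d n).hasCompactSupport_normed

theorem mollifier_nonneg (x : RSpace d) : 0 ≤ mollifier d n x := (mollifierBump d n).nonneg_normed x

theorem mollifier_neg (x : RSpace d) : mollifier d n (-x) = mollifier d n x :=
  (mollifierBump d n).normed_neg x

theorem mollifier_integrable : Integrable (mollifier d n) :=
  mollifier_contDiff.continuous.integrable_of_hasCompactSupport mollifier_hasCompactSupport

theorem lintegral_mollifier : ∫⁻ x, ENNReal.ofReal (mollifier d n x) = 1 := by
  rw [← ofReal_integral_eq_lintegral_ofReal mollifier_integrable
    (Eventually.of_forall mollifier_nonneg), mollifier, ContDiffBump.integral_normed,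
    ENNReal.ofReal_one]

theorem mollifier_eq_zero {x : RSpace d} (hx : 1 / ((n : ℝ) + 1) ≤ ‖x‖) : mollifier d n x = 0 := by
  have h := (mollifierBump d n).support_normed_eq (μ := (volume : Measure (RSpace d)))
  rw [← Function.notMem_support, mollifier, h]
  rw [mem_ball_zero_iff, not_lt]
  exact hx

theorem mollify_eq_convolution (u : RSpace d → F) :
    mollify n u = convolution (mollifier d n) u (ContinuousLinearMap.lsmul ℝ ℝ) volume := rfl

theorem mollify_eq_swap (u : RSpace d → F) (x : RSpace d) :
    mollify n u x = ∫ y, mollifier d n (x - y) • u y := by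
  rw [mollify_eq_convolution, convolution_eq_swap]; rfl

theorem contDiff_mollify {u : RSpace d → F} (hu : LocallyIntegrable u) :
    ContDiff ℝ ∞ (mollify n u) := by
  rw [mollify_eq_convolution]
  exact mollifier_hasCompactSupport.contDiff_convolution_left _ mollifier_contDiff hu

theorem mollify_integrable {u : RSpace d → F} (hu : LocallyIntegrable u) (x : RSpace d) :
    Integrable fun t => mollifier d n t • u (x - t) :=
  mollifier_hasCompactSupport.convolutionExists_left (ContinuousLinearMap.lsmul ℝ ℝ)
    mollifier_contDiff.continuous hu x

theorem ae_tendsto_mollify [CompleteSpace F] {u : RSpace d → F} (hu : LocallyIntegrable u) :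
    ∀ᵐ x, Tendsto (fun n => mollify n u x) atTop (𝓝 (u x)) := by
  -- Almost everywhere convergence needs outer radii bounded by a fixed multiple of the inner ones;
  -- here the ratio is exactly `2`.
  refine ContDiffBump.ae_convolution_tendsto_right_of_locallyIntegrable (K := 2)
    (φ := fun n => mollifierBump d n) ?_ (Eventually.of_forall fun n => ?_) hu
  · exact tendsto_one_div_add_atTop_nhds_zero_nat
  · simp only [mollifierBump]
    exact le_of_eq (by field_simp)

theorem tendsto_mollify_of_continuous [CompleteSpace F] {u : RSpace d → F} (hu : Continuous u)
    (x : RSpace d) : Tendsto (fun n => mollify n u x) atTop (𝓝 (u x)) :=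
  ContDiffBump.convolution_tendsto_right_of_continuous (φ := fun n => mollifierBump d n)
    tendsto_one_div_add_atTop_nhds_zero_nat hu x

theorem fderiv_mollify [CompleteSpace F] {u : RSpace d → F} (hu : LocallyIntegrable u)
    (x v : RSpace d) :
    fderiv ℝ (mollify n u) x v = ∫ y, fderiv ℝ (mollifier d n) (x - y) v • u y := by
  have h1 := mollifier_hasCompactSupport.hasFDerivAt_convolution_left
    (ContinuousLinearMap.lsmul ℝ ℝ) ((mollifier_contDiff (d := d) (n := n)).of_le (by simp)) hu x
  have hex := ((mollifier_hasCompactSupport (d := d) (n := n)).fderiv ℝ).convolutionExists_left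
      (ContinuousLinearMap.precompL (RSpace d) (ContinuousLinearMap.lsmul ℝ ℝ : ℝ →L[ℝ] F →L[ℝ] F))
      (mollifier_contDiff.continuous_fderiv (by simp)) hu x
  rw [mollify_eq_convolution, h1.fderiv, convolution_eq_swap,
    ContinuousLinearMap.integral_apply hex.integrable_swap]
  simp only [ContinuousLinearMap.precompL_apply, ContinuousLinearMap.lsmul_apply]

theorem enorm_mollify_rpow_le {p : ℝ} (hp : 1 ≤ p) {f : RSpace d → F}
    (hf : Measurable fun x => ‖f x‖ₑ) (x : RSpace d) :
    ‖mollify n f x‖ₑ ^ p ≤ ∫⁻ t, ENNReal.ofReal (mollifier d n t) * ‖f (x - t)‖ₑ ^ p :=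
  enorm_integral_smul_rpow_le volume hp mollifier_contDiff.continuous.measurable mollifier_nonneg
    lintegral_mollifier
    (hf.comp (measurable_const.sub measurable_id)).aemeasurable

theorem mollify_add_sub {u : RSpace d → F} (hu : LocallyIntegrable u) (x h : RSpace d) :
    mollify n u (x + h) - mollify n u x = mollify n (fun z => u (z + h) - u z) x := by
  simp only [mollify]
  rw [← integral_sub (mollify_integrable hu _) (mollify_integrable hu _)]
  refine integral_congr_ae (Eventually.of_forall fun t => ?_)
  simp only [← smul_sub]
  congr 3
  abel

theorem mollify_eq_zero {u : RSpace d → F} {C : Set (RSpace d)} (hu : ∀ x ∉ C, u x = 0)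
    {x : RSpace d} (hx : x ∉ Metric.cthickening (1 / ((n : ℝ) + 1)) C) : mollify n u x = 0 := by
  rw [mollify]
  refine integral_eq_zero_of_ae (Eventually.of_forall fun t => ?_)
  by_cases ht : 1 / ((n : ℝ) + 1) ≤ ‖t‖
  · simp [mollifier_eq_zero ht]
  · have : x - t ∉ C := fun hC => hx (Metric.mem_cthickening_of_dist_le x (x - t) _ _ hC (by
      simpa [dist_eq_norm] using (not_le.1 ht).le))
    simp [hu _ this]

theorem norm_mollify_le {u : RSpace d → F} {M : ℝ} (hu : ∀ x, ‖u x‖ ≤ M) (x : RSpace d) :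
    ‖mollify n u x‖ ≤ M := by
  rw [mollify]
  refine (norm_integral_le_of_norm_le ((mollifier_integrable (n := n)).mul_const M)
    (Eventually.of_forall fun t => ?_)).trans (le_of_eq ?_)
  · rw [norm_smul, Real.norm_of_nonneg (mollifier_nonneg t)]
    exact mul_le_mul_of_nonneg_left (hu _) (mollifier_nonneg t)
  · rw [integral_mul_const, mollifier, ContDiffBump.integral_normed, one_mul]

/-- Fubini for a continuous compactly supported convolution kernel. -/
theorem integral_mul_integral_kernel_swap {k a u : RSpace d → ℝ} {C : Set (RSpace d)}
    (hk : Continuous k) (hks : HasCompactSupport k) (hC : IsCompact C) (ha : Integrable a)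
    (ha0 : ∀ x ∉ C, a x = 0) (hu : LocallyIntegrable u) :
    ∫ x, a x * ∫ y, k (x - y) * u y = ∫ y, u y * ∫ x, k (x - y) * a x := by
  -- For `x ∈ C` the kernel sees only `y` in the compact set `C - tsupport k`, so `u` may be cut off
  -- there and becomes integrable.
  let K : Set (RSpace d) := (fun q : RSpace d × RSpace d => q.1 - q.2) '' (C ×ˢ tsupport k)
  have hK : IsCompact K := (hC.prod hks.isCompact).image (by fun_prop)
  let w := K.indicator u
  have hw : Integrable w := (hu.integrableOn_isCompact hK).integrable_indicator hK.measurableSet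
  have hkey : ∀ x y, a x * (k (x - y) * u y) = a x * w y * k (x - y) := fun x y => by
    by_cases hx : x ∈ C
    · by_cases hy : y ∈ K
      · simp only [w, indicator_of_mem hy]; ring
      · have : k (x - y) = 0 := by
          by_contra h0
          exact hy ⟨(x, x - y), ⟨hx, subset_tsupport _ h0⟩, by simp⟩
        simp [this]
    · simp [ha0 x hx]
  obtain ⟨M, hM⟩ := hks.exists_bound_of_continuous hk
  have hinteg : Integrable (fun q : RSpace d × RSpace d => a q.1 * w q.2 * k (q.1 - q.2))
      (volume.prod volume) := by
    refine (ha.mul_prod hw).mul_bdd (c := M)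
      (hk.comp (continuous_fst.sub continuous_snd)).aestronglyMeasurable
      (Eventually.of_forall fun q => hM _)
  simp_rw [← integral_const_mul]
  simp_rw [hkey]
  rw [integral_integral_swap hinteg]
  refine integral_congr_ae (Eventually.of_forall fun y => integral_congr_ae
    (Eventually.of_forall fun x => ?_))
  simp only
  rw [← hkey]; ring

/-- The mollifier is even, so Fubini moves it from `u` onto `ψ`. There the convergence is pointwise,
with uniformly bounded values and with supports within distance `1` of that of `ψ`, and dominated
convergence applies. -/
theorem tendsto_integral_mollify_mul {u ψ : RSpace d → ℝ} (hu : LocallyIntegrable u)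
    (hψ : Continuous ψ) (hs : HasCompactSupport ψ) :
    Tendsto (fun n => ∫ x, mollify n u x * ψ x) atTop (𝓝 (∫ x, u x * ψ x)) := by
  have h1 : ∀ n, ∫ x, mollify n u x * ψ x = ∫ y, u y * mollify n ψ y := fun n => by
    have h2 := integral_mul_integral_kernel_swap (mollifier_contDiff (n := n)).continuous
      mollifier_hasCompactSupport hs.isCompact (hψ.integrable_of_hasCompactSupport hs)
      (fun x hx => image_eq_zero_of_notMem_tsupport hx) hu
    rw [integral_congr_ae (g := fun x => ψ x * ∫ y, mollifier d n (x - y) * u y)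
      (Eventually.of_forall fun x => ?_), h2]
    · refine integral_congr_ae (Eventually.of_forall fun y => ?_)
      simp only [mollify_eq_swap, smul_eq_mul]
      congr 1
      refine integral_congr_ae (Eventually.of_forall fun x => ?_)
      simp only [← mollifier_neg (x - y), neg_sub]
    · simp only [mollify_eq_swap, smul_eq_mul, mul_comm]
  simp_rw [h1]
  obtain ⟨M, hM⟩ := hs.exists_bound_of_continuous hψ
  have hM0 : 0 ≤ M := (norm_nonneg _).trans (hM 0)
  let K := Metric.cthickening 1 (tsupport ψ)
  have hK : IsCompact K := hs.isCompact.cthickening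
  refine tendsto_integral_of_dominated_convergence
    (fun y => M * K.indicator (fun y => ‖u y‖) y) (fun n => ?_) ?_ (fun n => ?_) ?_
  · exact hu.aestronglyMeasurable.mul
      (contDiff_mollify hψ.locallyIntegrable).continuous.aestronglyMeasurable
  · exact (IntegrableOn.integrable_indicator (hu.integrableOn_isCompact hK).norm
      hK.measurableSet).const_mul M
  · refine Eventually.of_forall fun y => ?_
    by_cases hy : y ∈ K
    · rw [indicator_of_mem hy, norm_mul, mul_comm]
      exact mul_le_mul_of_nonneg_right (norm_mollify_le hM y) (norm_nonneg _)
    · have : mollify n ψ y = 0 := by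
        refine mollify_eq_zero (C := tsupport ψ)
          (fun x hx => image_eq_zero_of_notMem_tsupport hx) fun hy' => hy ?_
        refine Metric.cthickening_mono ?_ _ hy'
        rw [div_le_one (by positivity)]
        linarith [(Nat.cast_nonneg n : (0 : ℝ) ≤ n)]
      simp [this, indicator_of_notMem hy]
  · exact Eventually.of_forall fun y => (tendsto_mollify_of_continuous hψ y).const_mul _

/-- The function `y ↦ mollifier d n (x - y)` is itself a test function on `Ω` when the ball around
`x` lies in `Ω`. -/
theorem gradient_mollify_of_hasWeakGradient {Ω : Set (RSpace d)}
    {u : RSpace d → ℝ} {g : RSpace d → RSpace d} (hg : HasWeakGradient Ω u g)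
    (hu : LocallyIntegrable u) (hgl : LocallyIntegrable g) {x : RSpace d}
    (hx : Metric.closedBall x (1 / ((n : ℝ) + 1)) ⊆ Ω) :
    gradient (mollify n u) x = mollify n g x := by
  refine ext_inner_right ℝ fun v => ?_
  rw [inner_gradient_left, fderiv_mollify hu, mollify_eq_swap]
  let φ : RSpace d → ℝ := fun y => mollifier d n (x - y)
  have hsupp : Function.support φ ⊆ Metric.closedBall x (1 / ((n : ℝ) + 1)) := fun y hy => by
    by_contra h
    rw [Metric.mem_closedBall, dist_comm, dist_eq_norm, not_le] at h
    exact hy (mollifier_eq_zero h.le)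
  have hts : tsupport φ ⊆ Metric.closedBall x (1 / ((n : ℝ) + 1)) :=
    closure_minimal hsupp Metric.isClosed_closedBall
  have hφ : IsTestFunction Ω φ :=
    ⟨mollifier_contDiff.comp (contDiff_const.sub contDiff_id),
      (isCompact_closedBall _ _).of_isClosed_subset (isClosed_tsupport _) hts, hts.trans hx⟩
  have hfd : ∀ y, fderiv ℝ φ y v = - fderiv ℝ (mollifier d n) (x - y) v := fun y => by
    have h1 : HasFDerivAt (mollifier d n) (fderiv ℝ (mollifier d n) (x - y)) (x - y) :=
      (mollifier_contDiff.differentiable (by simp) _).hasFDerivAt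
    have h2 : HasFDerivAt (fun y => x - y) (-ContinuousLinearMap.id ℝ (RSpace d)) y :=
      (hasFDerivAt_id y).const_sub x
    have h3 := h1.comp y h2
    rw [show φ = mollifier d n ∘ fun y => x - y from rfl, h3.fderiv]
    simp
  have h4 := hg.2.2 φ hφ v
  rw [setIntegral_eq_integral_of_forall_compl_eq_zero,
    setIntegral_eq_integral_of_forall_compl_eq_zero] at h4
  · simp_rw [hfd, mul_neg, integral_neg, neg_inj] at h4
    have hinteg : Integrable fun y => mollifier d n (x - y) • g y := by
      have := (mollifier_hasCompactSupport.convolutionExists_left (ContinuousLinearMap.lsmul ℝ ℝ)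
        (mollifier_contDiff (d := d) (n := n)).continuous hgl x).integrable_swap
      exact this
    have h5 := integral_inner (𝕜 := ℝ) hinteg v
    rw [real_inner_comm, ← h5]
    simp_rw [real_inner_smul_right, smul_eq_mul]
    rw [integral_congr_ae (Eventually.of_forall fun y => mul_comm _ (u y)), h4]
    refine integral_congr_ae (Eventually.of_forall fun y => ?_)
    simp only [φ, real_inner_comm v, mul_comm]
  · intro y hy
    have : φ y = 0 := by
      by_contra h; exact hy (hx (hsupp h))
    simp [this]
  · intro y hy
    have : y ∉ tsupport (fderiv ℝ φ) := fun h => hy (hx (hts (tsupport_fderiv_subset ℝ h)))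
    simp [image_eq_zero_of_notMem_tsupport this]

end Mollify

/-! ### Lower bound for mollified functions -/

section LowerBound

variable {d : ℕ} {ι : Type*} {l : Filter ι} {p : ℝ} {ν : ι → RSpace d → ℝ≥0∞}

/-- Uniform continuity of `|·|^p` on `[-(M + 1), M + 1]`; taking `κ ≤ 1` keeps `b` in that interval.
-/
theorem exists_abs_rpow_le_add {p : ℝ} (hp : 0 < p) (M : ℝ) {η : ℝ} (hη : 0 < η) :
    ∃ κ > 0, ∀ a b : ℝ, |a| ≤ M → |b - a| ≤ κ → |a| ^ p ≤ |b| ^ p + η := by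
  have hc : Continuous fun a : ℝ => |a| ^ p := continuous_abs.rpow_const fun _ => Or.inr hp.le
  have huc := (isCompact_Icc (a := -(M + 1)) (b := M + 1)).uniformContinuousOn_of_continuous
    hc.continuousOn
  obtain ⟨κ, hκ, h⟩ := Metric.uniformContinuousOn_iff_le.1 huc η hη
  refine ⟨min κ 1, lt_min hκ one_pos, fun a b ha hab => ?_⟩
  have h1 := abs_le.1 (hab.trans (min_le_right _ _))
  have h2 := abs_le.1 ha
  have h3 := h a ⟨by linarith, by linarith⟩ b ⟨by linarith, by linarith⟩ (by
    rw [dist_comm, Real.dist_eq]; exact hab.trans (min_le_left _ _))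
  rw [Real.dist_eq] at h3
  linarith [(abs_le.1 h3).2]

/-- Division by `|h|` puts the linear term in `[-|g|, |g|]`, where one `κ` serves all `h`, and
differentiability makes the two quotients `κ`-close. The error `η |h|^p` costs at most `η` against a
kernel of mass at most `1`. -/
theorem exists_enorm_inner_rpow_le (hp : 0 < p) {w : RSpace d → ℝ} {g x : RSpace d}
    (hw : HasGradientAt w g x) {η : ℝ} (hη : 0 < η) :
    ∃ δ > 0, ∀ h : RSpace d, ‖h‖ ≤ δ →
      ‖inner ℝ g h‖ₑ ^ p ≤ ‖w (x + h) - w x‖ₑ ^ p + ENNReal.ofReal η * ‖h‖ₑ ^ p := by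
  obtain ⟨κ, hκ, hκ'⟩ := exists_abs_rpow_le_add hp ‖g‖ hη
  have h1 := (hasGradientAt_iff_isLittleO_nhds_zero.1 hw).bound hκ
  obtain ⟨δ, hδ, hδ'⟩ := Metric.eventually_nhds_iff.1 h1
  refine ⟨δ / 2, half_pos hδ, fun h hh => ?_⟩
  rcases eq_or_ne h 0 with rfl | h0
  · simp [hp]
  have hn : 0 < ‖h‖ := norm_pos_iff.2 h0
  have h2 := hδ' (y := h) (by rw [dist_zero_right]; linarith)
  have h3 := hκ' (inner ℝ g h / ‖h‖) ((w (x + h) - w x) / ‖h‖) (by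
    rw [abs_div, abs_norm, div_le_iff₀ hn]; exact abs_real_inner_le_norm g h) (by
    rw [← sub_div, abs_div, abs_norm, div_le_iff₀ hn]; exact h2)
  rw [abs_div, abs_div, abs_norm, Real.div_rpow (abs_nonneg _) hn.le,
    Real.div_rpow (abs_nonneg _) hn.le] at h3
  have hnp : 0 < ‖h‖ ^ p := Real.rpow_pos_of_pos hn p
  have h4 : |inner ℝ g h| ^ p ≤ |w (x + h) - w x| ^ p + η * ‖h‖ ^ p := by
    have := mul_le_mul_of_nonneg_right h3 hnp.le
    rwa [add_mul, div_mul_cancel₀ _ hnp.ne', div_mul_cancel₀ _ hnp.ne'] at this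
  have h5 := ENNReal.ofReal_le_ofReal h4
  rw [ENNReal.ofReal_add (by positivity) (by positivity), ENNReal.ofReal_mul hη.le,
    ← ENNReal.ofReal_rpow_of_nonneg (abs_nonneg _) hp.le,
    ← ENNReal.ofReal_rpow_of_nonneg (abs_nonneg _) hp.le,
    ← ENNReal.ofReal_rpow_of_nonneg (norm_nonneg _) hp.le, ofReal_norm] at h5
  rwa [Real.enorm_eq_ofReal_abs, Real.enorm_eq_ofReal_abs]

theorem IsLevyFamily.le_liminf_of_hasGradientAt [l.NeBot] (hν : IsLevyFamily l p ν) (hp : 0 < p)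
    {e : RSpace d} (he : ‖e‖ = 1) {w : RSpace d → ℝ} {g x : RSpace d} (hw : HasGradientAt w g x)
    {r : ℝ} (hr : 0 < r) :
    ENNReal.ofReal (sphereMean p e) * ‖g‖ₑ ^ p ≤ liminf (fun i =>
      ∫⁻ h in Metric.closedBall (0 : RSpace d) r, ν i h * ‖w (x + h) - w x‖ₑ ^ p) l := by
  refine ENNReal.le_of_forall_pos_le_add fun η hη _ => ?_
  obtain ⟨δ, hδ, hδ'⟩ := exists_enorm_inner_rpow_le hp hw (η := η) hη
  -- `δ` is for the expansion, `r` keeps the ball inside the given one, and `1` ensures that the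
  -- mass `∫ ν |h|^p` on the ball is at most `1` and tends to `1`.
  set s := min δ (min r 1) with hs
  have hs0 : 0 < s := lt_min hδ (lt_min hr one_pos)
  have hs1 : s ≤ 1 := (min_le_right _ _).trans (min_le_right _ _)
  have hsr : s ≤ r := (min_le_right _ _).trans (min_le_left _ _)
  have h1 : ∀ i, ENNReal.ofReal (sphereMean p e) * ‖g‖ₑ ^ p *
      (∫⁻ h in Metric.closedBall (0 : RSpace d) s, ν i h * ‖h‖ₑ ^ p) - η ≤
      ∫⁻ h in Metric.closedBall (0 : RSpace d) r, ν i h * ‖w (x + h) - w x‖ₑ ^ p := fun i => by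
    rw [tsub_le_iff_right, ← lintegral_kernel_inner (hν.measurable i) (hν.radial i) hp he]
    have hm := (hν.measurable i).restrict (s := Metric.closedBall (0 : RSpace d) s)
    calc _ ≤ ∫⁻ h in Metric.closedBall (0 : RSpace d) s, (ν i h * ‖w (x + h) - w x‖ₑ ^ p
            + η * (ν i h * ‖h‖ₑ ^ p)) := by
          refine setLIntegral_mono_ae' measurableSet_closedBall (Eventually.of_forall fun h hh => ?_)
          calc _ ≤ ν i h * (‖w (x + h) - w x‖ₑ ^ p + ENNReal.ofReal η * ‖h‖ₑ ^ p) := by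
                gcongr
                exact hδ' h ((mem_closedBall_zero_iff.1 hh).trans (min_le_left _ _))
            _ = _ := by rw [ENNReal.ofReal_coe_nnreal]; ring
      _ = (∫⁻ h in Metric.closedBall (0 : RSpace d) s, ν i h * ‖w (x + h) - w x‖ₑ ^ p)
            + η * ∫⁻ h in Metric.closedBall (0 : RSpace d) s, ν i h * ‖h‖ₑ ^ p := by
          rw [lintegral_add_right' _ (by fun_prop), lintegral_const_mul'' _ (by fun_prop)]
      _ ≤ _ := by
          gcongr
          calc (η : ℝ≥0∞) * _ ≤ η * 1 := by gcongr; exact hν.mass_le_one hp hs1 i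
            _ = η := mul_one _
  have h2 : Tendsto (fun i => ENNReal.ofReal (sphereMean p e) * ‖g‖ₑ ^ p *
      (∫⁻ h in Metric.closedBall (0 : RSpace d) s, ν i h * ‖h‖ₑ ^ p) - η) l
      (𝓝 (ENNReal.ofReal (sphereMean p e) * ‖g‖ₑ ^ p - η)) := by
    have h3 := ENNReal.Tendsto.const_mul (a := ENNReal.ofReal (sphereMean p e) * ‖g‖ₑ ^ p)
      (hν.tendsto_mass hp hs0 hs1) (Or.inl one_ne_zero)
    rw [mul_one] at h3
    exact ENNReal.Tendsto.sub h3 tendsto_const_nhds (Or.inr ENNReal.coe_ne_top)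
  rw [← tsub_le_iff_right, ← h2.liminf_eq]
  exact liminf_le_liminf (Eventually.of_forall h1)

/-- Fatou's lemma in `x` applied to the pointwise bound; this is what requires a countably generated
filter. -/
theorem IsLevyFamily.le_liminf_of_differentiable [l.NeBot] [l.IsCountablyGenerated]
    (hν : IsLevyFamily l p ν) (hp : 0 < p)
    {e : RSpace d} (he : ‖e‖ = 1) {w : RSpace d → ℝ} (hw : Differentiable ℝ w)
    {r : ℝ} (hr : 0 < r) (A : Set (RSpace d)) :
    ENNReal.ofReal (sphereMean p e) * ∫⁻ x in A, ‖gradient w x‖ₑ ^ p ≤ liminf (fun i =>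
      ∫⁻ h in Metric.closedBall (0 : RSpace d) r,
        ν i h * ∫⁻ x in A, ‖w (x + h) - w x‖ₑ ^ p) l := by
  have hwm : Measurable w := hw.continuous.measurable
  have hm : ∀ i, AEMeasurable (fun q : RSpace d × RSpace d =>
      ν i q.2 * ‖w (q.1 + q.2) - w q.1‖ₑ ^ p)
      ((volume.restrict A).prod (volume.restrict (Metric.closedBall (0 : RSpace d) r))) := fun i =>
    ((hν.measurable i).restrict.comp_snd).mul (Measurable.aemeasurable (by fun_prop))
  have h1 : ∀ i, ∫⁻ h in Metric.closedBall (0 : RSpace d) r,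
      ν i h * ∫⁻ x in A, ‖w (x + h) - w x‖ₑ ^ p = ∫⁻ x in A,
        ∫⁻ h in Metric.closedBall (0 : RSpace d) r, ν i h * ‖w (x + h) - w x‖ₑ ^ p := fun i => by
    rw [lintegral_lintegral_swap (hm i)]
    refine lintegral_congr fun h => ?_
    rw [lintegral_const_mul _ (by fun_prop)]
  simp_rw [h1]
  rw [← lintegral_const_mul' _ _ ENNReal.ofReal_ne_top]
  refine le_trans (lintegral_mono fun x => ?_)
    (lintegral_liminf_le' fun i => (hm i).lintegral_prod_right')
  exact hν.le_liminf_of_hasGradientAt hp he (hw x).hasGradientAt hr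

/-- Jensen: mollification does not increase the nonlocal energy. -/
theorem lintegral_mollify_le_nonlocalEnergy {Ω C : Set (RSpace d)} (hΩ : MeasurableSet Ω)
    (hC : MeasurableSet C) {k : RSpace d → ℝ≥0∞} (hk : AEMeasurable k volume)
    (hr : ∀ h h' : RSpace d, ‖h‖ = ‖h'‖ → k h = k h') {u : RSpace d → ℝ} (hu : Measurable u)
    (hul : LocallyIntegrable u) (hp : 1 ≤ p) {n : ℕ} {r : ℝ} (hr0 : 0 ≤ r)
    (hCΩ : ∀ x ∈ C, Metric.closedBall x (r + 1 / ((n : ℝ) + 1)) ⊆ Ω) :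
    ∫⁻ h in Metric.closedBall (0 : RSpace d) r,
        k h * ∫⁻ x in C, ‖mollify n u (x + h) - mollify n u x‖ₑ ^ p
      ≤ nonlocalEnergy Ω p k u := by
  rw [nonlocalEnergy_eq hΩ hk hr hu]
  refine le_trans (setLIntegral_mono_ae' measurableSet_closedBall
    (Eventually.of_forall fun h hh => ?_)) (setLIntegral_le_lintegral _ _)
  refine mul_le_mul_right ?_ _
  have hhr : ‖h‖ ≤ r := mem_closedBall_zero_iff.1 hh
  let f : RSpace d → ℝ≥0∞ := fun z => ‖u (z + h) - u z‖ₑ ^ p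
  have hf : Measurable f := by fun_prop
  have hη : Measurable (mollifier d n) := mollifier_contDiff.continuous.measurable
  calc ∫⁻ x in C, ‖mollify n u (x + h) - mollify n u x‖ₑ ^ p
      ≤ ∫⁻ x in C, ∫⁻ t, ENNReal.ofReal (mollifier d n t) * f (x - t) := by
        refine lintegral_mono fun x => ?_
        rw [mollify_add_sub hul]
        exact enorm_mollify_rpow_le hp (by fun_prop) x
    _ = ∫⁻ t, ENNReal.ofReal (mollifier d n t) * ∫⁻ x in C, f (x - t) := by
        rw [lintegral_lintegral_swap (Measurable.aemeasurable (by fun_prop))]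
        exact lintegral_congr fun t => lintegral_const_mul _ (by fun_prop)
    _ ≤ ∫⁻ t, ENNReal.ofReal (mollifier d n t) *
          ∫⁻ x in Ω, Ω.indicator (fun z => ‖u z - u x‖ₑ ^ p) (x + h) := by
        refine lintegral_mono fun t => ?_
        by_cases ht : 1 / ((n : ℝ) + 1) ≤ ‖t‖
        · simp [mollifier_eq_zero ht]
        refine mul_le_mul_right ?_ _
        rw [← lintegral_indicator hC, ← lintegral_indicator hΩ, ← lintegral_add_right_eq_self _ t]
        refine lintegral_mono fun z => ?_
        -- As `|t| < 1 / (n + 1)` and `|h| ≤ r`, both `z` and `z + h` are within `r + 1 / (n + 1)`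
        -- of the point `z + t` of `C`, hence in `Ω`.
        by_cases hz : z + t ∈ C
        · have hz1 : z ∈ Ω := hCΩ _ hz (by
            rw [Metric.mem_closedBall, dist_eq_norm]
            have : z - (z + t) = -t := by abel
            rw [this, norm_neg]; linarith [not_le.1 ht])
          have hz2 : z + h ∈ Ω := hCΩ _ hz (by
            rw [Metric.mem_closedBall, dist_eq_norm]
            have : z + h - (z + t) = h - t := by abel
            rw [this]; linarith [not_le.1 ht, norm_sub_le h t])
          rw [indicator_of_mem hz, indicator_of_mem hz1, indicator_of_mem hz2]
          simp only [f, add_sub_cancel_right]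
          exact le_rfl
        · simp [indicator_of_notMem hz]
    _ = ∫⁻ x in Ω, Ω.indicator (fun z => ‖u z - u x‖ₑ ^ p) (x + h) := by
        rw [lintegral_mul_const _ (by fun_prop), lintegral_mollifier, one_mul]

theorem IsLevyFamily.lintegral_gradient_mollify_le [l.NeBot] [l.IsCountablyGenerated]
    (hν : IsLevyFamily l p ν) (hp : 1 ≤ p)
    {e : RSpace d} (he : ‖e‖ = 1) {Ω C : Set (RSpace d)} (hΩ : MeasurableSet Ω)
    (hC : MeasurableSet C) {u : RSpace d → ℝ} (hu : Measurable u)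
    (hul : LocallyIntegrable u) {n : ℕ} {r : ℝ} (hr0 : 0 < r)
    (hCΩ : ∀ x ∈ C, Metric.closedBall x (r + 1 / ((n : ℝ) + 1)) ⊆ Ω) :
    ENNReal.ofReal (sphereMean p e) * ∫⁻ x in C, ‖gradient (mollify n u) x‖ₑ ^ p ≤
      liminf (fun i => nonlocalEnergy Ω p (ν i) u) l :=
  (hν.le_liminf_of_differentiable (zero_lt_one.trans_le hp) he
    ((contDiff_mollify hul).differentiable (by simp)) hr0 C).trans
    (liminf_le_liminf (Eventually.of_forall fun i =>
      lintegral_mollify_le_nonlocalEnergy hΩ hC (hν.measurable i) (hν.radial i) hu hul hp hr0.le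
        hCΩ))

end LowerBound

/-! ### Exhaustion of `Ω` by inner sets -/

section InnerSet

variable {d : ℕ}

/-- The points of `Ω` at distance more than `2 / (n + 1)` from the complement. -/
def innerSet (Ω : Set (RSpace d)) (n : ℕ) : Set (RSpace d) :=
  {x | ENNReal.ofReal (2 / ((n : ℝ) + 1)) < Metric.infEDist x Ωᶜ}

theorem isOpen_innerSet (Ω : Set (RSpace d)) (n : ℕ) : IsOpen (innerSet Ω n) :=
  isOpen_lt continuous_const Metric.continuous_infEDist

theorem monotone_innerSet (Ω : Set (RSpace d)) : Monotone (innerSet Ω) := fun m n hmn x hx => by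
  refine lt_of_le_of_lt (ENNReal.ofReal_le_ofReal ?_) hx
  have : (m : ℝ) ≤ n := Nat.cast_le.2 hmn
  gcongr

theorem closedBall_subset_of_mem_innerSet {Ω : Set (RSpace d)} {n : ℕ} {x : RSpace d}
    (hx : x ∈ innerSet Ω n) : Metric.closedBall x (2 / ((n : ℝ) + 1)) ⊆ Ω := fun y hy => by
  by_contra h
  have h1 : Metric.infEDist x Ωᶜ ≤ edist x y := Metric.infEDist_le_edist_of_mem h
  have h2 : edist x y ≤ ENNReal.ofReal (2 / ((n : ℝ) + 1)) := by
    rw [edist_dist]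
    exact ENNReal.ofReal_le_ofReal (by rw [dist_comm]; exact hy)
  exact absurd hx (not_lt.2 (h1.trans h2))

theorem innerSet_subset (Ω : Set (RSpace d)) (n : ℕ) : innerSet Ω n ⊆ Ω := fun x hx =>
  closedBall_subset_of_mem_innerSet hx (Metric.mem_closedBall_self (by positivity))

theorem iUnion_innerSet {Ω : Set (RSpace d)} (hΩ : IsOpen Ω) : ⋃ n, innerSet Ω n = Ω := by
  refine Subset.antisymm (iUnion_subset (innerSet_subset Ω)) fun x hx => ?_
  have h0 : x ∉ closure Ωᶜ := by rw [hΩ.isClosed_compl.closure_eq]; simpa using hx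
  obtain ⟨ε, hε, h⟩ := Metric.exists_real_pos_lt_infEDist_of_notMem_closure h0
  have hlim : Tendsto (fun n : ℕ => 2 / ((n : ℝ) + 1)) atTop (𝓝 0) := by
    have := (tendsto_one_div_add_atTop_nhds_zero_nat (𝕜 := ℝ)).const_mul 2
    simpa [div_eq_mul_inv] using this
  obtain ⟨n, hn⟩ := (hlim.eventually (gt_mem_nhds hε)).exists
  exact mem_iUnion.2 ⟨n, lt_of_le_of_lt (ENNReal.ofReal_le_ofReal hn.le) h⟩

/-- Ensures that a fixed test function on `Ω` does not notice the restriction to `innerSet Ω n` once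
`n` is large. -/
theorem eventually_subset_innerSet {Ω C : Set (RSpace d)} (hΩ : IsOpen Ω) (hC : IsCompact C)
    (hCΩ : C ⊆ Ω) : ∀ᶠ n in atTop, C ⊆ innerSet Ω n := by
  obtain ⟨n, hn⟩ := hC.elim_directed_cover (innerSet Ω) (isOpen_innerSet Ω)
    (by rwa [iUnion_innerSet hΩ]) (monotone_innerSet Ω).directed_le
  exact (eventually_ge_atTop n).mono fun m hm => hn.trans (monotone_innerSet Ω hm)

end InnerSet

/-! ### Lower bound for weak gradients and for the total variation -/

section LowerBound

variable {d : ℕ} {ι : Type*} {l : Filter ι} {p : ℝ} {ν : ι → RSpace d → ℝ≥0∞}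

theorem IsLevyFamily.lintegral_innerSet_le [l.NeBot] [l.IsCountablyGenerated]
    (hν : IsLevyFamily l p ν) (hp : 1 ≤ p)
    {e : RSpace d} (he : ‖e‖ = 1) {Ω : Set (RSpace d)} (hΩ : MeasurableSet Ω)
    {u : RSpace d → ℝ} (hu : Measurable u) (hul : LocallyIntegrable u) (n : ℕ) :
    ENNReal.ofReal (sphereMean p e) * ∫⁻ x in innerSet Ω n, ‖gradient (mollify n u) x‖ₑ ^ p ≤
      liminf (fun i => nonlocalEnergy Ω p (ν i) u) l := by
  -- Of the distance `2 / (n + 1)` to the complement, half is used by the shift `h` and half by the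
  -- mollifier.
  refine hν.lintegral_gradient_mollify_le hp he hΩ (isOpen_innerSet Ω n).measurableSet hu hul
    (r := 1 / ((n : ℝ) + 1)) (by positivity) fun x hx => ?_
  have h := closedBall_subset_of_mem_innerSet hx
  rwa [show 1 / ((n : ℝ) + 1) + 1 / ((n : ℝ) + 1) = 2 / ((n : ℝ) + 1) by ring]

theorem continuous_gradient_of_contDiff {w : RSpace d → ℝ} (hw : ContDiff ℝ ∞ w) :
    Continuous (gradient w) :=
  (InnerProductSpace.toDual ℝ (RSpace d)).symm.continuous.comp (hw.continuous_fderiv (by simp))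

/-- Lower bound for functions with a weak gradient. -/
theorem IsLevyFamily.lintegral_hasWeakGradient_le [l.NeBot] [l.IsCountablyGenerated]
    (hν : IsLevyFamily l p ν) (hp : 1 ≤ p)
    {e : RSpace d} (he : ‖e‖ = 1) {Ω : Set (RSpace d)} (hΩ : IsOpen Ω)
    {u : RSpace d → ℝ} (hu : Measurable u) (hul : LocallyIntegrable u)
    {g : RSpace d → RSpace d} (hg : HasWeakGradient Ω u g) (hgl : LocallyIntegrable g) :
    ENNReal.ofReal (sphereMean p e) * ∫⁻ x in Ω, ‖g x‖ₑ ^ p ≤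
      liminf (fun i => nonlocalEnergy Ω p (ν i) u) l := by
  set A := liminf (fun i => nonlocalEnergy Ω p (ν i) u) l
  let f : ℕ → RSpace d → ℝ≥0∞ := fun n => (innerSet Ω n).indicator fun x =>
    ENNReal.ofReal (sphereMean p e) * ‖gradient (mollify n u) x‖ₑ ^ p
  have hfm : ∀ n, Measurable (f n) := fun n => by
    have := (continuous_gradient_of_contDiff (contDiff_mollify (n := n) hul)).measurable
    exact Measurable.indicator (by fun_prop) (isOpen_innerSet Ω n).measurableSet
  have h1 : ∀ n, ∫⁻ x, f n x ≤ A := fun n => by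
    rw [lintegral_indicator (isOpen_innerSet Ω n).measurableSet,
      lintegral_const_mul' _ _ ENNReal.ofReal_ne_top]
    exact hν.lintegral_innerSet_le hp he hΩ.measurableSet hu hul n
  -- At a point of `Ω` the gradient of the mollification is eventually the mollification of `g`,
  -- which converges to `g` almost everywhere.
  have h2 : ∀ᵐ x ∂(volume.restrict Ω), ENNReal.ofReal (sphereMean p e) * ‖g x‖ₑ ^ p =
      liminf (fun n => f n x) atTop := by
    filter_upwards [ae_restrict_of_ae (ae_tendsto_mollify hgl), ae_restrict_mem hΩ.measurableSet]
      with x hx hxΩ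
    refine (Tendsto.liminf_eq ?_).symm
    have h3 : Tendsto (fun n => ENNReal.ofReal (sphereMean p e) * ‖mollify n g x‖ₑ ^ p) atTop
        (𝓝 (ENNReal.ofReal (sphereMean p e) * ‖g x‖ₑ ^ p)) :=
      ENNReal.Tendsto.const_mul (hx.enorm.ennrpow_const p) (Or.inr ENNReal.ofReal_ne_top)
    refine h3.congr' ?_
    filter_upwards [eventually_subset_innerSet hΩ isCompact_singleton (singleton_subset_iff.2 hxΩ)]
      with n hn
    have hxn := singleton_subset_iff.1 hn
    simp only [f, indicator_of_mem hxn]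
    rw [gradient_mollify_of_hasWeakGradient hg hul hgl]
    refine (Metric.closedBall_subset_closedBall ?_).trans (closedBall_subset_of_mem_innerSet hxn)
    gcongr; norm_num
  rw [← lintegral_const_mul' _ _ ENNReal.ofReal_ne_top, lintegral_congr_ae h2]
  refine (lintegral_liminf_le hfm).trans ?_
  refine liminf_le_of_frequently_le (Frequently.of_forall fun n => ?_)
  exact (setLIntegral_le_lintegral _ _).trans (h1 n)

theorem integral_mul_fderiv_eq_neg {w φ : RSpace d → ℝ} (hw : ContDiff ℝ ∞ w)
    (hφ : ContDiff ℝ ∞ φ) (hs : HasCompactSupport φ) (v : RSpace d) :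
    ∫ x, w x * fderiv ℝ φ x v = - ∫ x, inner ℝ (gradient w x) v * φ x := by
  simp_rw [inner_gradient_left]
  have hcw : Continuous fun x => fderiv ℝ w x v :=
    (hw.continuous_fderiv (by simp)).clm_apply continuous_const
  have hcφ : Continuous fun x => fderiv ℝ φ x v :=
    (hφ.continuous_fderiv (by simp)).clm_apply continuous_const
  refine integral_mul_fderiv_eq_neg_fderiv_mul_of_integrable ?_ ?_ ?_
    (fun x _ => hw.differentiable (by simp) x) fun x _ => hφ.differentiable (by simp) x
  · exact (hcw.mul hφ.continuous).integrable_of_hasCompactSupport hs.mul_left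
  · exact (hw.continuous.mul hcφ).integrable_of_hasCompactSupport (hs.fderiv_apply (𝕜 := ℝ) v).mul_left
  · exact (hw.continuous.mul hφ.continuous).integrable_of_hasCompactSupport hs.mul_left

theorem IsTestFunction.component {Ω : Set (RSpace d)} {φ : RSpace d → RSpace d}
    (hφ : IsTestFunction Ω φ) (i : Fin d) : IsTestFunction Ω fun x => φ x i := by
  have hsub : Function.support (fun x => φ x i) ⊆ Function.support φ := fun x hx h0 => hx (by
    simp [h0])
  refine ⟨(EuclideanSpace.proj (𝕜 := ℝ) i).contDiff.comp hφ.1, ?_, (closure_mono hsub).trans hφ.2.2⟩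
  exact hφ.2.1.mono hsub

theorem divergence_eq_sum {φ : RSpace d → RSpace d} (hφ : ContDiff ℝ ∞ φ) (x : RSpace d) :
    divergence φ x = ∑ i, fderiv ℝ (fun y => φ y i) x (EuclideanSpace.single i 1) := by
  refine Finset.sum_congr rfl fun i _ => ?_
  have h := (EuclideanSpace.proj (𝕜 := ℝ) i).hasFDerivAt.comp x
    (hφ.differentiable (by simp) x).hasFDerivAt
  have h' : fderiv ℝ (fun y => φ y i) x = (EuclideanSpace.proj (𝕜 := ℝ) i).comp (fderiv ℝ φ x) :=
    h.fderiv
  rw [h']; rfl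

theorem continuous_divergence {φ : RSpace d → RSpace d} (hφ : ContDiff ℝ ∞ φ) :
    Continuous (divergence φ) := by
  unfold divergence
  refine continuous_finsetSum _ fun i _ => ?_
  exact (EuclideanSpace.proj (𝕜 := ℝ) i).continuous.comp
    ((hφ.continuous_fderiv (by simp)).clm_apply continuous_const)

theorem support_divergence_subset (φ : RSpace d → RSpace d) :
    Function.support (divergence φ) ⊆ tsupport φ := fun x hx => by
  by_contra h
  refine hx ?_
  have : fderiv ℝ φ x = 0 := image_eq_zero_of_notMem_tsupport
    fun h' => h (tsupport_fderiv_subset ℝ h')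
  simp [divergence, this]

theorem integral_mul_divergence_eq_neg {w : RSpace d → ℝ} {φ : RSpace d → RSpace d}
    {Ω : Set (RSpace d)} (hw : ContDiff ℝ ∞ w) (hφ : IsTestFunction Ω φ) :
    ∫ x, w x * divergence φ x = - ∫ x, inner ℝ (gradient w x) (φ x) := by
  simp_rw [divergence_eq_sum hφ.1, Finset.mul_sum]
  rw [integral_finsetSum]
  · simp_rw [fun i => integral_mul_fderiv_eq_neg hw (hφ.component i).1 (hφ.component i).2.1
      (EuclideanSpace.single i 1)]
    rw [Finset.sum_neg_distrib, ← integral_finsetSum]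
    · congr 1
      refine integral_congr_ae (Eventually.of_forall fun x => ?_)
      simp only [EuclideanSpace.inner_single_right, PiLp.inner_apply (gradient w x) (φ x)]
      simp [mul_comm]
    · intro i _
      refine Continuous.integrable_of_hasCompactSupport ?_ (hφ.component i).2.1.mul_left
      exact ((continuous_gradient_of_contDiff hw).inner continuous_const).mul
        (hφ.component i).1.continuous
  · intro i _
    refine Continuous.integrable_of_hasCompactSupport ?_
      ((hφ.component i).2.1.fderiv_apply (𝕜 := ℝ) _).mul_left
    exact hw.continuous.mul
      (((hφ.component i).1.continuous_fderiv (by simp)).clm_apply continuous_const)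

/-- Lower bound for the total variation. -/
theorem IsLevyFamily.bvSeminorm_le [l.NeBot] [l.IsCountablyGenerated]
    {ν : ι → RSpace d → ℝ≥0∞} (hν : IsLevyFamily l 1 ν)
    {e : RSpace d} (he : ‖e‖ = 1) {Ω : Set (RSpace d)} (hΩ : IsOpen Ω)
    {u : RSpace d → ℝ} (hu : Measurable u) (hul : LocallyIntegrable u) :
    ENNReal.ofReal (sphereMean 1 e) * bvSeminorm Ω u ≤
      liminf (fun i => nonlocalEnergy Ω 1 (ν i) u) l := by
  rw [bvSeminorm, ENNReal.mul_iSup]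
  refine iSup_le fun φ => ?_
  rw [ENNReal.mul_iSup]
  refine iSup_le fun ⟨hφ, hφ1⟩ => ?_
  have hdc : HasCompactSupport (divergence φ) :=
    hφ.2.1.of_isClosed_subset (isClosed_tsupport _)
      (closure_minimal (support_divergence_subset φ) (isClosed_tsupport _))
  rw [setIntegral_eq_integral_of_forall_compl_eq_zero fun x hx => by
    have : divergence φ x = 0 := by
      by_contra h; exact hx (hφ.2.2 (support_divergence_subset φ h))
    rw [this, mul_zero]]
  -- Only the test integral has to converge as `n → ∞`. For each large `n`, integration by parts
  -- bounds it by the `L^1` norm of the mollified gradient on `innerSet Ω n`, which contains the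
  -- support of `φ`.
  have hlim := ENNReal.Tendsto.const_mul (a := ENNReal.ofReal (sphereMean 1 e))
    (ENNReal.tendsto_ofReal (tendsto_integral_mollify_mul hul (continuous_divergence hφ.1) hdc))
    (Or.inr ENNReal.ofReal_ne_top)
  refine le_of_tendsto hlim ?_
  filter_upwards [eventually_subset_innerSet hΩ hφ.2.1 hφ.2.2] with n hn
  refine le_trans ?_ (hν.lintegral_innerSet_le le_rfl he hΩ.measurableSet hu hul n)
  gcongr
  rw [integral_mul_divergence_eq_neg (contDiff_mollify hul) hφ]
  calc ENNReal.ofReal (-∫ x, inner ℝ (gradient (mollify n u) x) (φ x))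
      ≤ ‖∫ x, inner ℝ (gradient (mollify n u) x) (φ x)‖ₑ := by
        rw [Real.enorm_eq_ofReal_abs]
        exact ENNReal.ofReal_le_ofReal (neg_le_abs _)
    _ ≤ ∫⁻ x, ‖inner ℝ (gradient (mollify n u) x) (φ x)‖ₑ := enorm_integral_le_lintegral_enorm _
    _ ≤ ∫⁻ x, (innerSet Ω n).indicator (fun x => ‖gradient (mollify n u) x‖ₑ ^ (1 : ℝ)) x := by
        refine lintegral_mono fun x => ?_
        by_cases hx : x ∈ innerSet Ω n
        · rw [indicator_of_mem hx, ENNReal.rpow_one, enorm_le_iff_norm_le]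
          refine (norm_inner_le_norm _ _).trans ?_
          exact mul_le_of_le_one_right (norm_nonneg _) (hφ1 x)
        · rw [indicator_of_notMem hx,
            image_eq_zero_of_notMem_tsupport (f := φ) fun h => hx (hn h)]
          simp
    _ = _ := lintegral_indicator (isOpen_innerSet Ω n).measurableSet _

end LowerBound

/-! ### Weak compactness in `L^p` for nonnegative functions -/

section WeakCompactness

variable {α : Type*} [MeasurableSpace α] {μ : Measure α} {p q : ℝ}

/-- Weak compactness of bounded sets of nonnegative functions in `L^p`, `1 < p < ∞`. -/
theorem exists_tendsto_lintegral_mul [SigmaFinite μ] (hpq : p.HolderConjugate q)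
    {g : ℕ → α → ℝ≥0∞} (hg : ∀ n, Measurable (g n)) {C : ℝ≥0∞} (hC : C ≠ ⊤)
    (hb : ∀ n, ∫⁻ x, g n x ^ p ∂μ ≤ C) (U : Ultrafilter ℕ) :
    ∃ G : α → ℝ≥0∞, Measurable G ∧ ∫⁻ x, G x ^ p ∂μ ≤ C ∧
      ∀ ψ : α → ℝ≥0∞, Measurable ψ → ∫⁻ x, ψ x ^ q ∂μ ≠ ⊤ →
        Tendsto (fun n => ∫⁻ x, ψ x * g n x ∂μ) U (𝓝 (∫⁻ x, ψ x * G x ∂μ)) := by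
  have hp0 : 0 < p := hpq.pos
  have hq0 : 0 < q := hpq.symm.pos
  -- Since `[0, ∞]` is compact, the limit `T ψ` along the ultrafilter exists for every `ψ`, without
  -- extracting subsequences. On measurable functions `T` is additive and bounded by Hölder, and
  -- Radon–Nikodym will represent it.
  have hex : ∀ ψ : α → ℝ≥0∞, ∃ a, Tendsto (fun n => ∫⁻ x, ψ x * g n x ∂μ) U (𝓝 a) := fun ψ => by
    obtain ⟨a, -, ha⟩ := isCompact_univ.ultrafilter_le_nhds
      (U.map fun n => ∫⁻ x, ψ x * g n x ∂μ) (by simp)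
    exact ⟨a, ha⟩
  choose T hT using hex
  have hTle : ∀ ψ : α → ℝ≥0∞, Measurable ψ →
      T ψ ≤ C ^ (1 / p) * (∫⁻ x, ψ x ^ q ∂μ) ^ (1 / q) := fun ψ hψ => by
    refine le_of_tendsto (hT ψ) (Eventually.of_forall fun n => ?_)
    have h := ENNReal.lintegral_mul_le_Lp_mul_Lq μ hpq (hg n).aemeasurable hψ.aemeasurable
    simp only [Pi.mul_apply] at h
    simp_rw [mul_comm (ψ _)]
    refine h.trans ?_
    gcongr
    exact hb n
  have hTadd : ∀ ψ χ : α → ℝ≥0∞, Measurable ψ → T (fun x => ψ x + χ x) = T ψ + T χ :=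
    fun ψ χ hψ => by
      refine tendsto_nhds_unique (hT _) (((hT ψ).add (hT χ)).congr fun n => ?_)
      rw [← lintegral_add_left (f := fun x => ψ x * g n x) (hψ.mul (hg n))]
      simp_rw [add_mul]
  have hTmono : ∀ ψ χ : α → ℝ≥0∞, (∀ x, ψ x ≤ χ x) → T ψ ≤ T χ := fun ψ χ h =>
    le_of_tendsto_of_tendsto (hT ψ) (hT χ) (Eventually.of_forall fun n => by
      refine lintegral_mono fun x => ?_
      exact mul_le_mul' (h x) le_rfl)
  have hTzero : ∀ ψ : α → ℝ≥0∞, Measurable ψ → ∫⁻ x, ψ x ^ q ∂μ = 0 → T ψ = 0 := fun ψ hψ h => by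
    have := hTle ψ hψ
    rw [h, ENNReal.zero_rpow_of_pos (by positivity), mul_zero] at this
    exact le_antisymm this zero_le
  -- The weight `W` is positive and lies in `L^q`, so `A ↦ T (1_A W)` is a finite measure even if
  -- `μ` is infinite. It is divided out again in the definition of `G`.
  obtain ⟨w, hw0, hwm, hw1⟩ := exists_pos_lintegral_lt_of_sigmaFinite μ one_ne_zero
  let W : α → ℝ≥0∞ := fun x => (w x : ℝ≥0∞) ^ (1 / q)
  have hWm : Measurable W := by fun_prop
  have hW0 : ∀ x, W x ≠ 0 := fun x =>
    (ENNReal.rpow_pos (ENNReal.coe_pos.2 (hw0 x)) ENNReal.coe_ne_top).ne'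
  have hWt : ∀ x, W x ≠ ⊤ := fun x =>
    ENNReal.rpow_ne_top_of_nonneg (by positivity) ENNReal.coe_ne_top
  have hWq : ∀ x, W x ^ q = w x := fun x => by
    simp only [W]
    rw [← ENNReal.rpow_mul, one_div_mul_cancel hq0.ne', ENNReal.rpow_one]
  let lam : Measure α := μ.withDensity fun x => (w x : ℝ≥0∞)
  have hlamfin : IsFiniteMeasure lam :=
    ⟨by rw [withDensity_apply _ .univ, Measure.restrict_univ]; exact hw1.trans ENNReal.one_lt_top⟩
  have hind : ∀ A, MeasurableSet A → ∫⁻ x, (A.indicator W x) ^ q ∂μ = lam A := fun A hA => by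
    rw [withDensity_apply _ hA, ← lintegral_indicator hA]
    refine lintegral_congr fun x => ?_
    by_cases hx : x ∈ A
    · simp [indicator_of_mem hx, hWq]
    · simp [indicator_of_notMem hx, hq0]
  have hmle : ∀ A, MeasurableSet A → T (A.indicator W) ≤ C ^ (1 / p) * lam A ^ (1 / q) :=
    fun A hA => by rw [← hind A hA]; exact hTle _ (hWm.indicator hA)
  have hm0 : T ((∅ : Set α).indicator W) = 0 := by
    have := hmle ∅ .empty
    rw [measure_empty, ENNReal.zero_rpow_of_pos (by positivity), mul_zero] at this
    exact le_antisymm this zero_le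
  have hmadd : ∀ A B, MeasurableSet A → Disjoint A B →
      T ((A ∪ B).indicator W) = T (A.indicator W) + T (B.indicator W) := fun A B hA hAB => by
    rw [← hTadd _ _ (hWm.indicator hA), indicator_union_of_disjoint hAB]
  -- Countable additivity: the tails of a disjoint union have `lam`-measure tending to `0`, and on a
  -- set `A` the value of `T` is at most `C^(1/p) (lam A)^(1/q)`.
  let m : Measure α := Measure.ofMeasurable (fun A _ => T (A.indicator W)) hm0 (by
    intro A hA hd
    have hfin : ∀ N, T ((⋃ i, A i).indicator W) =
        ∑ i ∈ Finset.range N, T ((A i).indicator W) + T ((⋃ i, A (i + N)).indicator W) := by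
      intro N
      induction N with
      | zero => simp
      | succ N ih =>
        rw [ih, Finset.sum_range_succ, add_assoc]
        congr 1
        rw [← hmadd _ _ (hA N) ?_]
        · congr 2
          rw [← union_iUnion_nat_succ]
          simp only [zero_add, add_assoc, add_comm 1 N]
        · refine disjoint_iUnion_right.2 fun i => hd ?_
          omega
    have hlim1 : Tendsto (fun N => lam (⋃ i, A (i + N))) atTop (𝓝 0) := by
      have h1 : ∑' i, lam (A i) ≠ ⊤ := by
        rw [← measure_iUnion hd hA]; exact measure_ne_top _ _
      refine (ENNReal.tendsto_sum_nat_add _ h1).congr fun N => ?_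
      rw [measure_iUnion (f := fun i => A (i + N)) (fun i j hij => hd (by simpa using hij))
        fun i => hA _]
    have hlim2 : Tendsto (fun N => T ((⋃ i, A (i + N)).indicator W)) atTop (𝓝 0) := by
      have h2 : Tendsto (fun N => C ^ (1 / p) * lam (⋃ i, A (i + N)) ^ (1 / q)) atTop (𝓝 0) := by
        have h3 := ENNReal.Tendsto.const_mul (a := C ^ (1 / p)) (hlim1.ennrpow_const (1 / q))
          (Or.inr (ENNReal.rpow_ne_top_of_nonneg (by positivity) hC))
        rwa [ENNReal.zero_rpow_of_pos (by positivity), mul_zero] at h3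
      exact tendsto_of_tendsto_of_tendsto_of_le_of_le tendsto_const_nhds h2 (fun _ => zero_le)
        fun N => hmle _ (MeasurableSet.iUnion fun i => hA _)
    have hlim3 := (ENNReal.tendsto_nat_tsum fun i => T ((A i).indicator W)).add hlim2
    rw [add_zero] at hlim3
    exact tendsto_nhds_unique (tendsto_const_nhds.congr hfin) hlim3)
  have hmapp : ∀ A, MeasurableSet A → m A = T (A.indicator W) := fun A hA =>
    Measure.ofMeasurable_apply A hA
  have hmfin : IsFiniteMeasure m := ⟨by
    rw [hmapp _ .univ]
    exact (hmle _ .univ).trans_lt (ENNReal.mul_lt_top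
      (ENNReal.rpow_lt_top_of_nonneg (by positivity) hC)
      (ENNReal.rpow_lt_top_of_nonneg (by positivity) (measure_ne_top _ _)))⟩
  have hac : m ≪ μ := Measure.AbsolutelyContinuous.mk fun A hA h0 => by
    rw [hmapp A hA]
    refine hTzero _ (hWm.indicator hA) ?_
    rw [hind A hA]
    exact withDensity_absolutelyContinuous _ _ h0
  have hkey : ∀ f : α → ℝ≥0∞, Measurable f → ∫⁻ x, (f x * W x) ^ q ∂μ ≠ ⊤ →
      T (fun x => f x * W x) = ∫⁻ x, f x ∂m := by
    intro f hf
    refine Measurable.ennreal_induction (motive := fun f => ∫⁻ x, (f x * W x) ^ q ∂μ ≠ ⊤ →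
      T (fun x => f x * W x) = ∫⁻ x, f x ∂m) ?_ ?_ ?_ hf
    · intro c A hA hfinite
      rw [lintegral_indicator_const hA, hmapp A hA]
      have hrw : ∀ x, A.indicator (fun _ => c) x * W x = c * A.indicator W x := fun x => by
        by_cases hx : x ∈ A
        · simp [indicator_of_mem hx]
        · simp [indicator_of_notMem hx]
      simp_rw [hrw] at hfinite ⊢
      by_cases hc : c = ⊤
      · have hA0 : ∫⁻ x, (A.indicator W x) ^ q ∂μ = 0 := by
          by_contra hne
          refine hfinite ?_
          simp_rw [ENNReal.mul_rpow_of_nonneg _ _ hq0.le]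
          rw [lintegral_const_mul _ ((hWm.indicator hA).pow_const q), hc,
            ENNReal.top_rpow_of_pos hq0, ENNReal.top_mul hne]
        rw [hTzero _ (hWm.indicator hA) hA0, mul_zero]
        refine hTzero _ ((hWm.indicator hA).const_mul c) ?_
        simp_rw [ENNReal.mul_rpow_of_nonneg _ _ hq0.le]
        rw [lintegral_const_mul _ ((hWm.indicator hA).pow_const q), hA0, mul_zero]
      · refine tendsto_nhds_unique (hT _) ((ENNReal.Tendsto.const_mul (hT (A.indicator W))
          (Or.inr hc)).congr fun n => ?_)
        rw [← lintegral_const_mul' _ _ hc]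
        simp_rw [mul_assoc]
    · intro f₁ f₂ _ hf₁ hf₂ ih₁ ih₂ hfinite
      have h1 : ∫⁻ x, (f₁ x * W x) ^ q ∂μ ≠ ⊤ := ne_top_of_le_ne_top hfinite (by
        gcongr with x; exact le_self_add)
      have h2 : ∫⁻ x, (f₂ x * W x) ^ q ∂μ ≠ ⊤ := ne_top_of_le_ne_top hfinite (by
        gcongr with x; exact le_add_self)
      simp only [Pi.add_apply, add_mul]
      rw [hTadd (fun x => f₁ x * W x) _ (hf₁.mul hWm), ih₁ h1, ih₂ h2, lintegral_add_left hf₁]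
    · intro f hf hmono ih hfinite
      let F : α → ℝ≥0∞ := fun x => ⨆ n, f n x
      have hFm : Measurable F := Measurable.iSup hf
      have hfin' : ∀ n, ∫⁻ x, (f n x * W x) ^ q ∂μ ≠ ⊤ := fun n =>
        ne_top_of_le_ne_top hfinite (by
          gcongr with x; exact le_iSup (fun n => f n x) n)
      have hle1 : ∀ n, T (fun x => f n x * W x) ≤ T (fun x => F x * W x) := fun n =>
        hTmono _ _ fun x => mul_le_mul' (le_iSup (fun n => f n x) n) le_rfl
      -- A limit of integrals along an ultrafilter need not respect monotone limits. The Hölder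
      -- bound replaces monotone convergence: the remainder `(F - f n) W` tends to `0` in `L^q`.
      have hle2 : ∀ n, T (fun x => F x * W x) ≤ T (fun x => f n x * W x) +
          C ^ (1 / p) * (∫⁻ x, ((F x - f n x) * W x) ^ q ∂μ) ^ (1 / q) := fun n => by
        calc T (fun x => F x * W x) ≤ T (fun x => f n x * W x + (F x - f n x) * W x) :=
              hTmono _ _ fun x => by
                rw [← add_mul, add_tsub_cancel_of_le (le_iSup (fun n => f n x) n)]
          _ = T (fun x => f n x * W x) + T (fun x => (F x - f n x) * W x) :=
              hTadd _ _ ((hf n).mul hWm)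
          _ ≤ _ := add_le_add le_rfl (hTle _ ((hFm.sub (hf n)).mul hWm))
      have hFlt : ∀ᵐ x ∂μ, F x < ⊤ := by
        filter_upwards [ae_lt_top ((hFm.mul hWm).pow_const q) hfinite] with x hx
        by_contra h
        rw [not_lt, top_le_iff] at h
        simp only [Pi.mul_apply, h, ENNReal.top_mul (hW0 x), ENNReal.top_rpow_of_pos hq0,
          lt_self_iff_false] at hx
      have hlim : Tendsto (fun n => ∫⁻ x, ((F x - f n x) * W x) ^ q ∂μ) atTop (𝓝 0) := by
        have h0 : (0 : ℝ≥0∞) = ∫⁻ _, 0 ∂μ := by simp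
        rw [h0]
        refine tendsto_lintegral_of_dominated_convergence (fun x => (F x * W x) ^ q)
          (fun n => ((hFm.sub (hf n)).mul hWm).pow_const q) (fun n => ?_) hfinite ?_
        · exact Eventually.of_forall fun x => by
            exact ENNReal.rpow_le_rpow (mul_le_mul' tsub_le_self le_rfl) hq0.le
        · filter_upwards [hFlt] with x hx
          have h1 : Tendsto (fun n => f n x) atTop (𝓝 (F x)) :=
            tendsto_atTop_iSup fun i j hij => hmono hij x
          have h2 := ENNReal.Tendsto.sub (tendsto_const_nhds (x := F x)) h1 (Or.inl hx.ne)
          rw [tsub_self] at h2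
          have h3 := (ENNReal.Tendsto.mul_const (b := W x) h2 (Or.inr (hWt x))).ennrpow_const q
          rwa [zero_mul, ENNReal.zero_rpow_of_pos hq0] at h3
      have hlimI : Tendsto (fun n => T (fun x => f n x * W x)) atTop (𝓝 (∫⁻ x, F x ∂m)) := by
        simp_rw [fun n => ih n (hfin' n)]
        exact lintegral_tendsto_of_tendsto_of_monotone (fun n => (hf n).aemeasurable)
          (Eventually.of_forall fun x i j hij => hmono hij x)
          (Eventually.of_forall fun x => tendsto_atTop_iSup fun i j hij => hmono hij x)
      have hlimR := hlimI.add (ENNReal.Tendsto.const_mul (a := C ^ (1 / p))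
        (hlim.ennrpow_const (1 / q)) (Or.inr (ENNReal.rpow_ne_top_of_nonneg (by positivity) hC)))
      rw [ENNReal.zero_rpow_of_pos (by positivity), mul_zero, add_zero] at hlimR
      exact le_antisymm (ge_of_tendsto' hlimR hle2) (le_of_tendsto' hlimI hle1)
  let G : α → ℝ≥0∞ := fun x => m.rnDeriv μ x / W x
  have hGm : Measurable G := (Measure.measurable_rnDeriv m μ).div hWm
  have hTG : ∀ ψ : α → ℝ≥0∞, Measurable ψ → ∫⁻ x, ψ x ^ q ∂μ ≠ ⊤ → T ψ = ∫⁻ x, ψ x * G x ∂μ := by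
    intro ψ hψ hfinite
    have h1 : ∀ x, ψ x / W x * W x = ψ x := fun x => ENNReal.div_mul_cancel (hW0 x) (hWt x)
    have h2 := hkey (fun x => ψ x / W x) (hψ.div hWm) (by simp_rw [h1]; exact hfinite)
    simp_rw [h1] at h2
    rw [h2, ← Measure.withDensity_rnDeriv_eq m μ hac,
      lintegral_withDensity_eq_lintegral_mul _ (Measure.measurable_rnDeriv m μ) (by fun_prop)]
    refine lintegral_congr fun x => ?_
    simp only [Pi.mul_apply, G, div_eq_mul_inv]
    ring
  refine ⟨G, hGm, ?_, fun ψ hψ hfinite => hTG ψ hψ hfinite ▸ hT ψ⟩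
  -- The norm bound comes from testing with `G^(p-1)`, which gives `I ≤ C^(1/p) I^(1/q)`. Cancelling
  -- `I^(1/q)` requires `I` finite, hence the truncation to sets of finite measure on which `G ≤ k`.
  let S : ℕ → Set α := fun k => spanningSets μ k ∩ {x | G x ≤ k}
  have hSm : ∀ k, MeasurableSet (S k) := fun k =>
    (measurableSet_spanningSets μ k).inter (measurableSet_le hGm measurable_const)
  have hSle : ∀ k, ∫⁻ x in S k, G x ^ p ∂μ ≤ C := fun k => by
    set I := ∫⁻ x in S k, G x ^ p ∂μ with hI
    have hIt : I ≠ ⊤ := by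
      refine ne_top_of_le_ne_top (b := (k : ℝ≥0∞) ^ p * μ (S k)) ?_ ?_
      · refine ENNReal.mul_ne_top (ENNReal.rpow_ne_top_of_nonneg hp0.le (by simp)) ?_
        exact ((measure_mono inter_subset_left).trans_lt (measure_spanningSets_lt_top μ k)).ne
      · rw [← setLIntegral_const]
        refine setLIntegral_mono measurable_const fun x hx => ?_
        gcongr
        exact hx.2
    let ψ : α → ℝ≥0∞ := (S k).indicator fun x => G x ^ (p - 1)
    have hψm : Measurable ψ := (hGm.pow_const _).indicator (hSm k)
    have hψq : ∫⁻ x, ψ x ^ q ∂μ = I := by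
      rw [hI, ← lintegral_indicator (hSm k)]
      refine lintegral_congr fun x => ?_
      by_cases hx : x ∈ S k
      · simp only [ψ, indicator_of_mem hx]
        rw [← ENNReal.rpow_mul, hpq.sub_one_mul_conj]
      · simp [ψ, indicator_of_notMem hx, hq0]
    have hψG : ∫⁻ x, ψ x * G x ∂μ = I := by
      rw [hI, ← lintegral_indicator (hSm k)]
      refine lintegral_congr fun x => ?_
      by_cases hx : x ∈ S k
      · simp only [ψ, indicator_of_mem hx]
        conv_lhs => rw [← ENNReal.rpow_one (G x), ← ENNReal.rpow_mul, one_mul]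
        rw [← ENNReal.rpow_add_of_nonneg _ _ (by linarith [hpq.lt]) zero_le_one,
          sub_add_cancel]
      · simp [ψ, indicator_of_notMem hx]
    have h1 := hTle ψ hψm
    rw [hTG ψ hψm (by rwa [hψq]), hψG, hψq] at h1
    rcases eq_or_ne I 0 with h0 | h0
    · rw [h0]; exact zero_le
    have h2 : I ^ (1 / p) ≤ C ^ (1 / p) := by
      have hsplit : I = I ^ (1 / p) * I ^ (1 / q) := by
        rw [← ENNReal.rpow_add _ _ h0 hIt, one_div, one_div, hpq.inv_add_inv_eq_one,
          ENNReal.rpow_one]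
      rw [hsplit] at h1
      conv at h1 => rhs; rw [← hsplit]
      refine (ENNReal.mul_le_mul_iff_left (c := I ^ (1 / q)) ?_ ?_).1 h1
      · exact (ENNReal.rpow_pos (pos_iff_ne_zero.2 h0) hIt).ne'
      · exact ENNReal.rpow_ne_top_of_nonneg (by positivity) hIt
    exact (ENNReal.rpow_le_rpow_iff (by positivity)).1 h2
  have hGlt : ∀ᵐ x ∂μ, G x < ⊤ := by
    filter_upwards [Measure.rnDeriv_lt_top m μ] with x hx
    exact ENNReal.div_lt_top hx.ne (hW0 x)
  have hlim : ∀ᵐ x ∂μ, G x ^ p = liminf (fun k => (S k).indicator (fun x => G x ^ p) x) atTop := by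
    filter_upwards [hGlt] with x hx
    refine (Tendsto.liminf_eq (tendsto_const_nhds.congr' ?_)).symm
    obtain ⟨k₁, hk₁⟩ := ENNReal.exists_nat_gt hx.ne
    filter_upwards [eventually_ge_atTop k₁, eventually_ge_atTop (spanningSetsIndex μ x)] with k h1 h2
    rw [indicator_of_mem]
    refine ⟨monotone_spanningSets μ h2 (mem_spanningSetsIndex μ x), hk₁.le.trans ?_⟩
    exact_mod_cast h1
  rw [lintegral_congr_ae hlim]
  refine (lintegral_liminf_le fun k => (hGm.pow_const p).indicator (hSm k)).trans ?_
  refine liminf_le_of_frequently_le (Frequently.of_forall fun k => ?_)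
  rw [lintegral_indicator (hSm k)]
  exact hSle k

end WeakCompactness

/-! ### Weak compactness in `L^p` for real functions -/

section WeakCompactnessReal

variable {α : Type*} [MeasurableSpace α] {μ : Measure α} {p q : ℝ}

theorem integral_toReal_mul_ofReal (hpq : p.HolderConjugate q) {F : α → ℝ≥0∞} (hF : Measurable F)
    (hFp : ∫⁻ x, F x ^ p ∂μ ≠ ⊤) {ψ : α → ℝ} (hψ : Measurable ψ) (hψ0 : ∀ x, 0 ≤ ψ x)
    (hψq : ∫⁻ x, ENNReal.ofReal (ψ x) ^ q ∂μ ≠ ⊤) :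
    ∫⁻ x, ENNReal.ofReal (ψ x) * F x ∂μ ≠ ⊤ ∧ Integrable (fun x => (F x).toReal * ψ x) μ ∧
      ∫ x, (F x).toReal * ψ x ∂μ = (∫⁻ x, ENNReal.ofReal (ψ x) * F x ∂μ).toReal := by
  have hm : Measurable fun x => ENNReal.ofReal (ψ x) * F x := hψ.ennreal_ofReal.mul hF
  have hfin : ∫⁻ x, ENNReal.ofReal (ψ x) * F x ∂μ ≠ ⊤ := by
    have h := ENNReal.lintegral_mul_le_Lp_mul_Lq μ hpq hF.aemeasurable
      hψ.ennreal_ofReal.aemeasurable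
    simp only [Pi.mul_apply] at h
    simp_rw [mul_comm (ENNReal.ofReal _)]
    exact ne_top_of_le_ne_top (ENNReal.mul_ne_top
      (ENNReal.rpow_ne_top_of_nonneg (by have := hpq.pos; positivity) hFp)
      (ENNReal.rpow_ne_top_of_nonneg (by have := hpq.symm.pos; positivity) hψq)) h
  have heq : (fun x => (F x).toReal * ψ x) = fun x => (ENNReal.ofReal (ψ x) * F x).toReal := by
    ext x
    rw [ENNReal.toReal_mul, ENNReal.toReal_ofReal (hψ0 x), mul_comm]
  refine ⟨hfin, ?_, ?_⟩
  · rw [heq]; exact integrable_toReal_of_lintegral_ne_top hm.aemeasurable hfin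
  · rw [heq, integral_toReal hm.aemeasurable (ae_lt_top hm hfin)]

/-- Weak compactness of bounded sets in `L^p`, `1 < p < ∞`. -/
theorem exists_weak_limit [SigmaFinite μ] (hpq : p.HolderConjugate q)
    {g : ℕ → α → ℝ} (hg : ∀ n, Measurable (g n)) {C : ℝ≥0∞} (hC : C ≠ ⊤)
    (hb : ∀ n, ∫⁻ x, ‖g n x‖ₑ ^ p ∂μ ≤ C) :
    ∃ G : α → ℝ, Measurable G ∧ ∫⁻ x, ‖G x‖ₑ ^ p ∂μ ≠ ⊤ ∧
      ∀ ψ : α → ℝ, Measurable ψ → ∫⁻ x, ‖ψ x‖ₑ ^ q ∂μ ≠ ⊤ → ∀ L : ℝ,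
        Tendsto (fun n => ∫ x, g n x * ψ x ∂μ) atTop (𝓝 L) → ∫ x, G x * ψ x ∂μ = L := by
  have hp0 : 0 < p := hpq.pos
  have hq0 : 0 < q := hpq.symm.pos
  have hofReal : ∀ a : ℝ, ENNReal.ofReal a ≤ ‖a‖ₑ := fun a => by
    rw [Real.enorm_eq_ofReal_abs]; exact ENNReal.ofReal_le_ofReal (le_abs_self a)
  have hofReal' : ∀ a : ℝ, ENNReal.ofReal (-a) ≤ ‖a‖ₑ := fun a => by
    rw [Real.enorm_eq_ofReal_abs]; exact ENNReal.ofReal_le_ofReal (neg_le_abs a)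
  -- Since `U` is finer than `atTop`, integrals that converge along the sequence have the same limit
  -- along `U`; one `G` thus serves all `ψ`.
  let U : Ultrafilter ℕ := Ultrafilter.of atTop
  have hU : (U : Filter ℕ) ≤ atTop := Ultrafilter.of_le atTop
  have hb1 : ∀ n, ∫⁻ x, ENNReal.ofReal (g n x) ^ p ∂μ ≤ C := fun n =>
    (lintegral_mono fun x => ENNReal.rpow_le_rpow (hofReal _) hp0.le).trans (hb n)
  have hb2 : ∀ n, ∫⁻ x, ENNReal.ofReal (-g n x) ^ p ∂μ ≤ C := fun n =>
    (lintegral_mono fun x => ENNReal.rpow_le_rpow (hofReal' _) hp0.le).trans (hb n)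
  obtain ⟨G₁, hG₁m, hG₁, hG₁t⟩ := exists_tendsto_lintegral_mul hpq
    (fun n => (hg n).ennreal_ofReal) hC hb1 U
  obtain ⟨G₂, hG₂m, hG₂, hG₂t⟩ := exists_tendsto_lintegral_mul hpq
    (g := fun n x => ENNReal.ofReal (-g n x)) (fun n => (hg n).neg.ennreal_ofReal) hC hb2 U
  have hG₁' := ne_top_of_le_ne_top hC hG₁
  have hG₂' := ne_top_of_le_ne_top hC hG₂
  -- Positive and negative parts of `g n` have separate weak limits, which need not be the positive
  -- and negative parts of `G`.
  let G : α → ℝ := fun x => (G₁ x).toReal - (G₂ x).toReal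
  have hpos : ∀ ψ : α → ℝ, Measurable ψ → (∀ x, 0 ≤ ψ x) →
      ∫⁻ x, ENNReal.ofReal (ψ x) ^ q ∂μ ≠ ⊤ →
      (∀ n, Integrable (fun x => g n x * ψ x) μ) ∧ Integrable (fun x => G x * ψ x) μ ∧
        Tendsto (fun n => ∫ x, g n x * ψ x ∂μ) U (𝓝 (∫ x, G x * ψ x ∂μ)) := by
    intro ψ hψ hψ0 hψq
    have hsplit : ∀ n x, g n x * ψ x = (ENNReal.ofReal (g n x)).toReal * ψ x
        - (ENNReal.ofReal (-g n x)).toReal * ψ x := fun n x => by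
      rw [← sub_mul, ENNReal.toReal_ofReal', ENNReal.toReal_ofReal', max_zero_sub_max_neg_zero_eq_self]
    obtain ⟨f1, i1, e1⟩ := integral_toReal_mul_ofReal hpq hG₁m hG₁' hψ hψ0 hψq
    obtain ⟨f2, i2, e2⟩ := integral_toReal_mul_ofReal hpq hG₂m hG₂' hψ hψ0 hψq
    have hn1 := fun n => integral_toReal_mul_ofReal hpq (hg n).ennreal_ofReal
      (ne_top_of_le_ne_top hC (hb1 n)) hψ hψ0 hψq
    have hn2 := fun n => integral_toReal_mul_ofReal hpq
      (F := fun x => ENNReal.ofReal (-g n x)) (hg n).neg.ennreal_ofReal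
      (ne_top_of_le_ne_top hC (hb2 n)) hψ hψ0 hψq
    refine ⟨fun n => ?_, ?_, ?_⟩
    · simp_rw [hsplit]
      exact (hn1 n).2.1.sub (hn2 n).2.1
    · simp only [G, sub_mul]
      exact i1.sub i2
    · have hGe : ∫ x, G x * ψ x ∂μ = (∫⁻ x, ENNReal.ofReal (ψ x) * G₁ x ∂μ).toReal
          - (∫⁻ x, ENNReal.ofReal (ψ x) * G₂ x ∂μ).toReal := by
        simp only [G, sub_mul]
        rw [integral_sub i1 i2, e1, e2]
      rw [hGe]
      refine (((ENNReal.tendsto_toReal f1).comp (hG₁t _ hψ.ennreal_ofReal hψq)).sub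
        ((ENNReal.tendsto_toReal f2).comp (hG₂t _ hψ.ennreal_ofReal hψq))).congr fun n => ?_
      rw [integral_congr_ae (Eventually.of_forall (hsplit n)),
        integral_sub (hn1 n).2.1 (hn2 n).2.1, (hn1 n).2.2, (hn2 n).2.2]
      rfl
  refine ⟨G, hG₁m.ennreal_toReal.sub hG₂m.ennreal_toReal, ?_, ?_⟩
  · have hle : ∀ x, ‖G x‖ₑ ^ p ≤ 2 ^ (p - 1) * (G₁ x ^ p + G₂ x ^ p) := fun x => by
      refine le_trans (ENNReal.rpow_le_rpow ?_ hp0.le)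
        (ENNReal.rpow_add_le_mul_rpow_add_rpow (G₁ x) (G₂ x) hpq.lt.le)
      refine (enorm_sub_le).trans (add_le_add ?_ ?_)
      · rw [Real.enorm_of_nonneg ENNReal.toReal_nonneg]; exact ENNReal.ofReal_toReal_le
      · rw [Real.enorm_of_nonneg ENNReal.toReal_nonneg]; exact ENNReal.ofReal_toReal_le
    refine ne_top_of_le_ne_top ?_ (lintegral_mono hle)
    rw [lintegral_const_mul _ (by fun_prop), lintegral_add_left (by fun_prop)]
    exact ENNReal.mul_ne_top (ENNReal.rpow_ne_top_of_nonneg (by linarith [hpq.lt]) (by simp))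
      (ENNReal.add_ne_top.2 ⟨hG₁', hG₂'⟩)
  · intro ψ hψ hψq L hL
    have hq1 : ∫⁻ x, ENNReal.ofReal (max (ψ x) 0) ^ q ∂μ ≠ ⊤ := by
      refine ne_top_of_le_ne_top hψq (lintegral_mono fun x => ENNReal.rpow_le_rpow ?_ hq0.le)
      simpa using hofReal (ψ x)
    have hq2 : ∫⁻ x, ENNReal.ofReal (max (-ψ x) 0) ^ q ∂μ ≠ ⊤ := by
      refine ne_top_of_le_ne_top hψq (lintegral_mono fun x => ENNReal.rpow_le_rpow ?_ hq0.le)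
      simpa using hofReal' (ψ x)
    obtain ⟨a1, a2, a3⟩ := hpos _ (hψ.max measurable_const) (fun x => le_max_right _ _) hq1
    obtain ⟨b1, b2, b3⟩ := hpos (fun x => max (-ψ x) 0)
      (hψ.neg.max measurable_const) (fun x => le_max_right _ _) hq2
    have hsplit : ∀ (a : α → ℝ) x, a x * ψ x = a x * max (ψ x) 0 - a x * max (-ψ x) 0 :=
      fun a x => by rw [← mul_sub, max_zero_sub_max_neg_zero_eq_self]
    refine tendsto_nhds_unique ?_ (hL.mono_left hU)
    rw [integral_congr_ae (Eventually.of_forall (hsplit G)), integral_sub a2 b2]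
    refine (a3.sub b3).congr fun n => ?_
    rw [integral_congr_ae (Eventually.of_forall (hsplit (g n))), integral_sub (a1 n) (b1 n)]

end WeakCompactnessReal

/-! ### Finite lower limit of the energies implies a weak gradient in `L^p` -/

section SobolevCharacterization

variable {d : ℕ} {ι : Type*} {l : Filter ι} {p : ℝ} {ν : ι → RSpace d → ℝ≥0∞}

/-- Functions of finite lower nonlocal energy are in `W^{1,p}`, `1 < p < ∞`. -/
theorem IsLevyFamily.exists_hasWeakGradient [l.NeBot] [l.IsCountablyGenerated]
    (hν : IsLevyFamily l p ν) (hp : 1 < p)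
    {e : RSpace d} (he : ‖e‖ = 1) {Ω : Set (RSpace d)} (hΩ : IsOpen Ω)
    {u : RSpace d → ℝ} (hu : Measurable u) (hul : LocallyIntegrable u)
    (hfin : liminf (fun i => nonlocalEnergy Ω p (ν i) u) l ≠ ⊤) :
    ∃ g, HasWeakGradient Ω u g ∧ ∫⁻ x in Ω, ‖g x‖ₑ ^ p ≠ ⊤ := by
  have hp0 : 0 < p := zero_lt_one.trans hp
  set A := liminf (fun i => nonlocalEnergy Ω p (ν i) u) l
  set K := ENNReal.ofReal (sphereMean p e)
  have hK0 : K ≠ 0 := ofReal_sphereMean_ne_zero hp0 he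
  have hgc : ∀ n, Measurable (gradient (mollify n u)) := fun n =>
    (continuous_gradient_of_contDiff (contDiff_mollify hul)).measurable
  -- The components are cut off outside the inner sets, where the mollified gradients are not
  -- controlled; what remains is bounded in `L^p(ℝ^d)` uniformly in `n`.
  let g : Fin d → ℕ → RSpace d → ℝ := fun i n => (innerSet Ω n).indicator fun x =>
    inner ℝ (gradient (mollify n u) x) (EuclideanSpace.single i 1)
  have hgm : ∀ i n, Measurable (g i n) := fun i n => by
    have := hgc n
    exact Measurable.indicator (by fun_prop) (isOpen_innerSet Ω n).measurableSet
  have hgb : ∀ i n, ∫⁻ x, ‖g i n x‖ₑ ^ p ≤ A / K := fun i n => by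
    rw [ENNReal.le_div_iff_mul_le (Or.inl hK0) (Or.inl ENNReal.ofReal_ne_top), mul_comm]
    refine le_trans (mul_le_mul' le_rfl ?_)
      (hν.lintegral_innerSet_le hp.le he hΩ.measurableSet hu hul n)
    rw [← lintegral_indicator (isOpen_innerSet Ω n).measurableSet]
    refine lintegral_mono fun x => ?_
    by_cases hx : x ∈ innerSet Ω n
    · simp only [g, indicator_of_mem hx]
      refine ENNReal.rpow_le_rpow (enorm_le_iff_norm_le.2 ?_) hp0.le
      refine (norm_inner_le_norm _ _).trans ?_
      simp
    · simp [g, indicator_of_notMem hx, hp0]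
  have hC : A / K ≠ ⊤ := ENNReal.div_ne_top hfin hK0
  choose G hGm hGp hGw using fun i => exists_weak_limit
    (Real.HolderConjugate.conjExponent hp) (hgm i) hC (hgb i)
  let g₀ : RSpace d → RSpace d := fun x => WithLp.toLp 2 fun i => G i x
  have hpE : (ENNReal.ofReal p) ≠ 0 := (ENNReal.ofReal_pos.2 hp0).ne'
  have hGL : ∀ i, MemLp (G i) (ENNReal.ofReal p) volume := fun i => by
    refine ⟨(hGm i).aestronglyMeasurable, ?_⟩
    rw [eLpNorm_lt_top_iff_lintegral_rpow_enorm_lt_top hpE ENNReal.ofReal_ne_top,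
      ENNReal.toReal_ofReal hp0.le]
    exact (hGp i).lt_top
  have hg₀L : MemLp g₀ (ENNReal.ofReal p) volume := by
    have h1 : g₀ = ∑ i, fun x => G i x • (EuclideanSpace.single i 1 : RSpace d) := by
      ext x j
      simp [g₀, Finset.sum_apply, Pi.single_apply]
    rw [h1]
    refine memLp_finsetSum' _ fun i _ => ?_
    exact (ContinuousLinearMap.toSpanSingleton ℝ
      (EuclideanSpace.single i 1 : RSpace d)).comp_memLp' (hGL i)
  have hg₀i : ∀ x v, inner ℝ (g₀ x) v = ∑ i, v i * G i x := fun x v => by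
    simp [g₀, PiLp.inner_apply]
  have hg₀loc : LocallyIntegrable g₀ :=
    hg₀L.locallyIntegrable (by rw [← ENNReal.ofReal_one]; exact ENNReal.ofReal_le_ofReal hp.le)
  refine ⟨g₀, ⟨hul.locallyIntegrableOn Ω, hg₀loc.locallyIntegrableOn Ω, fun φ hφ v => ?_⟩, ?_⟩
  -- From some `n` on the support of `φ` lies in the inner set, and integration by parts gives the
  -- limit of the integrals against `φ`, hence the value of the weak limit.
  · have hcomp : ∀ i, ∫ x, G i x * φ x
        = - ∫ x, u x * fderiv ℝ φ x (EuclideanSpace.single i 1) := fun i => by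
      have hcφ : Continuous fun x => fderiv ℝ φ x (EuclideanSpace.single i 1) :=
        (hφ.1.continuous_fderiv (by simp)).clm_apply continuous_const
      refine hGw i φ hφ.1.continuous.measurable ?_ _ ?_
      · have hq := (Real.HolderConjugate.conjExponent hp).symm.pos
        have h1 : MemLp φ (ENNReal.ofReal (p.conjExponent)) volume :=
          hφ.1.continuous.memLp_of_hasCompactSupport hφ.2.1
        have h2 := h1.2
        rw [eLpNorm_lt_top_iff_lintegral_rpow_enorm_lt_top (ENNReal.ofReal_pos.2 hq).ne'
          ENNReal.ofReal_ne_top, ENNReal.toReal_ofReal hq.le] at h2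
        exact h2.ne
      · have hlim := (tendsto_integral_mollify_mul hul hcφ
          (hφ.2.1.fderiv_apply (𝕜 := ℝ) _)).neg
        refine hlim.congr' ?_
        filter_upwards [eventually_subset_innerSet hΩ hφ.2.1 hφ.2.2] with n hn
        rw [integral_mul_fderiv_eq_neg (contDiff_mollify hul) hφ.1 hφ.2.1, neg_neg]
        refine integral_congr_ae (Eventually.of_forall fun x => ?_)
        by_cases hx : x ∈ innerSet Ω n
        · simp only [g, indicator_of_mem hx]
        · have : φ x = 0 := image_eq_zero_of_notMem_tsupport fun h => hx (hn h)
          simp [this]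
    have hfd : ∀ x, fderiv ℝ φ x v = ∑ i, v i * fderiv ℝ φ x (EuclideanSpace.single i 1) :=
      fun x => by
        conv_lhs => rw [← (EuclideanSpace.basisFun (Fin d) ℝ).sum_repr v]
        simp
    rw [setIntegral_eq_integral_of_forall_compl_eq_zero,
      setIntegral_eq_integral_of_forall_compl_eq_zero]
    · simp_rw [hfd, hg₀i, Finset.mul_sum, Finset.sum_mul, mul_left_comm (u _), mul_assoc]
      rw [integral_finsetSum, integral_finsetSum, ← Finset.sum_neg_distrib]
      · refine Finset.sum_congr rfl fun i _ => ?_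
        rw [integral_const_mul, integral_const_mul, hcomp i]; ring
      · intro i _
        have h := integrable_mul_of_compactSupport (Ω := univ) (u := G i) (ψ := φ)
          (((hGL i).locallyIntegrable (by
            rw [← ENNReal.ofReal_one]; exact ENNReal.ofReal_le_ofReal hp.le)).locallyIntegrableOn _)
          hφ.1.continuous hφ.2.1 (subset_univ _)
        rw [Measure.restrict_univ] at h
        exact h.const_mul _
      · intro i _
        have h := IsTestFunction.integrable_mul_fderiv (Ω := univ) (u := u) (φ := φ)
          (hul.locallyIntegrableOn _) ⟨hφ.1, hφ.2.1, subset_univ _⟩ (EuclideanSpace.single i 1)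
        rw [Measure.restrict_univ] at h
        exact h.const_mul _
    · intro x hx
      have : φ x = 0 := image_eq_zero_of_notMem_tsupport fun h => hx (hφ.2.2 h)
      simp [this]
    · intro x hx
      have : fderiv ℝ φ x = 0 := image_eq_zero_of_notMem_tsupport
        fun h => hx (hφ.2.2 (tsupport_fderiv_subset ℝ h))
      simp [this]
  · have h2 := hg₀L.2
    rw [eLpNorm_lt_top_iff_lintegral_rpow_enorm_lt_top hpE ENNReal.ofReal_ne_top,
      ENNReal.toReal_ofReal hp0.le] at h2
    exact ((setLIntegral_le_lintegral _ _).trans_lt h2).ne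

end SobolevCharacterization

/-! ### Upper bound for Sobolev functions -/

section UpperBound

variable {d : ℕ} {p : ℝ}

/-- The fundamental theorem of calculus on the segment from `x` to `x + h`, followed by Jensen on
`[0, 1]`. -/
theorem enorm_sub_rpow_le_lintegral (hp : 1 ≤ p) {w : RSpace d → ℝ} (hw : ContDiff ℝ ∞ w)
    (x h : RSpace d) :
    ‖w (x + h) - w x‖ₑ ^ p ≤
      ∫⁻ t in Icc (0 : ℝ) 1, ‖inner ℝ (gradient w (x + t • h)) h‖ₑ ^ p := by
  have hgc := continuous_gradient_of_contDiff hw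
  have hc : Continuous fun t : ℝ => inner ℝ (gradient w (x + t • h)) h := by fun_prop
  have hderiv : ∀ t ∈ uIcc (0 : ℝ) 1, HasDerivAt (fun t : ℝ => w (x + t • h))
      (inner ℝ (gradient w (x + t • h)) h) t := fun t _ => by
    have h1 : HasFDerivAt w (fderiv ℝ w (x + t • h)) (x + t • h) :=
      (hw.differentiable (by simp) _).hasFDerivAt
    have h2 : HasDerivAt (fun t : ℝ => x + t • h) h t := by
      simpa using ((hasDerivAt_id t).smul_const h).const_add x
    rw [inner_gradient_left]
    exact h1.comp_hasDerivAt t h2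
  have hftc := intervalIntegral.integral_eq_sub_of_hasDerivAt hderiv (hc.intervalIntegrable 0 1)
  rw [one_smul, zero_smul, add_zero, intervalIntegral.integral_of_le zero_le_one,
    ← integral_Icc_eq_integral_Ioc] at hftc
  have : IsProbabilityMeasure (volume.restrict (Icc (0 : ℝ) 1)) := ⟨by simp⟩
  rw [← hftc]
  exact (ENNReal.rpow_le_rpow (enorm_integral_le_lintegral_enorm _) (by linarith)).trans
    (lintegral_rpow_le_of_isProbabilityMeasure _ hp hc.measurable.enorm.aemeasurable)

theorem lintegral_enorm_sub_rpow_le (hp : 1 ≤ p) {w : RSpace d → ℝ} (hw : ContDiff ℝ ∞ w)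
    (A : Set (RSpace d)) (h : RSpace d) :
    ∫⁻ x in A, ‖w (x + h) - w x‖ₑ ^ p ≤
      ∫⁻ t in Icc (0 : ℝ) 1, ∫⁻ x in A, ‖inner ℝ (gradient w (x + t • h)) h‖ₑ ^ p := by
  have hgc := (continuous_gradient_of_contDiff hw).measurable
  refine (lintegral_mono fun x => enorm_sub_rpow_le_lintegral hp hw x h).trans (le_of_eq ?_)
  exact lintegral_lintegral_swap (Measurable.aemeasurable (by fun_prop))

theorem lintegral_enorm_sub_rpow_le_of_forall (hp : 1 ≤ p) {w : RSpace d → ℝ}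
    (hw : ContDiff ℝ ∞ w) {A : Set (RSpace d)} {h : RSpace d} {B : ℝ≥0∞}
    (hB : ∀ t ∈ Icc (0 : ℝ) 1, ∫⁻ x in A, ‖inner ℝ (gradient w (x + t • h)) h‖ₑ ^ p ≤ B) :
    ∫⁻ x in A, ‖w (x + h) - w x‖ₑ ^ p ≤ B := by
  refine (lintegral_enorm_sub_rpow_le hp hw A h).trans
    ((setLIntegral_mono measurable_const hB).trans (le_of_eq ?_))
  simp

/-- Lower semicontinuity of truncated nonlocal energies under a.e. convergence. -/
theorem lintegral_kernel_le_liminf {k : RSpace d → ℝ≥0∞} (hk : AEMeasurable k volume)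
    {v : RSpace d → ℝ} (hv : Measurable v) {w : ℕ → RSpace d → ℝ} (hw : ∀ n, Measurable (w n))
    (hlim : ∀ᵐ x, Tendsto (fun n => w n x) atTop (𝓝 (v x))) (A B : Set (RSpace d)) :
    ∫⁻ h in B, k h * ∫⁻ x in A, ‖v (x + h) - v x‖ₑ ^ p ≤
      liminf (fun n => ∫⁻ h in B, k h * ∫⁻ x in A, ‖w n (x + h) - w n x‖ₑ ^ p) atTop := by
  have h1 : ∀ (z : RSpace d → ℝ), Measurable z → ∀ h, k h * ∫⁻ x in A, ‖z (x + h) - z x‖ₑ ^ p =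
      ∫⁻ x in A, k h * ‖z (x + h) - z x‖ₑ ^ p := fun z hz h =>
    (lintegral_const_mul _ (by fun_prop)).symm
  have hm : ∀ n, AEMeasurable (fun q : RSpace d × RSpace d =>
      k q.1 * ‖w n (q.2 + q.1) - w n q.2‖ₑ ^ p) ((volume.restrict B).prod (volume.restrict A)) :=
    fun n => by
      have := hw n
      exact (hk.restrict.comp_fst).mul (Measurable.aemeasurable (by fun_prop))
  simp_rw [h1 v hv, fun n => h1 (w n) (hw n)]
  refine le_trans (lintegral_mono fun h => ?_)
    (lintegral_liminf_le' fun n => (hm n).lintegral_prod_right')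
  have hshift : ∀ᵐ x : RSpace d, Tendsto (fun n => w n (x + h)) atTop (𝓝 (v (x + h))) :=
    (measurePreserving_add_right volume h).quasiMeasurePreserving.ae hlim
  refine le_trans (lintegral_mono_ae ?_) (lintegral_liminf_le fun n => ?_)
  · filter_upwards [ae_restrict_of_ae hlim, ae_restrict_of_ae hshift] with x hx hx'
    have h2 : Tendsto (fun n => ‖w n (x + h) - w n x‖ₑ ^ p) atTop
        (𝓝 (‖v (x + h) - v x‖ₑ ^ p)) := (hx'.sub hx).enorm.ennrpow_const p
    -- The kernel may take the value `⊤`, and multiplication by `⊤` is continuous only at nonzero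
    -- limits.
    rcases eq_or_ne (‖v (x + h) - v x‖ₑ ^ p) 0 with h0 | h0
    · rw [h0, mul_zero]; exact zero_le
    · rw [(ENNReal.Tendsto.const_mul h2 (Or.inl h0)).liminf_eq]
  · have := hw n
    exact Measurable.const_mul (by fun_prop) _

theorem tendsto_lintegral_translate_sub {f : RSpace d → ℝ} (hf : Integrable f) :
    Tendsto (fun s => ∫⁻ x, ‖f (x + s) - f x‖ₑ) (𝓝 (0 : RSpace d)) (𝓝 0) := by
  have : Fact ((1 : ℝ≥0∞) ≤ 1) := ⟨le_rfl⟩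
  let F : Lp ℝ 1 (volume : Measure (RSpace d)) := hf.toL1 f
  let τ : C(RSpace d, C(RSpace d, RSpace d)) :=
    (ContinuousMap.mk (fun q : RSpace d × RSpace d => q.2 + q.1) (by fun_prop)).curry
  have hτ : ∀ s, MeasurePreserving (τ s) volume volume := fun s =>
    measurePreserving_add_right volume s
  have h1 := Tendsto.compMeasurePreservingLp (tendsto_const_nhds (x := F) (f := 𝓝 (0 : RSpace d)))
    (τ.continuous.tendsto 0) hτ (hτ 0) ENNReal.one_ne_top
  have h2 := tendsto_iff_edist_tendsto_0.1 h1
  refine h2.congr fun s => ?_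
  have hF : (F : RSpace d → ℝ) =ᵐ[volume] f := hf.coeFn_toL1
  rw [Lp.edist_def, eLpNorm_one_eq_lintegral_enorm]
  refine lintegral_congr_ae ?_
  filter_upwards [Lp.coeFn_compMeasurePreserving F (hτ s), Lp.coeFn_compMeasurePreserving F (hτ 0),
    (hτ s).quasiMeasurePreserving.ae hF, (hτ 0).quasiMeasurePreserving.ae hF] with x a1 a2 a3 a4
  simp only [Pi.sub_apply, a1, a2, Function.comp_apply, a3, a4]
  simp [τ]

/-- The boundary may have positive measure, so dominated convergence in `z` is not available. With
`z = x + s` it is: a fixed `x ∈ Ω` stays in the open set under small shifts, and replacing `f (x +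
s)` by `f x` costs only the `L^1` modulus of continuity of `f`. -/
theorem tendsto_lintegral_translate_diff {Ω : Set (RSpace d)} (hΩ : IsOpen Ω) {f : RSpace d → ℝ}
    (hfm : Measurable f) (hf : Integrable f) :
    Tendsto (fun s => ∫⁻ z in Ωᶜ, Ω.indicator (fun _ => ‖f z‖ₑ) (z - s))
      (𝓝 (0 : RSpace d)) (𝓝 0) := by
  have h1 : Tendsto (fun s => ∫⁻ x, Ω.indicator (fun x => Ωᶜ.indicator (fun _ => ‖f x‖ₑ) (x + s)) x)
      (𝓝 (0 : RSpace d)) (𝓝 0) := by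
    have h0 : (0 : ℝ≥0∞) = ∫⁻ _ : RSpace d, 0 := by simp
    rw [h0]
    refine tendsto_lintegral_filter_of_dominated_convergence (fun x => ‖f x‖ₑ)
      (Eventually.of_forall fun s => ?_) (Eventually.of_forall fun s => ?_) hf.2.ne
      (Eventually.of_forall fun x => ?_)
    · refine Measurable.indicator ?_ hΩ.measurableSet
      exact Measurable.indicator (s := (fun x => x + s) ⁻¹' Ωᶜ) hfm.enorm
        (hΩ.measurableSet.compl.preimage (measurable_add_const s))
    · refine Eventually.of_forall fun x => ?_
      exact (indicator_le_self' (fun _ _ => zero_le) x).trans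
        (indicator_le_self' (f := fun _ => ‖f x‖ₑ) (fun _ _ => zero_le) (x + s))
    · refine tendsto_const_nhds.congr' ?_
      by_cases hx : x ∈ Ω
      · have hmem : ∀ᶠ s in 𝓝 (0 : RSpace d), x + s ∈ Ω := by
          have hc : Tendsto (fun s : RSpace d => x + s) (𝓝 0) (𝓝 x) := by
            have := (continuous_const_add x).tendsto (0 : RSpace d)
            rwa [add_zero] at this
          exact hc (hΩ.mem_nhds hx)
        filter_upwards [hmem] with s hs
        rw [indicator_of_mem hx, indicator_of_notMem (not_not.2 hs)]
      · exact Eventually.of_forall fun s => by simp [hx]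
  have h2 := h1.add (tendsto_lintegral_translate_sub hf)
  rw [add_zero] at h2
  refine tendsto_of_tendsto_of_tendsto_of_le_of_le tendsto_const_nhds h2 (fun _ => zero_le)
    fun s => ?_
  simp only
  rw [← lintegral_indicator hΩ.measurableSet.compl, ← lintegral_add_right_eq_self _ s,
    ← lintegral_add_right _ (by fun_prop)]
  refine lintegral_mono fun x => ?_
  by_cases hx : x ∈ Ω
  · by_cases hxs : x + s ∈ Ω
    · simp [hxs]
    · simp only [hx, indicator_of_mem, mem_compl_iff, hxs, not_false_eq_true, add_sub_cancel_right]
      calc ‖f (x + s)‖ₑ = ‖f x + (f (x + s) - f x)‖ₑ := by rw [add_sub_cancel]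
        _ ≤ _ := enorm_add_le _ _
  · by_cases hxs : x + s ∈ Ω
    · simp [hxs]
    · simp [hx, hxs]

/-- The part of `Ω + s` inside `Ω` gives at most the first term; the second is what leaks out of
`Ω`. -/
theorem setLIntegral_translate_le {Ω : Set (RSpace d)} (hΩ : MeasurableSet Ω)
    {f : RSpace d → ℝ≥0∞} (s : RSpace d) :
    ∫⁻ x in Ω, f (x + s) ≤
      (∫⁻ x in Ω, f x) + ∫⁻ z in Ωᶜ, Ω.indicator (fun _ => f z) (z - s) := by
  have h1 : ∫⁻ x in Ω, f (x + s) = ∫⁻ z, Ω.indicator (fun _ => f z) (z - s) := by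
    rw [← lintegral_indicator hΩ,
      ← lintegral_add_right_eq_self (fun z => Ω.indicator (fun _ => f z) (z - s)) s]
    refine lintegral_congr fun x => ?_
    rw [add_sub_cancel_right]
    rfl
  rw [h1, ← lintegral_add_compl _ hΩ]
  gcongr with z
  exact indicator_le_self' (f := fun _ => f z) (fun _ _ => zero_le) (z - s)

/-- By Jensen the mollified gradient is dominated by an average over shifts `a - t` of length at
most `r`. Each shifted integral exceeds the original by the leak out of `Ω`, which Cauchy–Schwarz
bounds by `|h|^p η`. -/
theorem lintegral_inner_mollify_translate_le (hp : 1 ≤ p) {Ω : Set (RSpace d)} (hΩ : IsOpen Ω)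
    {G : RSpace d → RSpace d} (hGm : Measurable G) (hGl : LocallyIntegrable G) {r : ℝ} {η : ℝ≥0∞}
    (hη : ∀ s : RSpace d, ‖s‖ ≤ r → ∫⁻ z in Ωᶜ, Ω.indicator (fun _ => ‖G z‖ₑ ^ p) (z - s) ≤ η)
    {n : ℕ} {h a : RSpace d} (ha : ‖a‖ + 1 / ((n : ℝ) + 1) ≤ r) :
    ∫⁻ x in Ω, ‖inner ℝ (mollify n G (x + a)) h‖ₑ ^ p ≤
      (∫⁻ x in Ω, ‖inner ℝ (G x) h‖ₑ ^ p) + ‖h‖ₑ ^ p * η := by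
  have hp0 : 0 < p := zero_lt_one.trans_le hp
  have hmol : ∀ y, inner ℝ (mollify n G y) h = mollify n (fun z => inner ℝ (G z) h) y := fun y => by
    have h5 := integral_inner (𝕜 := ℝ) (mollify_integrable (n := n) hGl y) h
    rw [real_inner_comm, mollify, ← h5, mollify]
    simp_rw [real_inner_smul_right, smul_eq_mul, real_inner_comm h]
  have hηm : Measurable (mollifier d n) := mollifier_contDiff.continuous.measurable
  have hle : ∀ z, ‖inner ℝ (G z) h‖ₑ ^ p ≤ ‖h‖ₑ ^ p * ‖G z‖ₑ ^ p := fun z => by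
    rw [← ENNReal.mul_rpow_of_nonneg _ _ hp0.le, mul_comm]
    refine ENNReal.rpow_le_rpow ?_ hp0.le
    rw [← enorm_norm (G z), ← enorm_norm h, ← enorm_mul, enorm_le_iff_norm_le,
      Real.norm_of_nonneg (by positivity : 0 ≤ ‖G z‖ * ‖h‖)]
    exact norm_inner_le_norm _ _
  calc ∫⁻ x in Ω, ‖inner ℝ (mollify n G (x + a)) h‖ₑ ^ p
      ≤ ∫⁻ x in Ω, ∫⁻ t, ENNReal.ofReal (mollifier d n t) * ‖inner ℝ (G (x + a - t)) h‖ₑ ^ p := by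
        refine lintegral_mono fun x => ?_
        rw [hmol]
        exact enorm_mollify_rpow_le hp (by fun_prop) (x + a)
    _ = ∫⁻ t, ENNReal.ofReal (mollifier d n t) * ∫⁻ x in Ω, ‖inner ℝ (G (x + a - t)) h‖ₑ ^ p := by
        rw [lintegral_lintegral_swap (Measurable.aemeasurable (by fun_prop))]
        exact lintegral_congr fun t => lintegral_const_mul _ (by fun_prop)
    _ ≤ ∫⁻ t, ENNReal.ofReal (mollifier d n t) *
          ((∫⁻ x in Ω, ‖inner ℝ (G x) h‖ₑ ^ p) + ‖h‖ₑ ^ p * η) := by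
        refine lintegral_mono fun t => ?_
        by_cases ht : 1 / ((n : ℝ) + 1) ≤ ‖t‖
        · simp [mollifier_eq_zero ht]
        refine mul_le_mul_right ?_ _
        simp_rw [add_sub_assoc]
        refine (setLIntegral_translate_le hΩ.measurableSet
          (f := fun z => ‖inner ℝ (G z) h‖ₑ ^ p) (a - t)).trans ?_
        gcongr
        calc ∫⁻ z in Ωᶜ, Ω.indicator (fun _ => ‖inner ℝ (G z) h‖ₑ ^ p) (z - (a - t))
            ≤ ∫⁻ z in Ωᶜ, ‖h‖ₑ ^ p * Ω.indicator (fun _ => ‖G z‖ₑ ^ p) (z - (a - t)) := by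
              refine lintegral_mono fun z => ?_
              by_cases hz : z - (a - t) ∈ Ω
              · rw [indicator_of_mem hz, indicator_of_mem hz]; exact hle z
              · rw [indicator_of_notMem hz]; exact zero_le
          _ = ‖h‖ₑ ^ p * ∫⁻ z in Ωᶜ, Ω.indicator (fun _ => ‖G z‖ₑ ^ p) (z - (a - t)) :=
              lintegral_const_mul' _ _ (ENNReal.rpow_ne_top_of_nonneg hp0.le enorm_ne_top)
          _ ≤ _ := mul_le_mul_right (hη _ (by linarith [norm_sub_le a t, not_le.1 ht])) _
    _ = _ := by rw [lintegral_mul_const _ (by fun_prop), lintegral_mollifier, one_mul]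

/-- Upper bound for the truncated nonlocal energy of a Sobolev function on `ℝ^d`. -/
theorem exists_lintegral_kernel_le_sobolev (hp : 1 ≤ p) {e : RSpace d} (he : ‖e‖ = 1)
    {Ω : Set (RSpace d)} (hΩ : IsOpen Ω) {v : RSpace d → ℝ} (hv : Measurable v)
    (hvl : LocallyIntegrable v) {G : RSpace d → RSpace d} (hGm : Measurable G)
    (hGl : LocallyIntegrable G) (hGp : ∫⁻ x, ‖G x‖ₑ ^ p ≠ ⊤) (hG : HasWeakGradient univ v G)
    {η : ℝ≥0∞} (hη : 0 < η) :
    ∃ δ > 0, δ ≤ 1 ∧ ∀ k : RSpace d → ℝ≥0∞, AEMeasurable k volume →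
      (∀ h h' : RSpace d, ‖h‖ = ‖h'‖ → k h = k h') →
      ∫⁻ h in Metric.closedBall (0 : RSpace d) δ, k h * ‖h‖ₑ ^ p ≤ 1 →
      ∫⁻ h in Metric.closedBall (0 : RSpace d) δ, k h * ∫⁻ x in Ω, ‖v (x + h) - v x‖ₑ ^ p ≤
        ENNReal.ofReal (sphereMean p e) * (∫⁻ x in Ω, ‖G x‖ₑ ^ p) + η := by
  have hp0 : 0 < p := zero_lt_one.trans_le hp
  have hfi : Integrable fun x => ‖G x‖ ^ p := by
    refine ⟨(hGm.norm.pow_const p).aestronglyMeasurable, ?_⟩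
    rw [hasFiniteIntegral_iff_enorm]
    simp_rw [Real.enorm_rpow_of_nonneg (norm_nonneg _) hp0.le, enorm_norm]
    exact hGp.lt_top
  have hlim := tendsto_lintegral_translate_diff hΩ (hGm.norm.pow_const p) hfi
  simp_rw [Real.enorm_rpow_of_nonneg (norm_nonneg _) hp0.le, enorm_norm] at hlim
  obtain ⟨r, hr, hr'⟩ := Metric.eventually_nhds_iff.1 (hlim.eventually (gt_mem_nhds hη))
  have hηr : ∀ s : RSpace d, ‖s‖ ≤ r / 2 →
      ∫⁻ z in Ωᶜ, Ω.indicator (fun _ => ‖G z‖ₑ ^ p) (z - s) ≤ η := fun s hs =>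
    (hr' (y := s) (by rw [dist_zero_right]; linarith)).le
  -- The shift `t • h` uses `r / 4` and the mollifier another `r / 4`, together the `r / 2` of
  -- `hηr`.
  refine ⟨min (r / 4) 1, by positivity, min_le_right _ _, fun k hk hkr hk1 => ?_⟩
  set δ := min (r / 4) 1 with hδ
  refine (lintegral_kernel_le_liminf hk hv
    (fun n => (contDiff_mollify (n := n) hvl).continuous.measurable) (ae_tendsto_mollify hvl)
    Ω (Metric.closedBall 0 δ)).trans ?_
  refine liminf_le_of_frequently_le (Eventually.frequently ?_)
  have hsmall : ∀ᶠ n : ℕ in atTop, 1 / ((n : ℝ) + 1) < r / 4 :=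
    (tendsto_one_div_add_atTop_nhds_zero_nat (𝕜 := ℝ)).eventually (gt_mem_nhds (by positivity))
  filter_upwards [hsmall] with n hn
  calc ∫⁻ h in Metric.closedBall (0 : RSpace d) δ,
        k h * ∫⁻ x in Ω, ‖mollify n v (x + h) - mollify n v x‖ₑ ^ p
      ≤ ∫⁻ h in Metric.closedBall (0 : RSpace d) δ, (k h * (∫⁻ x in Ω, ‖inner ℝ (G x) h‖ₑ ^ p)
          + η * (k h * ‖h‖ₑ ^ p)) := by
        refine setLIntegral_mono_ae' measurableSet_closedBall (Eventually.of_forall fun h hh => ?_)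
        have hh' : ‖h‖ ≤ r / 4 := (mem_closedBall_zero_iff.1 hh).trans (min_le_left _ _)
        calc _ ≤ k h * ((∫⁻ x in Ω, ‖inner ℝ (G x) h‖ₑ ^ p) + ‖h‖ₑ ^ p * η) := by
              refine mul_le_mul_right ?_ _
              refine lintegral_enorm_sub_rpow_le_of_forall hp (contDiff_mollify hvl) fun t ht => ?_
              simp_rw [gradient_mollify_of_hasWeakGradient hG hvl hGl (subset_univ _)]
              refine lintegral_inner_mollify_translate_le hp hΩ hGm hGl hηr ?_
              rw [norm_smul, Real.norm_of_nonneg ht.1]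
              have := mul_le_of_le_one_left (norm_nonneg h) ht.2
              linarith
          _ = _ := by ring
    _ = (∫⁻ h in Metric.closedBall (0 : RSpace d) δ, k h * ∫⁻ x in Ω, ‖inner ℝ (G x) h‖ₑ ^ p)
          + η * ∫⁻ h in Metric.closedBall (0 : RSpace d) δ, k h * ‖h‖ₑ ^ p := by
        have hkδ := hk.restrict (s := Metric.closedBall (0 : RSpace d) δ)
        rw [lintegral_add_right' _ (by fun_prop), lintegral_const_mul'' _ (by fun_prop)]
    _ ≤ _ := by
        rw [lintegral_kernel_lintegral_inner hk hkr hp0 he δ Ω hGm]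
        exact add_le_add (mul_le_of_le_one_right zero_le hk1)
          (mul_le_of_le_one_right zero_le hk1)

/-- Only the behaviour of the energy near the diagonal matters in the limit. -/
theorem IsLevyFamily.limsup_nonlocalEnergy_le {ι : Type*} {l : Filter ι} [l.NeBot]
    {ν : ι → RSpace d → ℝ≥0∞} (hν : IsLevyFamily l p ν) (hp : 1 ≤ p) {Ω : Set (RSpace d)}
    (hΩ : MeasurableSet Ω) {v : RSpace d → ℝ} (hv : Measurable v)
    (hvp : ∫⁻ x in Ω, ‖v x‖ₑ ^ p ≠ ⊤) {δ : ℝ} (hδ : 0 < δ) {B : ℝ≥0∞}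
    (hB : ∀ i, ∫⁻ h in Metric.closedBall (0 : RSpace d) δ,
      ν i h * ∫⁻ x in Ω, ‖v (x + h) - v x‖ₑ ^ p ≤ B) :
    limsup (fun i => nonlocalEnergy Ω p (ν i) v) l ≤ B := by
  have hp0 : 0 < p := zero_lt_one.trans_le hp
  set I := ∫⁻ x in Ω, ‖v x‖ₑ ^ p with hI
  -- From `|a - b|^p ≤ 2^(p-1) (|a|^p + |b|^p)`: a shift by any `h`, however large, costs at most
  -- `D`.
  let D : ℝ≥0∞ := 2 ^ (p - 1) * (I + I)
  have hD : D ≠ ⊤ := ENNReal.mul_ne_top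
    (ENNReal.rpow_ne_top_of_nonneg (by linarith) (by simp)) (ENNReal.add_ne_top.2 ⟨hvp, hvp⟩)
  have hfar : ∀ h, ∫⁻ x in Ω, Ω.indicator (fun z => ‖v z - v x‖ₑ ^ p) (x + h) ≤ D := fun h => by
    have hm : Measurable fun x => Ω.indicator (fun z => ‖v z‖ₑ ^ p) (x + h) :=
      ((hv.enorm.pow_const p).indicator hΩ).comp (measurable_add_const h)
    calc ∫⁻ x in Ω, Ω.indicator (fun z => ‖v z - v x‖ₑ ^ p) (x + h)
        ≤ ∫⁻ x in Ω, 2 ^ (p - 1) * (Ω.indicator (fun z => ‖v z‖ₑ ^ p) (x + h) + ‖v x‖ₑ ^ p) := by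
          refine lintegral_mono fun x => ?_
          by_cases hx : x + h ∈ Ω
          · rw [indicator_of_mem hx, indicator_of_mem hx]
            exact (ENNReal.rpow_le_rpow enorm_sub_le hp0.le).trans
              (ENNReal.rpow_add_le_mul_rpow_add_rpow _ _ hp)
          · rw [indicator_of_notMem hx]; exact zero_le
      _ = 2 ^ (p - 1) * ((∫⁻ x in Ω, Ω.indicator (fun z => ‖v z‖ₑ ^ p) (x + h)) + I) := by
          rw [lintegral_const_mul _ (by fun_prop), lintegral_add_left hm]
      _ ≤ D := by
          refine mul_le_mul' le_rfl (add_le_add ?_ le_rfl)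
          refine (setLIntegral_le_lintegral _ _).trans ?_
          rw [lintegral_add_right_eq_self (fun x => Ω.indicator (fun z => ‖v z‖ₑ ^ p) x) h,
            lintegral_indicator hΩ]
  have hle : ∀ i, nonlocalEnergy Ω p (ν i) v ≤ B + D * ∫⁻ h in {h : RSpace d | δ < ‖h‖}, ν i h :=
    fun i => by
      rw [nonlocalEnergy_eq hΩ (hν.measurable i) (hν.radial i) hv, ← lintegral_add_compl _
        (measurableSet_closedBall (x := (0 : RSpace d)) (ε := δ)), compl_closedBall_zero,
        ← lintegral_const_mul'' _ (hν.measurable i).restrict]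
      refine add_le_add (le_trans ?_ (hB i)) ?_
      · gcongr with h x
        exact indicator_le_self' (fun _ _ => zero_le) _
      · refine lintegral_mono fun h => ?_
        rw [mul_comm D]
        exact mul_le_mul_right (hfar h) _
  have hlim : Tendsto (fun i => B + D * ∫⁻ h in {h : RSpace d | δ < ‖h‖}, ν i h) l (𝓝 B) := by
    have := (tendsto_const_nhds (x := B)).add (ENNReal.Tendsto.const_mul (a := D)
      (hν.tendsto_tail hp0 hδ) (Or.inr hD))
    rwa [mul_zero, add_zero] at this
  rw [← hlim.limsup_eq]
  exact limsup_le_limsup (Eventually.of_forall hle)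

end UpperBound

/-! ### Total variation and gradients of mollifications -/

section BVMollify

variable {d : ℕ}

theorem le_bvSeminorm {Ω : Set (RSpace d)} {φ : RSpace d → RSpace d} (v : RSpace d → ℝ)
    (hφ : IsTestFunction Ω φ) (hφ1 : ∀ x, ‖φ x‖ ≤ 1) :
    ENNReal.ofReal (∫ x, v x * divergence φ x) ≤ bvSeminorm Ω v := by
  have h := le_iSup₂ (f := fun (φ : RSpace d → RSpace d)
    (_ : IsTestFunction Ω φ ∧ ∀ x, ‖φ x‖ ≤ 1) =>
      ENNReal.ofReal (∫ x in Ω, v x * divergence φ x)) φ ⟨hφ, hφ1⟩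
  rwa [setIntegral_eq_integral_of_forall_compl_eq_zero fun x hx => by
    have : divergence φ x = 0 := by
      by_contra h; exact hx (hφ.2.2 (support_divergence_subset φ h))
    rw [this, mul_zero]] at h

theorem bvSeminorm_le_of_forall {Ω : Set (RSpace d)} {v : RSpace d → ℝ} {B : ℝ≥0∞}
    (hB : ∀ φ : RSpace d → RSpace d, IsTestFunction Ω φ → (∀ x, ‖φ x‖ ≤ 1) →
      ENNReal.ofReal (∫ x, v x * divergence φ x) ≤ B) : bvSeminorm Ω v ≤ B := by
  refine iSup₂_le fun φ hφ => ?_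
  rw [setIntegral_eq_integral_of_forall_compl_eq_zero fun x hx => by
    have : divergence φ x = 0 := by
      by_contra h; exact hx (hφ.1.2.2 (support_divergence_subset φ h))
    rw [this, mul_zero]]
  exact hB φ hφ.1 hφ.2

theorem fderiv_mollifier_neg {n : ℕ} (z v : RSpace d) :
    fderiv ℝ (mollifier d n) (-z) v = - fderiv ℝ (mollifier d n) z v := by
  have h1 : HasFDerivAt (mollifier d n) (fderiv ℝ (mollifier d n) (-z)) (-z) :=
    (mollifier_contDiff.differentiable (by simp) _).hasFDerivAt
  have h2 : HasFDerivAt (fun y : RSpace d => -y) (-ContinuousLinearMap.id ℝ (RSpace d)) z :=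
    (hasFDerivAt_id z).neg
  have h3 := (h1.comp z h2).fderiv
  rw [show mollifier d n ∘ (fun y => -y) = mollifier d n from funext mollifier_neg] at h3
  rw [h3]
  simp

theorem mollify_apply {n : ℕ} {a : RSpace d → RSpace d} (ha : LocallyIntegrable a) (y : RSpace d)
    (i : Fin d) : mollify n a y i = mollify n (fun x => a x i) y := by
  have h := (EuclideanSpace.proj (𝕜 := ℝ) i : RSpace d →L[ℝ] ℝ).integral_comp_comm
    (mollify_integrable (n := n) ha y)
  simpa [mollify] using h.symm

/-- The total variation on a neighbourhood controls the gradient of the mollification. -/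
theorem lintegral_gradient_mollify_le_bvSeminorm {v : RSpace d → ℝ} (hv : LocallyIntegrable v)
    {C W : Set (RSpace d)} (hC : IsCompact C) {n : ℕ}
    (hCW : Metric.cthickening (1 / ((n : ℝ) + 1)) C ⊆ W) :
    ∫⁻ x in C, ‖gradient (mollify n v) x‖ₑ ≤ bvSeminorm W v := by
  set g := gradient (mollify n v) with hg
  have hgc : Continuous g := continuous_gradient_of_contDiff (contDiff_mollify hv)
  -- The field that is optimal for `∫_C |g|`; where `g` vanishes, `0⁻¹ = 0` makes it zero. Its
  -- mollification is smooth, still bounded by `1`, and supported in `W`.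
  let a : RSpace d → RSpace d := C.indicator fun x => -(‖g x‖⁻¹ • g x)
  have ham : Measurable a := Measurable.indicator (by have := hgc.measurable; fun_prop)
    hC.measurableSet
  have ha1 : ∀ x, ‖a x‖ ≤ 1 := fun x => by
    by_cases hx : x ∈ C
    · simp only [a, indicator_of_mem hx, norm_neg, norm_smul, norm_inv, norm_norm]
      exact inv_mul_le_one
    · simp [a, indicator_of_notMem hx]
  have ha0 : ∀ x ∉ C, a x = 0 := fun x hx => indicator_of_notMem hx _
  have hai : Integrable a := by
    refine Integrable.mono' (g := C.indicator fun _ => (1 : ℝ))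
      ((integrable_indicator_iff hC.measurableSet).2 (integrableOn_const hC.measure_lt_top.ne))
      ham.aestronglyMeasurable (Eventually.of_forall fun x => ?_)
    by_cases hx : x ∈ C
    · rw [indicator_of_mem hx]; exact ha1 x
    · rw [ha0 x hx, indicator_of_notMem hx, norm_zero]
  have hail : LocallyIntegrable a := hai.locallyIntegrable
  let φ := mollify n a
  have hts : tsupport φ ⊆ Metric.cthickening (1 / ((n : ℝ) + 1)) C := by
    refine closure_minimal (fun y hy => ?_) Metric.isClosed_cthickening
    by_contra h
    exact hy (mollify_eq_zero ha0 h)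
  have hφ : IsTestFunction W φ := ⟨contDiff_mollify hail,
    hC.cthickening.of_isClosed_subset (isClosed_tsupport _) hts, hts.trans hCW⟩
  refine le_trans ?_ (le_bvSeminorm v hφ (norm_mollify_le ha1))
  have hac : ∀ i, Integrable fun x => a x i := fun i =>
    (EuclideanSpace.proj (𝕜 := ℝ) i : RSpace d →L[ℝ] ℝ).integrable_comp hai
  have hdc : ∀ i : Fin d, Continuous fun z => fderiv ℝ (mollifier d n) z (EuclideanSpace.single i 1) :=
    fun i => (mollifier_contDiff.continuous_fderiv (by simp)).clm_apply continuous_const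
  have hdiv : ∀ y, divergence φ y = ∑ i, ∫ x,
      fderiv ℝ (mollifier d n) (-(x - y)) (EuclideanSpace.single i 1) * a x i := fun y => by
    rw [divergence_eq_sum hφ.1]
    refine Finset.sum_congr rfl fun i _ => ?_
    have h1 : (fun y => φ y i) = mollify n fun x => a x i := funext fun y => mollify_apply hail y i
    rw [h1, fderiv_mollify (hac i).locallyIntegrable]
    simp_rw [neg_sub, smul_eq_mul]
  -- Fubini moves the mollifier from `a` back onto `v`. Its derivatives are odd, and the resulting
  -- sign is compensated by the sign in `a`.
  have hswap : ∀ i : Fin d, ∫ y, v y * ∫ x,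
      fderiv ℝ (mollifier d n) (-(x - y)) (EuclideanSpace.single i 1) * a x i
      = - ∫ x, a x i * g x i := fun i => by
    rw [← integral_mul_integral_kernel_swap
      (k := fun z => fderiv ℝ (mollifier d n) (-z) (EuclideanSpace.single i 1))
      (a := fun x => a x i) ((hdc i).comp continuous_neg) ?_ hC (hac i)
      (fun x hx => by rw [ha0 x hx]; rfl) hv, ← integral_neg]
    · refine integral_congr_ae (Eventually.of_forall fun x => ?_)
      simp_rw [fderiv_mollifier_neg, neg_mul, integral_neg, mul_neg]
      have h2 := fderiv_mollify (n := n) hv x (EuclideanSpace.single i 1)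
      rw [← inner_gradient_left, EuclideanSpace.inner_single_right] at h2
      simp only [smul_eq_mul] at h2
      rw [← h2]
      simp [hg]
    · exact (mollifier_hasCompactSupport.fderiv_apply (𝕜 := ℝ) _).comp_homeomorph
        (Homeomorph.neg (RSpace d))
  have hinteg : ∀ i, Integrable fun x => a x i * g x i := fun i => by
    obtain ⟨M, hM⟩ := hC.exists_bound_of_continuousOn hgc.continuousOn
    refine Integrable.mono' ((hac i).norm.mul_const M) ?_ (Eventually.of_forall fun x => ?_)
    · have := hgc.measurable
      exact (Measurable.aestronglyMeasurable (by fun_prop))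
    · rw [norm_mul]
      by_cases hx : x ∈ C
      · exact mul_le_mul_of_nonneg_left ((PiLp.norm_apply_le (g x) i).trans (hM x hx))
          (norm_nonneg _)
      · simp [ha0 x hx]
  have hmain : ∫ y, v y * divergence φ y = ∫ x in C, ‖g x‖ := by
    simp_rw [hdiv, Finset.mul_sum]
    rw [integral_finsetSum]
    · simp_rw [hswap]
      rw [Finset.sum_neg_distrib, ← integral_finsetSum _ fun i _ => hinteg i, ← integral_neg,
        ← integral_indicator hC.measurableSet]
      refine integral_congr_ae (Eventually.of_forall fun x => ?_)
      have h3 : ∑ i, a x i * g x i = inner ℝ (a x) (g x) := by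
        simp [PiLp.inner_apply, mul_comm]
      simp only [h3]
      by_cases hx : x ∈ C
      · simp only [a, indicator_of_mem hx, inner_neg_left, real_inner_smul_left,
          real_inner_self_eq_norm_sq, neg_neg]
        rcases eq_or_ne (g x) 0 with h0 | h0
        · simp [h0]
        · have := norm_ne_zero_iff.2 h0
          field_simp
      · simp [ha0 x hx, indicator_of_notMem hx]
    · intro i _
      have h1 : (fun y => ∫ x,
          fderiv ℝ (mollifier d n) (-(x - y)) (EuclideanSpace.single i 1) * a x i) =
          fun y => fderiv ℝ (fun z => φ z i) y (EuclideanSpace.single i 1) := by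
        ext y
        have h1 : (fun y => φ y i) = mollify n fun x => a x i :=
          funext fun y => mollify_apply hail y i
        rw [h1, fderiv_mollify (hac i).locallyIntegrable]
        simp_rw [neg_sub, smul_eq_mul]
      have h2 := (hφ.component i).integrable_mul_fderiv (hv.locallyIntegrableOn W)
        (EuclideanSpace.single i 1)
      have h3 : Integrable fun y => v y * fderiv ℝ (fun z => φ z i) y (EuclideanSpace.single i 1) := by
        refine (integrableOn_iff_integrable_of_support_subset (s := W) fun y hy => ?_).1 h2
        refine (hφ.component i).2.2 (tsupport_fderiv_subset ℝ (subset_tsupport _ fun h0 => hy ?_))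
        simp [h0]
      refine h3.congr (Eventually.of_forall fun y => ?_)
      exact congrArg (v y * ·) (congrFun h1 y).symm
  rw [hmain, ofReal_integral_eq_lintegral_ofReal
    (hgc.norm.continuousOn.integrableOn_compact hC) (Eventually.of_forall fun x => norm_nonneg _)]
  simp_rw [ofReal_norm]
  exact le_rfl

end BVMollify

/-! ### Upper bound for functions of bounded variation -/

section BVUpper

variable {d : ℕ}

theorem IsTestFunction.mono {F : Type*} [NormedAddCommGroup F] [NormedSpace ℝ F]
    {A B : Set (RSpace d)} {φ : RSpace d → F} (hφ : IsTestFunction A φ) (h : A ⊆ B) :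
    IsTestFunction B φ := ⟨hφ.1, hφ.2.1, hφ.2.2.trans h⟩

theorem bvSeminorm_mono {A B : Set (RSpace d)} (h : A ⊆ B) (v : RSpace d → ℝ) :
    bvSeminorm A v ≤ bvSeminorm B v :=
  bvSeminorm_le_of_forall fun _ hφ hφ1 => le_bvSeminorm v (hφ.mono h) hφ1

theorem integral_mul_divergence_add {v : RSpace d → ℝ} (hv : LocallyIntegrable v)
    {A B : Set (RSpace d)} {φ ψ : RSpace d → RSpace d} (hφ : IsTestFunction A φ)
    (hψ : IsTestFunction B ψ) :
    ∫ x, v x * divergence (φ + ψ) x =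
      (∫ x, v x * divergence φ x) + ∫ x, v x * divergence ψ x := by
  have h1 := (hφ.mono (subset_univ _)).integrable_mul_divergence (hv.locallyIntegrableOn univ)
  have h2 := (hψ.mono (subset_univ _)).integrable_mul_divergence (hv.locallyIntegrableOn univ)
  rw [Measure.restrict_univ] at h1 h2
  rw [← integral_add h1 h2]
  refine integral_congr_ae (Eventually.of_forall fun x => ?_)
  have h3 : divergence (φ + ψ) x = divergence φ x + divergence ψ x := by
    simp only [divergence]
    rw [fderiv_add (hφ.1.differentiable (by simp) x) (hψ.1.differentiable (by simp) x),
      ← Finset.sum_add_distrib]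
    rfl
  simp only [h3, mul_add]

theorem exists_contDiff_one_nhds_of_subset_interior {E : Type*} [NormedAddCommGroup E]
    [NormedSpace ℝ E] [FiniteDimensional ℝ E] {s t : Set E} (hs : IsClosed s)
    (hd : s ⊆ interior t) : ∃ f : E → ℝ, ContDiff ℝ ∞ f ∧ (∀ᶠ x in 𝓝ˢ s, f x = 1) ∧
      (∀ x ∉ t, f x = 0) ∧ ∀ x, f x ∈ Icc 0 1 := by
  obtain ⟨f, hf⟩ := exists_contMDiffMap_one_nhds_of_subset_interior
    (n := (⊤ : ℕ∞)) (modelWithCornersSelf ℝ E) hs hd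
  exact ⟨f, f.contMDiff.contDiff, hf⟩

/-- A test field on the union is split by a smooth cutoff with values in `[0, 1]`, equal to `1` near
`tsupport φ \ B` and vanishing off a compact subset of `A`. Together with the tail estimate below,
this replaces the theory of the variation as a measure. -/
theorem bvSeminorm_union_le {v : RSpace d → ℝ} (hv : LocallyIntegrable v) {A B : Set (RSpace d)}
    (hA : IsOpen A) (hB : IsOpen B) :
    bvSeminorm (A ∪ B) v ≤ bvSeminorm A v + bvSeminorm B v := by
  refine bvSeminorm_le_of_forall fun φ hφ hφ1 => ?_
  have hC : IsCompact (tsupport φ \ B) := hφ.2.1.isCompact.diff hB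
  have hCA : tsupport φ \ B ⊆ A := fun x hx => (hφ.2.2 hx.1).resolve_right hx.2
  obtain ⟨r, hr, hrA⟩ := hC.exists_cthickening_subset_open hA hCA
  obtain ⟨χ, hχc, hχ1, hχ0, hχ⟩ := exists_contDiff_one_nhds_of_subset_interior hC.isClosed
    (t := Metric.cthickening r (tsupport φ \ B))
    ((Metric.self_subset_thickening hr _).trans
      (interior_maximal (Metric.thickening_subset_cthickening r _) Metric.isOpen_thickening))
  have h1 : IsTestFunction A fun x => χ x • φ x := by
    refine ⟨hχc.smul hφ.1, hφ.2.1.mono fun x hx => right_ne_zero_of_smul hx, ?_⟩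
    refine (closure_minimal (fun x hx => ?_) Metric.isClosed_cthickening).trans hrA
    by_contra h
    exact hx (by simp [hχ0 x h])
  have h2 : IsTestFunction B fun x => (1 - χ x) • φ x := by
    refine ⟨(contDiff_const.sub hχc).smul hφ.1, hφ.2.1.mono fun x hx => right_ne_zero_of_smul hx, fun x hx => ?_⟩
    by_contra hxB
    have hxφ : x ∈ tsupport φ := tsupport_smul_subset_right (fun x => 1 - χ x) φ hx
    have hxC : x ∈ tsupport φ \ B := ⟨hxφ, hxB⟩
    have h3 := hχ1.filter_mono (nhds_le_nhdsSet hxC)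
    refine (notMem_tsupport_iff_eventuallyEq.2 ?_) hx
    filter_upwards [h3] with y hy
    simp [hy]
  have hsum : φ = (fun x => χ x • φ x) + fun x => (1 - χ x) • φ x := by
    ext1 x
    simp [sub_smul]
  rw [hsum, integral_mul_divergence_add hv h1 h2]
  refine ENNReal.ofReal_add_le.trans (add_le_add (le_bvSeminorm v h1 fun x => ?_)
    (le_bvSeminorm v h2 fun x => ?_))
  · rw [norm_smul, Real.norm_of_nonneg (hχ x).1]
    exact mul_le_one₀ (hχ x).2 (norm_nonneg _) (hφ1 x)
  · rw [norm_smul, Real.norm_of_nonneg (sub_nonneg.2 (hχ x).2)]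
    exact mul_le_one₀ (by linarith [(hχ x).1]) (norm_nonneg _) (hφ1 x)

/-- A nearly optimal field has compact support. A field supported farther out can be added to it
without violating the bound `1`, so it cannot gain more than `η`. -/
theorem exists_bvSeminorm_compl_ball_le {v : RSpace d → ℝ} (hv : LocallyIntegrable v)
    (hfin : bvSeminorm univ v ≠ ⊤) {η : ℝ≥0∞} (hη : 0 < η) :
    ∃ R : ℝ, bvSeminorm {x : RSpace d | R < ‖x‖} v ≤ η := by
  rcases le_or_gt (bvSeminorm univ v) η with h | h
  · exact ⟨0, (bvSeminorm_mono (subset_univ _) v).trans h⟩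
  have hlt : bvSeminorm univ v - η < bvSeminorm univ v :=
    ENNReal.sub_lt_self hfin (hη.trans h).ne' hη.ne'
  obtain ⟨φ, hφ, hφ1, hφ2⟩ : ∃ φ : RSpace d → RSpace d, IsTestFunction univ φ ∧ (∀ x, ‖φ x‖ ≤ 1) ∧
      bvSeminorm univ v - η < ENNReal.ofReal (∫ x, v x * divergence φ x) := by
    by_contra! hcon
    exact hlt.not_ge (bvSeminorm_le_of_forall hcon)
  obtain ⟨R, hR⟩ := hφ.2.1.isCompact.isBounded.subset_closedBall (0 : RSpace d)
  refine ⟨R, bvSeminorm_le_of_forall fun ψ hψ hψ1 => ?_⟩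
  have hsum : IsTestFunction univ (φ + ψ) :=
    ⟨hφ.1.add hψ.1, hφ.2.1.add hψ.2.1, subset_univ _⟩
  have hsum1 : ∀ x, ‖(φ + ψ) x‖ ≤ 1 := fun x => by
    rcases le_or_gt ‖x‖ R with hx | hx
    · have : ψ x = 0 := image_eq_zero_of_notMem_tsupport fun h' => (hψ.2.2 h').not_ge hx
      simpa [this] using hφ1 x
    · have : φ x = 0 := image_eq_zero_of_notMem_tsupport fun h' =>
        hx.not_ge (mem_closedBall_zero_iff.1 (hR h'))
      simpa [this] using hψ1 x
  have hle := le_bvSeminorm v hsum hsum1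
  rw [integral_mul_divergence_add hv hφ hψ] at hle
  have ha : 0 < ∫ x, v x * divergence φ x := ENNReal.ofReal_pos.1 (zero_le.trans_lt hφ2)
  rcases le_total (∫ x, v x * divergence ψ x) 0 with hb | hb
  · rw [ENNReal.ofReal_of_nonpos hb]; exact zero_le
  rw [ENNReal.ofReal_add ha.le hb] at hle
  have h3 := hle.trans (tsub_le_iff_left.1 hφ2.le)
  rw [add_comm] at h3
  exact (ENNReal.add_le_add_iff_right ENNReal.ofReal_ne_top).1 h3

/-- If the gradient measure does not charge the boundary, the total variation on a small uniform
neighbourhood exceeds the one on the set by little. -/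
theorem exists_thickening_bvSeminorm_le {Ω : Set (RSpace d)} (hΩ : IsOpen Ω) {v : RSpace d → ℝ}
    (hv : LocallyIntegrable v) (hfin : bvSeminorm univ v ≠ ⊤)
    (hfr : variationMeasure v (frontier Ω) = 0) {η : ℝ≥0∞} (hη : 0 < η) :
    ∃ ρ > 0, bvSeminorm (Metric.thickening ρ Ω) v ≤ bvSeminorm Ω v + η := by
  have hη2 : 0 < η / 2 := ENNReal.half_pos hη.ne'
  obtain ⟨R, hR⟩ := exists_bvSeminorm_compl_ball_le hv hfin hη2
  obtain ⟨U, hU, hUη⟩ : ∃ U, (IsOpen U ∧ frontier Ω ⊆ U) ∧ bvSeminorm U v < η / 2 := by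
    rw [← hfr] at hη2
    simpa only [variationMeasure, iInf_lt_iff, exists_prop] using hη2
  -- Compactness gives a uniform neighbourhood inside `Ω ∪ U`. The radius is `R + 1` because a point
  -- of norm at most `R` in the thickening is within `1` of a point of `Ω`.
  let C : Set (RSpace d) := closure Ω ∩ Metric.closedBall 0 (R + 1)
  have hC : IsCompact C := (isCompact_closedBall _ _).inter_left isClosed_closure
  have hCU : C ⊆ Ω ∪ U := fun x hx => by
    by_cases h : x ∈ Ω
    · exact Or.inl h
    · exact Or.inr (hU.2 ⟨hx.1, fun h' => h (interior_subset h')⟩)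
  obtain ⟨r, hr, hrC⟩ := hC.exists_thickening_subset_open (hΩ.union hU.1) hCU
  have hO : IsOpen {x : RSpace d | R < ‖x‖} := isOpen_lt continuous_const continuous_norm
  refine ⟨min r 1, by positivity, ?_⟩
  calc bvSeminorm (Metric.thickening (min r 1) Ω) v
      ≤ bvSeminorm ((Ω ∪ U) ∪ {x : RSpace d | R < ‖x‖}) v := by
        refine bvSeminorm_mono (fun x hx => ?_) v
        obtain ⟨z, hz, hxz⟩ := Metric.mem_thickening_iff.1 hx
        rcases le_or_gt ‖x‖ R with hxR | hxR
        · refine Or.inl (hrC (Metric.mem_thickening_iff.2 ⟨z, ⟨subset_closure hz, ?_⟩,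
            hxz.trans_le (min_le_left _ _)⟩))
          rw [mem_closedBall_zero_iff]
          have h1 : ‖z‖ ≤ ‖x‖ + ‖x - z‖ := norm_le_norm_add_norm_sub x z
          rw [← dist_eq_norm] at h1
          linarith [min_le_right r 1]
        · exact Or.inr hxR
    _ ≤ bvSeminorm Ω v + bvSeminorm U v + bvSeminorm {x : RSpace d | R < ‖x‖} v :=
        (bvSeminorm_union_le hv (hΩ.union hU.1) hO).trans
          (add_le_add (bvSeminorm_union_le hv hΩ hU.1) le_rfl)
    _ ≤ bvSeminorm Ω v + η / 2 + η / 2 := add_le_add (add_le_add le_rfl hUη.le) hR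
    _ = _ := by rw [add_assoc, ENNReal.add_halves]

/-- Exhaustion of `A` by compact sets; `Ω` may be unbounded. -/
theorem lintegral_gradient_mollify_le_of_cthickening {v : RSpace d → ℝ} (hv : LocallyIntegrable v)
    {A W : Set (RSpace d)} (hA : IsClosed A) {n : ℕ}
    (hAW : Metric.cthickening (1 / ((n : ℝ) + 1)) A ⊆ W) :
    ∫⁻ x in A, ‖gradient (mollify n v) x‖ₑ ≤ bvSeminorm W v := by
  have hU : A = ⋃ k : ℕ, A ∩ Metric.closedBall 0 k := by
    rw [← inter_iUnion, Metric.iUnion_closedBall_nat, inter_univ]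
  rw [hU, setLIntegral_iUnion_of_directed]
  · refine iSup_le fun k => lintegral_gradient_mollify_le_bvSeminorm hv
      ((isCompact_closedBall _ _).inter_left hA)
      ((Metric.cthickening_subset_of_subset _ inter_subset_left).trans hAW)
  · exact Monotone.directed_le fun i j hij => inter_subset_inter_right _
      (Metric.closedBall_subset_closedBall (by exact_mod_cast hij))

/-- Upper bound for the truncated nonlocal energy of a function of bounded variation. -/
theorem exists_lintegral_kernel_le_bv {e : RSpace d} (he : ‖e‖ = 1)
    {Ω : Set (RSpace d)} (hΩ : IsOpen Ω) {v : RSpace d → ℝ} (hv : Measurable v)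
    (hvl : LocallyIntegrable v) (hfin : bvSeminorm univ v ≠ ⊤)
    (hfr : variationMeasure v (frontier Ω) = 0) {η : ℝ≥0∞} (hη : 0 < η) :
    ∃ δ > 0, δ ≤ 1 ∧ ∀ k : RSpace d → ℝ≥0∞, AEMeasurable k volume →
      (∀ h h' : RSpace d, ‖h‖ = ‖h'‖ → k h = k h') →
      ∫⁻ h in Metric.closedBall (0 : RSpace d) δ, k h * ‖h‖ₑ ^ (1 : ℝ) ≤ 1 →
      ∫⁻ h in Metric.closedBall (0 : RSpace d) δ,
          k h * ∫⁻ x in Ω, ‖v (x + h) - v x‖ₑ ^ (1 : ℝ) ≤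
        ENNReal.ofReal (sphereMean 1 e) * (bvSeminorm Ω v + η) := by
  obtain ⟨ρ, hρ, hρv⟩ := exists_thickening_bvSeminorm_le hΩ hvl hfin hfr hη
  refine ⟨min (ρ / 4) 1, by positivity, min_le_right _ _, fun k hk hkr hk1 => ?_⟩
  set δ := min (ρ / 4) 1 with hδ
  refine (lintegral_kernel_le_liminf hk hv
    (fun n => (contDiff_mollify (n := n) hvl).continuous.measurable) (ae_tendsto_mollify hvl)
    Ω (Metric.closedBall 0 δ)).trans ?_
  refine liminf_le_of_frequently_le (Eventually.frequently ?_)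
  have hsmall : ∀ᶠ n : ℕ in atTop, 1 / ((n : ℝ) + 1) < ρ / 4 :=
    (tendsto_one_div_add_atTop_nhds_zero_nat (𝕜 := ℝ)).eventually (gt_mem_nhds (by positivity))
  filter_upwards [hsmall] with n hn
  -- `A` contains all segments of length at most `ρ / 4` starting in `Ω`; the mollifier reaches less
  -- than `ρ / 4` further, still inside `thickening ρ Ω`.
  let A := Metric.cthickening (ρ / 4) Ω
  have hA : IsClosed A := Metric.isClosed_cthickening
  have hgm := (continuous_gradient_of_contDiff (contDiff_mollify (n := n) hvl)).measurable
  have hAW : Metric.cthickening (1 / ((n : ℝ) + 1)) A ⊆ Metric.thickening ρ Ω :=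
    (Metric.cthickening_cthickening_subset (by positivity) (by positivity) Ω).trans
      (Metric.cthickening_subset_thickening' hρ (by linarith) Ω)
  calc ∫⁻ h in Metric.closedBall (0 : RSpace d) δ,
        k h * ∫⁻ x in Ω, ‖mollify n v (x + h) - mollify n v x‖ₑ ^ (1 : ℝ)
      ≤ ∫⁻ h in Metric.closedBall (0 : RSpace d) δ,
          k h * ∫⁻ x in A, ‖inner ℝ (gradient (mollify n v) x) h‖ₑ ^ (1 : ℝ) := by
        refine setLIntegral_mono_ae' measurableSet_closedBall (Eventually.of_forall fun h hh => ?_)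
        have hh' : ‖h‖ ≤ ρ / 4 := (mem_closedBall_zero_iff.1 hh).trans (min_le_left _ _)
        refine mul_le_mul_right ?_ _
        refine lintegral_enorm_sub_rpow_le_of_forall le_rfl (contDiff_mollify hvl) fun t ht => ?_
        rw [← lintegral_indicator hA.measurableSet, ← lintegral_indicator hΩ.measurableSet,
          ← lintegral_add_right_eq_self (A.indicator _) (t • h)]
        refine lintegral_mono fun x => ?_
        by_cases hx : x ∈ Ω
        · have hxA : x + t • h ∈ A := by
            refine Metric.mem_cthickening_of_dist_le _ x _ _ hx ?_
            rw [dist_eq_norm, add_sub_cancel_left, norm_smul, Real.norm_of_nonneg ht.1]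
            exact (mul_le_of_le_one_left (norm_nonneg h) ht.2).trans hh'
          rw [indicator_of_mem hx, indicator_of_mem hxA]
        · rw [indicator_of_notMem hx]; exact zero_le
    _ ≤ ENNReal.ofReal (sphereMean 1 e) *
          ∫⁻ x in A, ‖gradient (mollify n v) x‖ₑ ^ (1 : ℝ) := by
        rw [lintegral_kernel_lintegral_inner hk hkr one_pos he δ A hgm]
        exact mul_le_of_le_one_right zero_le hk1
    _ ≤ _ := by
        simp_rw [ENNReal.rpow_one]
        exact mul_le_mul_right
          ((lintegral_gradient_mollify_le_of_cthickening hvl hA hAW).trans hρv) _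

end BVUpper

/-! ### Representatives and uniqueness of the weak gradient -/

section Congruence

variable {d : ℕ} {p : ℝ} {Ω : Set (RSpace d)}

theorem nonlocalEnergy_congr {u w : RSpace d → ℝ} (h : u =ᵐ[volume.restrict Ω] w)
    (k : RSpace d → ℝ≥0∞) : nonlocalEnergy Ω p k u = nonlocalEnergy Ω p k w := by
  refine lintegral_congr_ae ?_
  filter_upwards [h] with x hx
  refine lintegral_congr_ae ?_
  filter_upwards [h] with y hy
  rw [hx, hy]

theorem gradEnergy_congr {u w : RSpace d → ℝ} (h : u =ᵐ[volume.restrict Ω] w) :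
    gradEnergy Ω p u = gradEnergy Ω p w :=
  iInf_congr fun _ => iInf_congr_Prop ⟨fun hg => hg.congr h, fun hg => hg.congr h.symm⟩
    fun _ => rfl

theorem HasWeakGradient.congr_right {u : RSpace d → ℝ} {g k : RSpace d → RSpace d}
    (h : HasWeakGradient Ω u g) (hgk : g =ᵐ[volume.restrict Ω] k) : HasWeakGradient Ω u k := by
  refine ⟨h.1, fun x hx => ?_, fun φ hφ v => ?_⟩
  · obtain ⟨s, hs, hi⟩ := h.2.1 x hx
    refine ⟨s ∩ Ω, inter_mem hs self_mem_nhdsWithin, ?_⟩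
    exact (hi.mono_set inter_subset_left).congr
      (ae_restrict_of_ae_restrict_of_subset inter_subset_right hgk)
  · rw [h.2.2 φ hφ v]
    congr 1
    exact integral_congr_ae (hgk.mono fun x hx => by simp only [hx])

theorem HasWeakGradient.restrict {u : RSpace d → ℝ} {g : RSpace d → RSpace d}
    (h : HasWeakGradient univ u g) (Ω : Set (RSpace d)) : HasWeakGradient Ω u g := by
  refine ⟨h.1.mono_set (subset_univ _), h.2.1.mono_set (subset_univ _), fun φ hφ v => ?_⟩
  have h1 := h.2.2 φ (hφ.mono (subset_univ _)) v
  rw [Measure.restrict_univ] at h1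
  have hφ0 : ∀ x ∉ Ω, φ x = 0 := fun x hx =>
    image_eq_zero_of_notMem_tsupport fun h' => hx (hφ.2.2 h')
  have hφ0' : ∀ x ∉ Ω, fderiv ℝ φ x = 0 := fun x hx =>
    image_eq_zero_of_notMem_tsupport fun h' => hx (hφ.2.2 (tsupport_fderiv_subset ℝ h'))
  rw [setIntegral_eq_integral_of_forall_compl_eq_zero fun x hx => by simp [hφ0' x hx],
    setIntegral_eq_integral_of_forall_compl_eq_zero fun x hx => by simp [hφ0 x hx], h1]

/-- The difference of two weak gradients integrates to zero against every test function. Uniqueness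
reduces the infimum in `gradEnergy` to a single value. -/
theorem HasWeakGradient.ae_eq (hΩ : IsOpen Ω) {u : RSpace d → ℝ} {g k : RSpace d → RSpace d}
    (hg : HasWeakGradient Ω u g) (hk : HasWeakGradient Ω u k) : g =ᵐ[volume.restrict Ω] k := by
  have hl : LocallyIntegrableOn (g - k) Ω := fun x hx => (hg.2.1 x hx).sub (hk.2.1 x hx)
  have h := hΩ.ae_eq_zero_of_integral_contDiff_smul_eq_zero hl fun φ hφ hφc hφΩ => by
    have hφt : IsTestFunction Ω φ := ⟨hφ, hφc, hφΩ⟩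
    have hφ0 : ∀ x ∉ Ω, φ x = 0 := fun x hx =>
      image_eq_zero_of_notMem_tsupport fun h' => hx (hφΩ h')
    rw [← setIntegral_eq_integral_of_forall_compl_eq_zero (s := Ω) fun x hx => by simp [hφ0 x hx]]
    have hinteg : Integrable (fun x => φ x • (g - k) x) (volume.restrict Ω) := by
      have h1 : IntegrableOn (fun x => φ x • (g - k) x) (tsupport φ) :=
        (hl.integrableOn_compact_subset hφΩ hφc.isCompact).continuousOn_smul
          hφ.continuous.continuousOn hφc.isCompact
      exact ((integrableOn_iff_integrable_of_support_subset fun x hx =>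
        subset_tsupport φ fun h0 => hx (by simp [h0])).1 h1).restrict
    refine ext_inner_left ℝ fun v => ?_
    rw [← integral_inner (𝕜 := ℝ) hinteg v, inner_zero_right]
    have h2 := (hg.2.2 φ hφt v).symm.trans (hk.2.2 φ hφt v)
    rw [neg_inj, ← sub_eq_zero, ← integral_sub (hφt.integrable_inner_mul hg.2.1 v)
      (hφt.integrable_inner_mul hk.2.1 v)] at h2
    rw [← h2]
    refine integral_congr_ae (Eventually.of_forall fun x => ?_)
    simp only [Pi.sub_apply, real_inner_smul_right, inner_sub_right, real_inner_comm v]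
    ring
  refine (ae_restrict_iff' hΩ.measurableSet).2 (h.mono fun x hx hxΩ => ?_)
  exact sub_eq_zero.1 (hx hxΩ)

theorem HasWeakGradient.gradEnergy_eq (hΩ : IsOpen Ω) {u : RSpace d → ℝ}
    {g : RSpace d → RSpace d} (hg : HasWeakGradient Ω u g) :
    gradEnergy Ω p u = ∫⁻ x in Ω, ‖g x‖ₑ ^ p :=
  le_antisymm (iInf₂_le g hg) (le_iInf₂ fun k hk =>
    (lintegral_congr_ae ((hg.ae_eq hΩ hk).mono fun x hx => by simp only [hx])).le)

theorem memLp_ofReal_iff {E : Type*} [NormedAddCommGroup E] (hp : 0 < p) {f : RSpace d → E}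
    {μ : Measure (RSpace d)} : MemLp f (ENNReal.ofReal p) μ ↔
      AEStronglyMeasurable f μ ∧ ∫⁻ x, ‖f x‖ₑ ^ p ∂μ ≠ ⊤ := by
  rw [MemLp, eLpNorm_lt_top_iff_lintegral_rpow_enorm_lt_top (by simpa using hp) ENNReal.ofReal_ne_top,
    ENNReal.toReal_ofReal hp.le, lt_top_iff_ne_top]

theorem HasWeakGradient.memW1p (hp : 0 < p) {u : RSpace d → ℝ}
    {g : RSpace d → RSpace d} (hu : MemLp u (ENNReal.ofReal p) (volume.restrict Ω))
    (hg : HasWeakGradient Ω u g) (hgp : ∫⁻ x in Ω, ‖g x‖ₑ ^ p ≠ ⊤) : MemW1p Ω p u :=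
  ⟨hu, g, hg, (memLp_ofReal_iff hp).2 ⟨hg.2.1.aestronglyMeasurable, hgp⟩⟩

/-- An `L^q` function on `Ω` has a measurable representative that is locally integrable on the
whole space. -/
theorem MemLp.exists_measurable_locallyIntegrable (hΩ : MeasurableSet Ω) {q : ℝ≥0∞} (hq : 1 ≤ q)
    {u : RSpace d → ℝ} (hu : MemLp u q (volume.restrict Ω)) :
    ∃ w : RSpace d → ℝ, Measurable w ∧ LocallyIntegrable w ∧ u =ᵐ[volume.restrict Ω] w := by
  refine ⟨Ω.indicator (hu.1.mk u), hu.1.stronglyMeasurable_mk.measurable.indicator hΩ, ?_, ?_⟩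
  · exact ((memLp_indicator_iff_restrict hΩ).2 (hu.ae_eq hu.1.ae_eq_mk)).locallyIntegrable hq
  · exact hu.1.ae_eq_mk.trans (indicator_ae_eq_restrict hΩ).symm

end Congruence

/-! ### The limits -/

section Main

variable {d : ℕ} {p : ℝ} {Ω : Set (RSpace d)} {ι : Type*} {l : Filter ι} [l.NeBot]
  [l.IsCountablyGenerated] {ν : ι → RSpace d → ℝ≥0∞} {e : RSpace d}

/-- Both sides depend only on `u` in `Ω`, so `u` may be replaced by its extension, whose weak
gradient on the whole space the upper bound needs. -/
theorem IsLevyFamily.tendsto_of_memW1p (hν : IsLevyFamily l p ν) (hp : 1 ≤ p) (he : ‖e‖ = 1)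
    (hext : IsSobolevExtensionDomain Ω p) {u : RSpace d → ℝ} (hu : MemW1p Ω p u) :
    Tendsto (fun i => nonlocalEnergy Ω p (ν i) u) l
      (𝓝 (ENNReal.ofReal (sphereMean p e) * gradEnergy Ω p u)) := by
  have hp0 : 0 < p := zero_lt_one.trans_le hp
  have hq : 1 ≤ ENNReal.ofReal p := by simpa using hp
  obtain ⟨hΩ, T, C, hT⟩ := hext
  have hU : hu.1.toLp u ∈ sobolevSpace Ω p := by
    obtain ⟨g, hg, hgp⟩ := hu.2
    exact ⟨Lp.memLp _, g, hg.congr hu.1.coeFn_toLp.symm, hgp⟩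
  obtain ⟨v, huv, hvm, hvp, G₀, hG₀, hG₀p⟩ : ∃ v : RSpace d → ℝ, u =ᵐ[volume.restrict Ω] v ∧
      Measurable v ∧ MemW1p univ p v :=
    ⟨(T ⟨hu.1.toLp u, hU⟩).1, hu.1.coeFn_toLp.symm.trans (hT ⟨hu.1.toLp u, hU⟩).1.symm,
      (Lp.stronglyMeasurable _).measurable, (T ⟨hu.1.toLp u, hU⟩).2⟩
  obtain ⟨G, hGm, hGG⟩ : ∃ G, Measurable G ∧ G₀ =ᵐ[volume.restrict univ] G :=
    ⟨_, hG₀p.1.stronglyMeasurable_mk.measurable, hG₀p.1.ae_eq_mk⟩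
  have hG := hG₀.congr_right hGG
  have hGp := hG₀p.ae_eq hGG
  rw [Measure.restrict_univ] at hvp hGp
  have hvl := hvp.locallyIntegrable hq
  have hGl := hGp.locallyIntegrable hq
  have hGfin := ((memLp_ofReal_iff hp0).1 hGp).2
  have hvfin : ∫⁻ x in Ω, ‖v x‖ₑ ^ p ≠ ⊤ :=
    ne_top_of_le_ne_top ((memLp_ofReal_iff hp0).1 hvp).2 (setLIntegral_le_lintegral _ _)
  simp_rw [nonlocalEnergy_congr huv]
  rw [gradEnergy_congr huv, (hG.restrict Ω).gradEnergy_eq hΩ]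
  refine tendsto_of_le_liminf_of_limsup_le
    (hν.lintegral_hasWeakGradient_le hp he hΩ hvm hvl (hG.restrict Ω) hGl) ?_
  refine ENNReal.le_of_forall_pos_le_add fun η hη _ => ?_
  obtain ⟨δ, hδ, hδ1, hle⟩ := exists_lintegral_kernel_le_sobolev hp he hΩ hvm hvl hGm hGl hGfin hG
    (ENNReal.coe_pos.2 hη)
  exact hν.limsup_nonlocalEnergy_le hp hΩ.measurableSet hvm hvfin hδ fun i =>
    hle (ν i) (hν.measurable i) (hν.radial i) (hν.mass_le_one hp0 hδ1 i)

/-- Outside `W^{1,p}` both sides are infinite: a finite lower limit of the energies would produce a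
weak gradient in `L^p(Ω)`. -/
theorem IsLevyFamily.tendsto_of_memLp (hν : IsLevyFamily l p ν) (hp : 1 < p) (he : ‖e‖ = 1)
    (hext : IsSobolevExtensionDomain Ω p) {u : RSpace d → ℝ}
    (hu : MemLp u (ENNReal.ofReal p) (volume.restrict Ω)) :
    Tendsto (fun i => nonlocalEnergy Ω p (ν i) u) l
      (𝓝 (ENNReal.ofReal (sphereMean p e) * gradEnergy Ω p u)) := by
  have hp0 : 0 < p := zero_lt_one.trans hp
  have hΩ := hext.1
  by_cases hW : MemW1p Ω p u
  · exact hν.tendsto_of_memW1p hp.le he hext hW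
  have hgrad : gradEnergy Ω p u = ⊤ := by
    simp only [gradEnergy, iInf_eq_top]
    intro g hg
    by_contra hfin
    exact hW (hg.memW1p hp0 hu hfin)
  have hlim : liminf (fun i => nonlocalEnergy Ω p (ν i) u) l = ⊤ := by
    by_contra hfin
    obtain ⟨w, hwm, hwl, huw⟩ := MemLp.exists_measurable_locallyIntegrable hΩ.measurableSet
      (by simpa using hp.le) hu
    simp_rw [nonlocalEnergy_congr huw] at hfin
    obtain ⟨g, hg, hgp⟩ := hν.exists_hasWeakGradient hp he hΩ hwm hwl hfin
    exact hW ((hg.congr huw.symm).memW1p hp0 hu hgp)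
  rw [hgrad, ENNReal.mul_top (ofReal_sphereMean_ne_zero hp0 he)]
  exact tendsto_of_le_liminf_of_limsup_le hlim.ge le_top

/-- For infinite variation the lower bound alone forces divergence; otherwise `u` has an extension
and both bounds apply to it. -/
theorem IsLevyFamily.tendsto_bvSeminorm (hν : IsLevyFamily l 1 ν) (he : ‖e‖ = 1)
    (hext : IsBVExtensionDomain Ω) {u : RSpace d → ℝ} (hu : MemLp u 1 (volume.restrict Ω)) :
    Tendsto (fun i => nonlocalEnergy Ω 1 (ν i) u) l
      (𝓝 (ENNReal.ofReal (sphereMean 1 e) * bvSeminorm Ω u)) := by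
  obtain ⟨hΩ, T, C, hT⟩ := hext
  by_cases hbv : bvSeminorm Ω u = ⊤
  · obtain ⟨w, hwm, hwl, huw⟩ := MemLp.exists_measurable_locallyIntegrable hΩ.measurableSet
      le_rfl hu
    have hle := hν.bvSeminorm_le he hΩ hwm hwl
    rw [← bvSeminorm_congr huw, hbv] at hle
    simp_rw [← nonlocalEnergy_congr huw] at hle
    rw [hbv]
    refine tendsto_of_le_liminf_of_limsup_le hle ?_
    rw [ENNReal.mul_top (ofReal_sphereMean_ne_zero one_pos he)]
    exact le_top
  have hU : hu.toLp u ∈ bvSpace Ω := by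
    refine ⟨Lp.memLp _, ?_⟩
    rw [bvSeminorm_congr hu.coeFn_toLp]
    exact lt_top_iff_ne_top.2 hbv
  obtain ⟨v, huv, hvm, ⟨hv1, hvbv⟩, hfr⟩ : ∃ v : RSpace d → ℝ, u =ᵐ[volume.restrict Ω] v ∧
      Measurable v ∧ MemBV univ v ∧ variationMeasure v (frontier Ω) = 0 :=
    ⟨(T ⟨hu.toLp u, hU⟩).1, hu.coeFn_toLp.symm.trans (hT ⟨hu.toLp u, hU⟩).1.symm,
      (Lp.stronglyMeasurable _).measurable, (T ⟨hu.toLp u, hU⟩).2, (hT ⟨hu.toLp u, hU⟩).2.2⟩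
  rw [Measure.restrict_univ] at hv1
  have hvl := hv1.locallyIntegrable le_rfl
  have hvfin : ∫⁻ x in Ω, ‖v x‖ₑ ^ (1 : ℝ) ≠ ⊤ := by
    simp_rw [ENNReal.rpow_one]
    exact ne_top_of_le_ne_top (memLp_one_iff_integrable.1 hv1).2.ne (setLIntegral_le_lintegral _ _)
  simp_rw [nonlocalEnergy_congr huv]
  rw [bvSeminorm_congr huv]
  refine tendsto_of_le_liminf_of_limsup_le (hν.bvSeminorm_le he hΩ hvm hvl) ?_
  -- The error `1 / n` is `⊤` for `n = 0`; the upper bound allows any positive error in `[0, ∞]`.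
  have hη : Tendsto (fun n : ℕ => ENNReal.ofReal (sphereMean 1 e) *
      (bvSeminorm Ω v + (n : ℝ≥0∞)⁻¹)) atTop
      (𝓝 (ENNReal.ofReal (sphereMean 1 e) * (bvSeminorm Ω v + 0))) :=
    ENNReal.Tendsto.const_mul (tendsto_const_nhds.add ENNReal.tendsto_inv_nat_nhds_zero)
      (Or.inr ENNReal.ofReal_ne_top)
  rw [add_zero] at hη
  refine ge_of_tendsto' hη fun n => ?_
  obtain ⟨δ, hδ, hδ1, hle⟩ := exists_lintegral_kernel_le_bv he hΩ hvm hvl hvbv.ne hfr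
    (ENNReal.inv_pos.2 (ENNReal.natCast_ne_top n))
  exact hν.limsup_nonlocalEnergy_le le_rfl hΩ.measurableSet hvm hvfin hδ fun i =>
    hle (ν i) (hν.measurable i) (hν.radial i) (hν.mass_le_one one_pos hδ1 i)

end Main

theorem theorem1p2 (d : ℕ) (p : ℝ) (hp : 1 ≤ p) (Ω : Set (RSpace d))
    (ν : ℝ → RSpace d → ℝ≥0∞) (hν : IsLevyDiracApprox p ν)
    (e : RSpace d) (he : ‖e‖ = 1) :
    (IsSobolevExtensionDomain Ω p →
      ∀ u : RSpace d → ℝ,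
        (1 < p ∧ MemLp u (ENNReal.ofReal p) (volume.restrict Ω)) ∨ (p = 1 ∧ MemW1p Ω 1 u) →
        Tendsto (fun ε => nonlocalEnergy Ω p (ν ε) u) (𝓝[>] (0 : ℝ))
          (𝓝 (ENNReal.ofReal (sphereMean p e) * gradEnergy Ω p u))) ∧
    (p = 1 → IsBVExtensionDomain Ω →
      ∀ u : RSpace d → ℝ, MemLp u 1 (volume.restrict Ω) →
        Tendsto (fun ε => nonlocalEnergy Ω 1 (ν ε) u) (𝓝[>] (0 : ℝ))
          (𝓝 (ENNReal.ofReal (sphereMean 1 e) * bvSeminorm Ω u))) := by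
  have hν' := hν.isLevyFamily
  have hpos : ∀ᶠ ε : ℝ in 𝓝[>] (0 : ℝ), ν (if 0 < ε then ε else 1) = ν ε := by
    filter_upwards [self_mem_nhdsWithin] with ε hε
    rw [if_pos (mem_Ioi.1 hε)]
  refine ⟨fun hext u hu => ?_, ?_⟩
  · have hlim : Tendsto (fun ε => nonlocalEnergy Ω p (ν (if 0 < ε then ε else 1)) u) (𝓝[>] (0 : ℝ))
        (𝓝 (ENNReal.ofReal (sphereMean p e) * gradEnergy Ω p u)) := by
      rcases hu with ⟨hp1, hu⟩ | ⟨rfl, hu⟩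
      · exact hν'.tendsto_of_memLp hp1 he hext hu
      · exact hν'.tendsto_of_memW1p hp he hext hu
    exact hlim.congr' (hpos.mono fun ε hε => by simp only [hε])
  · rintro rfl hext u hu
    exact (hν'.tendsto_bvSeminorm he hext hu).congr' (hpos.mono fun ε hε => by simp only [hε])
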